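/- A tournament is a finite loopless digraph in which any two distinct vertices are joined by exactly one arc. A digraph is Eulerian if it has a directed closed trail that visits every vertex and uses every arc exactly once (a single vertex without arcs is Eulerian). An instance of Eulerian Strong Component Arc Deletion on tournaments is a pair $(T,k)$ of a tournament $T$ and an integer $k\ge 0$; it is a yes-instance if there is a set $A'$ of at most $k$ arcs of $T$ such that every strong component of $T-A'$ is Eulerian. Theorem. Eulerian Strong Component Arc Deletion on tournaments, parameterized by $k$, is fixed-parameter tractable: there are an algorithm, a function $f$ and a constant $c$ such that the algorithm decides every instance $(T,k)$ in time at most $f(k)\,|T|^{c}$, where $|T|$ is the size of the adjacency matrix description of $T$. Moreover the problem has a kernel with at most $4k(4k+2)$ vertices: there is a polynomial-time algorithm that maps each instance $(T,k)$ to an instance $(T',k')$ of the same problem (so $T'$ is again a tournament and $k'\ge 0$) such that 1. $(T,k)$ is a yes-instance if and only if $(T',k')$ is a yes-instance; 2. $k'\le h(k)$ and $|T'|\le g(k)$ for some functions $h$ and $g$ of $k$ only; 3. $|V(T')|\le 4k(4k+2)$, with the sole exception of the no-instances with $k=0$, for which $|V(T')|\le 4$. -/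

import Mathlib

namespace Digraph

variable {V : Type*}

/-- Every vertex can be reached from every vertex by a (possibly trivial) directed path.
The digraph without vertices is not counted as strongly connected. -/
def IsStrong (D : Digraph V) : Prop :=
  Nonempty V ∧ ∀ x y : V, Relation.ReflTransGen D.Adj x y

/-- The subgraph of `D` induced by a set of vertices. -/
def induceOn (D : Digraph V) (S : Set V) : Digraph S where
  Adj x y := D.Adj x y

/-- `S` is the vertex set of a strong component of `D`: the subgraph induced by `S` is strongly
connected, and `S` is maximal with this property. -/
def IsStrongComponent (D : Digraph V) (S : Set V) : Prop :=
  Maximal (fun X : Set V => (D.induceOn X).IsStrong) S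

/-- The list of vertices `w = [v₀, v₁, …, vₘ]`, `m ≥ 0`, is a closed trail of `D`: each `vᵢ vᵢ₊₁`
is an arc of `D`, these arcs are pairwise distinct, and `v₀ = vₘ`. -/
structure IsClosedTrail (D : Digraph V) (w : List V) : Prop where
  ne_nil : w ≠ []
  chain : w.IsChain D.Adj
  closed : w.head? = w.getLast?
  arcs_nodup : (w.zip w.tail).Nodup

/-- `D` has a closed trail that visits every vertex and uses every arc (exactly once, since the
arcs of a trail are distinct). -/
def IsEulerian (D : Digraph V) : Prop :=
  ∃ w : List V, D.IsClosedTrail w ∧ (∀ v : V, v ∈ w) ∧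
    ∀ x y : V, D.Adj x y → (x, y) ∈ w.zip w.tail

/-- The digraph `D - A`. -/
def deleteArcs (D : Digraph V) (A : Set (V × V)) : Digraph V where
  Adj x y := D.Adj x y ∧ (x, y) ∉ A

/-- `A` is a set of arcs of `D` such that all strong components of `D - A` are Eulerian. -/
def IsDESCSet (D : Digraph V) (A : Set (V × V)) : Prop :=
  (∀ a ∈ A, D.Adj a.1 a.2) ∧
    ∀ S : Set V, (D.deleteArcs A).IsStrongComponent S → ((D.deleteArcs A).induceOn S).IsEulerian

/-- `D` is a tournament: there are no loops, and any two distinct vertices are joined by exactly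
one arc. -/
def IsTournament (D : Digraph V) : Prop :=
  (∀ x : V, ¬ D.Adj x x) ∧ ∀ x y : V, x ≠ y → Xor (D.Adj x y) (D.Adj y x)

end Digraph

/-! A random-access machine over the natural numbers with addition and truncated subtraction
(but no multiplication) at unit cost, programmed by structured programs. Such a machine and a
Turing machine simulate each other with polynomial overhead. -/

namespace RAM

/-- The memory: registers, and infinite arrays of cells that are addressed indirectly. -/
structure Memory where
  reg : ℕ → ℕ
  arr : ℕ → ℕ → ℕ

/-- Expressions: constants, registers, array cells, sums and truncated differences. -/
inductive Expr where
  | const (n : ℕ)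
  | reg (x : ℕ)
  | get (a : ℕ) (i : Expr)
  | add (e₁ e₂ : Expr)
  | sub (e₁ e₂ : Expr)

/-- The value of an expression. -/
def Expr.eval (s : Memory) : Expr → ℕ
  | .const n => n
  | .reg x => s.reg x
  | .get a i => s.arr a (i.eval s)
  | .add e₁ e₂ => e₁.eval s + e₂.eval s
  | .sub e₁ e₂ => e₁.eval s - e₂.eval s

/-- The number of elementary operations needed to evaluate an expression. -/
def Expr.cost : Expr → ℕ
  | .const _ => 1
  | .reg _ => 1
  | .get _ i => i.cost + 1
  | .add e₁ e₂ => e₁.cost + e₂.cost + 1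
  | .sub e₁ e₂ => e₁.cost + e₂.cost + 1

/-- Programs. A test succeeds when the value of the expression is nonzero. -/
inductive Program where
  | skip
  | setReg (x : ℕ) (e : Expr)
  | setArr (a : ℕ) (i e : Expr)
  | seq (p q : Program)
  | ite (e : Expr) (p q : Program)
  | while (e : Expr) (p : Program)

/-- Write `v` to register `x`. -/
def Memory.setReg (s : Memory) (x v : ℕ) : Memory :=
  { s with reg := Function.update s.reg x v }

/-- Write `v` to cell `i` of array `a`. -/
def Memory.setArr (s : Memory) (a i v : ℕ) : Memory :=
  { s with arr := Function.update s.arr a (Function.update (s.arr a) i v) }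

/-- `Exec p s t s'`: started in memory `s`, the program `p` halts after exactly `t` steps, in
memory `s'`. -/
inductive Exec : Program → Memory → ℕ → Memory → Prop where
  | skip (s : Memory) : Exec .skip s 1 s
  | setReg (s : Memory) (x : ℕ) (e : Expr) :
      Exec (.setReg x e) s (e.cost + 1) (s.setReg x (e.eval s))
  | setArr (s : Memory) (a : ℕ) (i e : Expr) :
      Exec (.setArr a i e) s (i.cost + e.cost + 1) (s.setArr a (i.eval s) (e.eval s))
  | seq {p q : Program} {s s₁ s₂ : Memory} {t₁ t₂ : ℕ} :
      Exec p s t₁ s₁ → Exec q s₁ t₂ s₂ → Exec (.seq p q) s (t₁ + t₂) s₂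
  | iteTrue {e : Expr} {p q : Program} {s s₁ : Memory} {t : ℕ} :
      e.eval s ≠ 0 → Exec p s t s₁ → Exec (.ite e p q) s (e.cost + 1 + t) s₁
  | iteFalse {e : Expr} {p q : Program} {s s₁ : Memory} {t : ℕ} :
      e.eval s = 0 → Exec q s t s₁ → Exec (.ite e p q) s (e.cost + 1 + t) s₁
  | whileTrue {e : Expr} {p : Program} {s s₁ s₂ : Memory} {t₁ t₂ : ℕ} :
      e.eval s ≠ 0 → Exec p s t₁ s₁ → Exec (.while e p) s₁ t₂ s₂ →
        Exec (.while e p) s (e.cost + 1 + t₁ + t₂) s₂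
  | whileFalse {e : Expr} {p : Program} {s : Memory} :
      e.eval s = 0 → Exec (.while e p) s (e.cost + 1) s

end RAM

/-- An instance: a tournament on the vertices `0, …, n - 1` and a nonnegative integer `k`, the
parameter. -/
structure TournamentInstance where
  n : ℕ
  T : Digraph (Fin n)
  isTournament : T.IsTournament
  k : ℕ

namespace TournamentInstance

/-- The number of memory cells that hold the tournament: its order and its adjacency matrix. -/
def size (I : TournamentInstance) : ℕ := I.n * I.n + 1

open Classical in
/-- The adjacency matrix of the tournament, written row by row, and followed by zeros. -/
noncomputable def matrix (I : TournamentInstance) (p : ℕ) : ℕ :=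
  if ∃ i j : Fin I.n, p = i * I.n + j ∧ I.T.Adj i j then 1 else 0

/-- The input memory: `n` is in register 0, `k` is in register 1, the adjacency matrix is in
array 0, and everything else is zero. -/
noncomputable def input (I : TournamentInstance) : RAM.Memory where
  reg x := if x = 0 then I.n else if x = 1 then I.k else 0
  arr a p := if a = 0 then I.matrix p else 0

/-- The memory `s` presents the instance `I` as output: register 0 holds `n`, register 1 holds
`k`, and the first `n²` cells of array 0 hold the adjacency matrix. -/
def IsOutput (I : TournamentInstance) (s : RAM.Memory) : Prop :=
  s.reg 0 = I.n ∧ s.reg 1 = I.k ∧ ∀ p < I.n * I.n, s.arr 0 p = I.matrix p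

end TournamentInstance

/-- The parameterized problem `L`, on tournaments, is fixed-parameter tractable: a single program
decides it (with the answer, 1 or 0, in register 0) in at most `f(k) |T|^c` steps, for some
function `f` of the parameter and some constant `c`. -/
def FixedParameterTractable (L : Set TournamentInstance) : Prop :=
  ∃ (p : RAM.Program) (f : ℕ → ℕ) (c : ℕ), ∀ I : TournamentInstance,
    ∃ (t : ℕ) (s : RAM.Memory), RAM.Exec p I.input t s ∧ t ≤ f I.k * I.size ^ c ∧
      (I ∈ L → s.reg 0 = 1) ∧ (I ∉ L → s.reg 0 = 0)

/-- `K` is computed by a program in time polynomial in the size of the input, in which the number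
`k` counts with the number of its binary digits. -/
def PolyTimeComputable (K : TournamentInstance → TournamentInstance) : Prop :=
  ∃ (p : RAM.Program) (C c : ℕ), ∀ I : TournamentInstance,
    ∃ (t : ℕ) (s : RAM.Memory), RAM.Exec p I.input t s ∧
      t ≤ C * (I.size + Nat.size I.k) ^ c ∧ (K I).IsOutput s

/-- `K` is a kernelization of `L`: a polynomial-time map to equivalent instances, such that the
new parameter and the size of the new tournament are bounded by functions of the old parameter. -/
def IsKernelization (L : Set TournamentInstance) (K : TournamentInstance → TournamentInstance) :
    Prop :=
  PolyTimeComputable K ∧ (∀ I, I ∈ L ↔ K I ∈ L) ∧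
    (∃ h : ℕ → ℕ, ∀ I, (K I).k ≤ h I.k) ∧ ∃ g : ℕ → ℕ, ∀ I, (K I).size ≤ g I.k

/-- Eulerian Strong Component Arc Deletion on tournaments: the instances `(T, k)` in which at most
`k` arcs of `T` can be deleted so that all strong components of what remains are Eulerian. -/
def EulerianStrongComponentArcDeletion : Set TournamentInstance :=
  {I | ∃ A : Finset (Fin I.n × Fin I.n), I.T.IsDESCSet A ∧ A.card ≤ I.k}

/-!
A strongly connected digraph is Eulerian if and only if the in-degree of each vertex is equal to
its out-degree. Hence a set of arcs of a tournament `T` is a solution if and only if the digraph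
`D` that remains can be divided into levels such that no arc of `D` goes down and every level is
balanced (`isCyclicallyBalanced_iff`, `Digraph.exists_isDESCSet_iff`). All arguments are about such
levels; the problem in this form is `Solvable`.

If at most `κ` arcs are deleted, at most `2κ` vertices are affected, and the in-degree of an
unaffected vertex is determined by its level, and conversely (`IsSolution.inDeg_eq_iff`). Three
reductions follow from this.

* If `4κ + 2` vertices have the same in-degree, then they lie in a common level, the same one in
  all solutions (`IsSolution.exists_level`). The arcs of `T` that go down with respect to this level
  have to be deleted, the level itself has to be made balanced at least cost, and it can then be
  replaced by a transitive tournament between those below and those above (`solvable_iff_split`).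
  This decreases the number of vertices on directed triangles.
* Otherwise, an arc in `6κ + 2` triangles has to be deleted, and can be reversed instead
  (`solvable_iff_reverseArc`). This decreases the parameter.
* Strong components that are already balanced can be removed (`solvable_unbalancedPart_iff`). If the
  other rules do not apply, at most `κ(16κ + 8) = 4κ(4κ + 2)` vertices are left in a yes-instance
  (`card_unbalancedPart_le`). Any other instance is replaced by a no-instance with four vertices.

The parameter decreases during the reduction, but the thresholds refer to its initial value `κ`,
since then all the bounds above hold for the current parameter, too.

The least number of arcs that have to be deleted to make a tournament `L` balanced is found by a
minimum cost flow argument. The balanced subgraphs of `L` correspond to the tournaments with the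
same scores, in which exactly the arcs of the subgraph are reversed. Starting from `L`, reverse
cycles more than half of whose arcs have not been reversed before; if there is none, the maximum
gain of walks to a vertex is a potential that certifies optimality
(`IsReorientation.isBalanceCost_of_no_gain`). Maximum weight walks are computed by dynamic
programming, and a shortest closed walk of positive gain is a cycle (`IsBestWalk.injective`).

Programs are written in a language with bounded sums, bounded suprema and bounded loops (`HExpr`,
`HProg`), which has a denotational semantics. It is compiled to the machine; one theorem
(`HProg.exec_toProg`) says that the compiled program is correct and that its time is bounded by an
explicit function of the bound on the ranges, which is polynomial (`HProg.polyBounded_time`). So the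
kernelization takes polynomial time. For fixed-parameter tractability the kernel is solved by trying
all sets of arcs, which are encoded by the numbers below `2 ^ (n * n)`.
-/

/-! ### Programs with bounded loops, and their compilation -/

/-- Expressions with bounded sums and suprema. In `sum x b e` and `sup x b e` the register `x` is
a bound variable, which runs through the numbers below the content of register `b`. -/
inductive HExpr where
  | const (n : ℕ)
  | reg (x : ℕ)
  | get (a : ℕ) (i : HExpr)
  | add (e f : HExpr)
  | sub (e f : HExpr)
  | ite (c e f : HExpr)
  | sum (x b : ℕ) (e : HExpr)
  | sup (x b : ℕ) (e : HExpr)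

namespace HExpr

open RAM Finset

/-- The value of an expression. -/
def eval : HExpr → Memory → ℕ
  | const n, _ => n
  | reg x, s => s.reg x
  | get a i, s => s.arr a (i.eval s)
  | add e f, s => e.eval s + f.eval s
  | sub e f, s => e.eval s - f.eval s
  | ite c e f, s => if c.eval s ≠ 0 then e.eval s else f.eval s
  | sum x b e, s => ∑ i ∈ range (s.reg b), e.eval (s.setReg x i)
  | sup x b e, s => (range (s.reg b)).sup fun i => e.eval (s.setReg x i)

/-- All registers that occur are below `t`, all ranges are given by registers from `bs`, and these
registers are not used as bound variables. -/
def ok (bs : List ℕ) (t : ℕ) : HExpr → Bool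
  | const _ => true
  | reg x => x < t
  | get _ i => i.ok bs t
  | add e f => e.ok bs t && f.ok bs t
  | sub e f => e.ok bs t && f.ok bs t
  | ite c e f => c.ok bs t && e.ok bs t && f.ok bs t
  | sum x b e => b ∈ bs && b < t && x ∉ bs && x < t && e.ok bs t
  | sup x b e => b ∈ bs && b < t && x ∉ bs && x < t && e.ok bs t

/-- The loop that evaluates a bounded sum or supremum: `p` evaluates the body into register
`t + 3`, and `upd` is the new value of the accumulator, which is register `t`. -/
def foldProg (x b t : ℕ) (p : Program) (upd : Expr) : Program :=
  .seq (.setReg t (.const 0)) <| .seq (.setReg (t + 1) (.const 0)) <|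
  .seq (.setReg (t + 2) (.reg x)) <|
  .seq (.while (.sub (.reg b) (.reg (t + 1))) <|
    .seq (.setReg x (.reg (t + 1))) <| .seq p <| .seq (.setReg t upd) <|
      .setReg (t + 1) (.add (.reg (t + 1)) (.const 1))) <|
  .setReg x (.reg (t + 2))

/-- The program that writes the value of an expression to register `t`, with the registers above
`t` as a scratch area. -/
def toProg : HExpr → ℕ → Program
  | const n, t => .setReg t (.const n)
  | reg x, t => .setReg t (.reg x)
  | get a i, t => .seq (i.toProg t) (.setReg t (.get a (.reg t)))
  | add e f, t => .seq (e.toProg t) <| .seq (f.toProg (t + 1)) <|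
      .setReg t (.add (.reg t) (.reg (t + 1)))
  | sub e f, t => .seq (e.toProg t) <| .seq (f.toProg (t + 1)) <|
      .setReg t (.sub (.reg t) (.reg (t + 1)))
  | ite c e f, t => .seq (c.toProg t) (.ite (.reg t) (e.toProg t) (f.toProg t))
  | sum x b e, t => foldProg x b t (e.toProg (t + 3)) (.add (.reg t) (.reg (t + 3)))
  | sup x b e, t => foldProg x b t (e.toProg (t + 3))
      (.add (.reg t) (.sub (.reg (t + 3)) (.reg t)))

/-- A bound for the running time of `toProg`, when all ranges are at most `B`. -/
def time (B : ℕ) : HExpr → ℕ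
  | const _ => 2
  | reg _ => 2
  | get _ i => i.time B + 3
  | add e f => e.time B + f.time B + 4
  | sub e f => e.time B + f.time B + 4
  | ite c e f => c.time B + e.time B + f.time B + 2
  | sum _ _ e => B * (e.time B + 16) + 16
  | sup _ _ e => B * (e.time B + 16) + 16

end HExpr

/-- Two memories agree on all arrays and on the registers below `t`. -/
def RAM.Agree (t : ℕ) (s s' : RAM.Memory) : Prop :=
  s.arr = s'.arr ∧ ∀ x < t, s.reg x = s'.reg x

namespace RAM

@[simp] theorem Memory.setReg_reg (s : Memory) (x v y : ℕ) :
    (s.setReg x v).reg y = if y = x then v else s.reg y := by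
  simp [Memory.setReg, Function.update_apply]

@[simp] theorem Memory.setReg_arr (s : Memory) (x v : ℕ) : (s.setReg x v).arr = s.arr := rfl

@[simp] theorem Memory.setArr_reg (s : Memory) (a i v : ℕ) : (s.setArr a i v).reg = s.reg := rfl

theorem Memory.setArr_arr (s : Memory) (a i v b j : ℕ) :
    (s.setArr a i v).arr b j = if b = a ∧ j = i then v else s.arr b j := by
  by_cases h : b = a
  · subst h; simp [Memory.setArr, Function.update_apply]
  · simp [Memory.setArr, h]

theorem Memory.ext' {s s' : Memory} (h : ∀ x, s.reg x = s'.reg x)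
    (h' : ∀ a p, s.arr a p = s'.arr a p) : s = s' := by
  cases s; cases s'
  simp only [Memory.mk.injEq]
  exact ⟨funext h, funext fun a => funext (h' a)⟩

theorem Agree.refl (t : ℕ) (s : Memory) : Agree t s s := ⟨rfl, fun _ _ => rfl⟩

theorem Agree.symm {t : ℕ} {s s' : Memory} (h : Agree t s s') : Agree t s' s :=
  ⟨h.1.symm, fun x hx => (h.2 x hx).symm⟩

theorem Agree.trans {t : ℕ} {s s' s'' : Memory} (h : Agree t s s') (h' : Agree t s' s'') :
    Agree t s s'' :=
  ⟨h.1.trans h'.1, fun x hx => (h.2 x hx).trans (h'.2 x hx)⟩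

theorem Agree.mono {t t' : ℕ} {s s' : Memory} (h : Agree t' s s') (ht : t ≤ t') : Agree t s s' :=
  ⟨h.1, fun x hx => h.2 x (hx.trans_le ht)⟩

theorem Agree.setReg {t : ℕ} {s s' : Memory} (h : Agree t s s') (x v : ℕ) :
    Agree t (s.setReg x v) (s'.setReg x v) :=
  ⟨h.1, fun y hy => by simp [h.2 y hy]⟩

theorem Agree.setArr {t : ℕ} {s s' : Memory} (h : Agree t s s') (a i v : ℕ) :
    Agree t (s.setArr a i v) (s'.setArr a i v) :=
  ⟨by simp [Memory.setArr, h.1], fun y hy => h.2 y hy⟩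

theorem Agree.setReg_right {t : ℕ} {s s' : Memory} (h : Agree t s s') {x : ℕ} (hx : t ≤ x)
    (v : ℕ) : Agree t s (s'.setReg x v) :=
  ⟨h.1, fun y hy => by simp [h.2 y hy, (hy.trans_le hx).ne]⟩

theorem Agree.setReg_left {t : ℕ} {s s' : Memory} (h : Agree t s s') {x : ℕ} (hx : t ≤ x)
    (v : ℕ) : Agree t (s.setReg x v) s' :=
  (h.symm.setReg_right hx v).symm

/-- A loop that counts in register `z` up to the content of register `b`. The predicate `I i`
describes the memory after `i` rounds. -/
theorem exec_count {b z : ℕ} {p : Program} {N T : ℕ} (I : ℕ → Memory → Prop)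
    (hI : ∀ i s, I i s → s.reg b = N ∧ s.reg z = i)
    (hp : ∀ i < N, ∀ s, I i s → ∃ τ s', Exec p s τ s' ∧ τ ≤ T ∧ I (i + 1) s') {s : Memory}
    (hs : I 0 s) :
    ∃ τ s', Exec (.while (.sub (.reg b) (.reg z)) p) s τ s' ∧ τ ≤ N * (T + 4) + 4 ∧ I N s' := by
  have key : ∀ j i s, i + j = N → I i s →
      ∃ τ s', Exec (.while (.sub (.reg b) (.reg z)) p) s τ s' ∧ τ ≤ j * (T + 4) + 4 ∧ I N s' := by
    intro j
    induction j with
    | zero =>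
      intro i s hi hs
      refine ⟨4, s, ?_, by omega, by simpa [← hi] using hs⟩
      have := hI i s hs
      exact Exec.whileFalse (e := .sub (.reg b) (.reg z)) (by simp [Expr.eval]; omega)
    | succ j ih =>
      intro i s hi hs
      obtain ⟨τ, s', he, hτ, hs'⟩ := hp i (by omega) s hs
      obtain ⟨τ', s'', he', hτ', hs''⟩ := ih (i + 1) s' (by omega) hs'
      refine ⟨_, s'', Exec.whileTrue (e := .sub (.reg b) (.reg z)) ?_ he he', ?_, hs''⟩
      · have := hI i s hs
        simp [Expr.eval]; omega
      · simp only [Expr.cost]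
        nlinarith
  exact key N 0 s (by omega) hs

end RAM

namespace HExpr

open RAM Finset

theorem ok_mono {bs : List ℕ} {t t' : ℕ} (h : t ≤ t') {e : HExpr} (he : e.ok bs t) :
    e.ok bs t' := by
  induction e with
  | const => rfl
  | reg x => simp [ok] at he ⊢; omega
  | get a i ih => simp [ok] at he ⊢; exact ih he
  | add e f ih ih' => simp [ok] at he ⊢; exact ⟨ih he.1, ih' he.2⟩
  | sub e f ih ih' => simp [ok] at he ⊢; exact ⟨ih he.1, ih' he.2⟩
  | ite c e f ih ih' ih'' => simp [ok] at he ⊢; exact ⟨⟨ih he.1.1, ih' he.1.2⟩, ih'' he.2⟩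
  | sum x b e ih => simp [ok] at he ⊢; exact ⟨by grind, ih he.2⟩
  | sup x b e ih => simp [ok] at he ⊢; exact ⟨by grind, ih he.2⟩

theorem eval_congr {bs : List ℕ} {t : ℕ} {e : HExpr} (he : e.ok bs t) {s s' : Memory}
    (h : Agree t s s') : e.eval s = e.eval s' := by
  induction e generalizing s s' with
  | const => rfl
  | reg x => simp [ok] at he; exact h.2 x he
  | get a i ih => simp [ok] at he; simp [eval, ih he h, h.1]
  | add e f ih ih' => simp [ok] at he; simp [eval, ih he.1 h, ih' he.2 h]
  | sub e f ih ih' => simp [ok] at he; simp [eval, ih he.1 h, ih' he.2 h]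
  | ite c e f ih ih' ih'' =>
    simp [ok] at he; simp [eval, ih he.1.1 h, ih' he.1.2 h, ih'' he.2 h]
  | sum x b e ih =>
    simp [ok] at he
    simp [eval, h.2 b (by grind), ih he.2 (h.setReg x _)]
  | sup x b e ih =>
    simp [ok] at he
    simp [eval, h.2 b (by grind), ih he.2 (h.setReg x _)]

theorem exec_foldProg {x b t T N : ℕ} {p : Program} {upd : Expr} {s : Memory} (hbx : b ≠ x)
    (hb : b < t) (hx : x < t) (hN : s.reg b = N) (F G : ℕ → ℕ) (hG : G 0 = 0)
    (hupd : ∀ i (s' : Memory), s'.reg t = G i → s'.reg (t + 3) = F i →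
      upd.eval s' = G (i + 1)) (hcost : upd.cost ≤ 5)
    (hp : ∀ i < N, ∀ s', Agree t s' (s.setReg x i) → ∃ τ s'', Exec p s' τ s'' ∧ τ ≤ T ∧
      Agree (t + 3) s'' s' ∧ s''.reg (t + 3) = F i) :
    ∃ τ s', Exec (foldProg x b t p upd) s τ s' ∧ τ ≤ N * (T + 16) + 16 ∧ Agree t s' s ∧
      s'.reg t = G N := by
  let s₁ := ((s.setReg t 0).setReg (t + 1) 0).setReg (t + 2) (s.reg x)
  have e0 : x ≠ t := by omega
  have e1 : x ≠ t + 1 := by omega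
  have e2 : t + 2 ≠ x := by omega
  have e3 : t ≠ x := by omega
  have e4 : t + 1 ≠ x := by omega
  obtain ⟨τ, s', he, hτ, hs'⟩ := exec_count (b := b) (z := t + 1) (N := N) (T := T + 12)
    (p := .seq (.setReg x (.reg (t + 1))) <| .seq p <| .seq (.setReg t upd) <|
      .setReg (t + 1) (.add (.reg (t + 1)) (.const 1)))
    (I := fun i s' => s'.reg (t + 1) = i ∧ s'.reg (t + 2) = s.reg x ∧ s'.reg t = G i ∧
      Agree t (s'.setReg x (s.reg x)) s) (s := s₁)
    (by
      rintro i s' ⟨h1, h2, h3, h4⟩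
      refine ⟨?_, h1⟩
      have := h4.2 b hb
      simpa [hbx, hN] using this)
    (by
      rintro i hi s' ⟨h1, h2, h3, h4⟩
      obtain ⟨τ, s'', he, hτ, hag, hv⟩ := hp i hi (s'.setReg x i)
        ⟨h4.1, fun y hy => by
          have := h4.2 y hy
          by_cases h : y = x <;> simp_all⟩
      refine ⟨2 + (τ + (upd.cost + 1 + 4)), (s''.setReg t (G (i + 1))).setReg (t + 1) (i + 1),
        ?_, by omega, by simp, ?_, by simp, ?_⟩
      · refine Exec.seq (s₁ := s'.setReg x i) ?_ (Exec.seq he (Exec.seq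
          (s₁ := s''.setReg t (G (i + 1))) ?_ ?_))
        · simpa [Expr.eval, h1, Expr.cost] using Exec.setReg s' x (.reg (t + 1))
        · have h5 : s''.reg t = G i := by
            rw [hag.2 t (by omega)]; simp [h3, e3]
          simpa [hupd i s'' h5 hv] using Exec.setReg s'' t upd
        · have h6 : s''.reg (t + 1) = i := by
            rw [hag.2 (t + 1) (by omega)]; simp [h1]
          simpa [Expr.eval, h6, Expr.cost] using
            Exec.setReg (s''.setReg t (G (i + 1))) (t + 1) (.add (.reg (t + 1)) (.const 1))
      · have := hag.2 (t + 2) (by omega)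
        simp [this, h2, e2]
      · refine ⟨hag.1.trans h4.1, fun y hy => ?_⟩
        have h7 := hag.2 y (by omega)
        have h8 := h4.2 y hy
        have e5 : y ≠ t := by omega
        have e6 : y ≠ t + 1 := by omega
        by_cases h : y = x
        · simp [h]
        · simp [h, e5, e6, h7] at h8 ⊢
          exact h8)
    (by
      refine ⟨by simp [s₁], by simp [s₁], by simp [s₁, hG], rfl, fun y hy => ?_⟩
      have e5 : y ≠ t := by omega
      have e6 : y ≠ t + 1 := by omega
      have e7 : y ≠ t + 2 := by omega
      by_cases h : y = x
      · simp [h]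
      · simp [s₁, h, e5, e6, e7])
  obtain ⟨h1, h2, h3, h4⟩ := hs'
  refine ⟨2 + (2 + (2 + (τ + 2))), s'.setReg x (s.reg x), ?_, ?_, h4, by simp [h3, e3]⟩
  · refine Exec.seq (Exec.setReg s t (.const 0)) (Exec.seq (Exec.setReg _ (t + 1) (.const 0))
      (Exec.seq (s₁ := s₁) ?_ (Exec.seq he ?_)))
    · simpa [Expr.eval, Expr.cost, s₁, e0, e1] using
        Exec.setReg ((s.setReg t 0).setReg (t + 1) 0) (t + 2) (.reg x)
    · simpa [Expr.eval, Expr.cost, h2] using Exec.setReg s' x (.reg (t + 2))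
  · have : N * (T + 12 + 4) = N * (T + 16) := by ring
    omega

/-- The compiled expression is evaluated correctly and within the time bound, and nothing but the
scratch area changes. -/
theorem exec_toProg {bs : List ℕ} {B t : ℕ} {e : HExpr} (he : e.ok bs t) (hbs : ∀ b ∈ bs, b < t)
    {s : Memory} (hB : ∀ b ∈ bs, s.reg b ≤ B) :
    ∃ τ s', Exec (e.toProg t) s τ s' ∧ τ ≤ e.time B ∧ Agree t s' s ∧ s'.reg t = e.eval s := by
  induction e generalizing s t with
  | const n =>
    exact ⟨2, _, Exec.setReg s t (.const n), by simp [time],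
      (Agree.refl t s).setReg_left le_rfl _, by simp [Expr.eval, eval]⟩
  | reg x =>
    exact ⟨2, _, Exec.setReg s t (.reg x), by simp [time],
      (Agree.refl t s).setReg_left le_rfl _, by simp [Expr.eval, eval]⟩
  | get a i ih =>
    simp [ok] at he
    obtain ⟨τ, s', h1, h2, h3, h4⟩ := ih he hbs hB
    refine ⟨_, _, Exec.seq h1 (Exec.setReg s' t (.get a (.reg t))), ?_, h3.setReg_left le_rfl _, ?_⟩
    · simp [time, Expr.cost]; omega
    · simp [Expr.eval, eval, h3.1, h4]
  | add e f ih ih' =>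
    simp [ok] at he
    obtain ⟨τ, s', h1, h2, h3, h4⟩ := ih he.1 hbs hB
    obtain ⟨τ', s'', h1', h2', h3', h4'⟩ := ih' (t := t + 1) (s := s') (ok_mono (by omega) he.2)
      (fun b hb => (hbs b hb).trans (by omega)) (fun b hb => by rw [h3.2 b (hbs b hb)]; exact hB b hb)
    refine ⟨_, _, Exec.seq h1 (Exec.seq h1' (Exec.setReg s'' t (.add (.reg t) (.reg (t + 1))))), ?_,
      ((h3'.mono (by omega)).trans h3).setReg_left le_rfl _, ?_⟩
    · simp [time, Expr.cost]; omega
    · simp [Expr.eval, eval, h4', h3'.2 t (by omega), h4, eval_congr he.2 h3]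
  | sub e f ih ih' =>
    simp [ok] at he
    obtain ⟨τ, s', h1, h2, h3, h4⟩ := ih he.1 hbs hB
    obtain ⟨τ', s'', h1', h2', h3', h4'⟩ := ih' (t := t + 1) (s := s') (ok_mono (by omega) he.2)
      (fun b hb => (hbs b hb).trans (by omega)) (fun b hb => by rw [h3.2 b (hbs b hb)]; exact hB b hb)
    refine ⟨_, _, Exec.seq h1 (Exec.seq h1' (Exec.setReg s'' t (.sub (.reg t) (.reg (t + 1))))), ?_,
      ((h3'.mono (by omega)).trans h3).setReg_left le_rfl _, ?_⟩
    · simp [time, Expr.cost]; omega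
    · simp [Expr.eval, eval, h4', h3'.2 t (by omega), h4, eval_congr he.2 h3]
  | ite c e f ih ih' ih'' =>
    simp [ok] at he
    obtain ⟨τ, s', h1, h2, h3, h4⟩ := ih he.1.1 hbs hB
    have hB' : ∀ b ∈ bs, s'.reg b ≤ B := fun b hb => by rw [h3.2 b (hbs b hb)]; exact hB b hb
    by_cases h : c.eval s = 0
    · obtain ⟨τ', s'', h1', h2', h3', h4'⟩ := ih'' he.2 hbs hB'
      refine ⟨_, _, Exec.seq h1 (Exec.iteFalse (e := .reg t) (by simp [Expr.eval, h4, h]) h1'), ?_,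
        h3'.trans h3, ?_⟩
      · simp [time, Expr.cost]; omega
      · simp [eval, h, h4', eval_congr he.2 h3]
    · obtain ⟨τ', s'', h1', h2', h3', h4'⟩ := ih' he.1.2 hbs hB'
      refine ⟨_, _, Exec.seq h1 (Exec.iteTrue (e := .reg t) (by simp [Expr.eval, h4, h]) h1'), ?_,
        h3'.trans h3, ?_⟩
      · simp [time, Expr.cost]; omega
      · simp [eval, h, h4', eval_congr he.1.2 h3]
  | sum x b e ih =>
    simp [ok] at he
    obtain ⟨τ, s', h1, h2, h3, h4⟩ := exec_foldProg (x := x) (b := b) (t := t) (T := e.time B)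
      (N := s.reg b) (p := e.toProg (t + 3)) (upd := .add (.reg t) (.reg (t + 3))) (s := s)
      (by grind) (by grind) (by grind) rfl
      (fun i => e.eval (s.setReg x i)) (fun n => ∑ i ∈ range n, e.eval (s.setReg x i)) (by simp)
      (fun i s' h h' => by simp [Expr.eval, h, h', sum_range_succ]) (by simp [Expr.cost])
      (fun i hi s' hs' => by
        obtain ⟨τ, s'', h1, h2, h3, h4⟩ := ih (t := t + 3) (s := s') (ok_mono (by omega) he.2)
          (fun b hb => (hbs b hb).trans (by omega)) (fun b hb => by
            rw [hs'.2 b (hbs b hb)]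
            have : b ≠ x := by grind
            simpa [this] using hB b hb)
        exact ⟨τ, s'', h1, h2, h3, by rw [h4, eval_congr he.2 hs']⟩)
    refine ⟨τ, s', h1, h2.trans ?_, h3, by simp [h4, eval]⟩
    simp only [time]
    have := hB b (by grind)
    gcongr
  | sup x b e ih =>
    simp [ok] at he
    obtain ⟨τ, s', h1, h2, h3, h4⟩ := exec_foldProg (x := x) (b := b) (t := t) (T := e.time B)
      (N := s.reg b) (p := e.toProg (t + 3))
      (upd := .add (.reg t) (.sub (.reg (t + 3)) (.reg t))) (s := s)
      (by grind) (by grind) (by grind) rfl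
      (fun i => e.eval (s.setReg x i)) (fun n => (range n).sup fun i => e.eval (s.setReg x i))
      (by simp)
      (fun i s' h h' => by
        simp [Expr.eval, h, h', range_add_one]; omega) (by simp [Expr.cost])
      (fun i hi s' hs' => by
        obtain ⟨τ, s'', h1, h2, h3, h4⟩ := ih (t := t + 3) (s := s') (ok_mono (by omega) he.2)
          (fun b hb => (hbs b hb).trans (by omega)) (fun b hb => by
            rw [hs'.2 b (hbs b hb)]
            have : b ≠ x := by grind
            simpa [this] using hB b hb)
        exact ⟨τ, s'', h1, h2, h3, by rw [h4, eval_congr he.2 hs']⟩)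
    refine ⟨τ, s', h1, h2.trans ?_, h3, by simp [h4, eval]⟩
    simp only [time]
    have := hB b (by grind)
    gcongr

end HExpr

/-- Programs with bounded loops. In `loop x b p` the register `x` runs through the numbers below
the content of register `b`, and it is restored in the end. -/
inductive HProg where
  | set (x : ℕ) (e : HExpr)
  | store (a : ℕ) (i e : HExpr)
  | seq (p q : HProg)
  | ite (e : HExpr) (p q : HProg)
  | loop (x b : ℕ) (p : HProg)

/-- The memory after `n` rounds of a loop with body `f`. -/
def RAM.rounds (f : ℕ → RAM.Memory → RAM.Memory) (s : RAM.Memory) : ℕ → RAM.Memory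
  | 0 => s
  | i + 1 => f i (RAM.rounds f s i)

namespace HProg

open RAM Finset

/-- The memory after the execution of a program. -/
def run : HProg → Memory → Memory
  | set x e, s => s.setReg x (e.eval s)
  | store a i e, s => s.setArr a (i.eval s) (e.eval s)
  | seq p q, s => q.run (p.run s)
  | ite e p q, s => if e.eval s ≠ 0 then p.run s else q.run s
  | loop x b p, s => (rounds (fun i s' => p.run (s'.setReg x i)) s (s.reg b)).setReg x (s.reg x)

/-- All registers that occur are below `t`, all ranges are given by registers from `bs`, and these
registers are never changed. -/
def ok (bs : List ℕ) (t : ℕ) : HProg → Bool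
  | set x e => x ∉ bs && x < t && e.ok bs t
  | store _ i e => i.ok bs t && e.ok bs t
  | seq p q => p.ok bs t && q.ok bs t
  | ite e p q => e.ok bs t && p.ok bs t && q.ok bs t
  | loop x b p => b ∈ bs && b < t && x ∉ bs && x < t && p.ok bs t

/-- The compiled program, with the registers above `t` as a scratch area. -/
def toProg : HProg → ℕ → Program
  | set x e, t => .seq (e.toProg t) (.setReg x (.reg t))
  | store a i e, t => .seq (i.toProg t) <| .seq (e.toProg (t + 1)) <|
      .setArr a (.reg t) (.reg (t + 1))
  | seq p q, t => .seq (p.toProg t) (q.toProg t)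
  | ite e p q, t => .seq (e.toProg t) (.ite (.reg t) (p.toProg t) (q.toProg t))
  | loop x b p, t => .seq (.setReg t (.const 0)) <| .seq (.setReg (t + 1) (.reg x)) <|
      .seq (.while (.sub (.reg b) (.reg t)) <|
        .seq (.setReg x (.reg t)) <| .seq (p.toProg (t + 2)) <|
          .setReg t (.add (.reg t) (.const 1))) <|
      .setReg x (.reg (t + 1))

/-- A bound for the running time of the compiled program, when all ranges are at most `B`. -/
def time (B : ℕ) : HProg → ℕ
  | set _ e => e.time B + 2
  | store _ i e => i.time B + e.time B + 3
  | seq p q => p.time B + q.time B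
  | ite e p q => e.time B + 2 + p.time B + q.time B
  | loop _ _ p => B * (p.time B + 10) + 10

/-- The program writes to the register `x`. -/
def writes (x : ℕ) : HProg → Bool
  | set y _ => y = x
  | store _ _ _ => false
  | seq p q => p.writes x || q.writes x
  | ite _ p q => p.writes x || q.writes x
  | loop _ _ p => p.writes x

/-- The program writes to the array `a`. -/
def stores (a : ℕ) : HProg → Bool
  | set _ _ => false
  | store b _ _ => b = a
  | seq p q => p.stores a || q.stores a
  | ite _ p q => p.stores a || q.stores a
  | loop _ _ p => p.stores a

theorem run_reg {p : HProg} {x : ℕ} (h : p.writes x = false) (s : Memory) :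
    (p.run s).reg x = s.reg x := by
  induction p generalizing s with
  | set y e => simp [writes] at h; simp [run, Ne.symm h]
  | store a i e => rfl
  | seq p q ih ih' => simp [writes] at h; simp [run, ih h.1, ih' h.2]
  | ite e p q ih ih' =>
    simp [writes] at h; simp only [run]; split <;> simp [ih h.1, ih' h.2]
  | loop y b p ih =>
    have key : ∀ i, x ≠ y →
        (rounds (fun i s' => p.run (s'.setReg y i)) s i).reg x = s.reg x := by
      intro i hxy
      induction i with
      | zero => rfl
      | succ i ih' => simp [rounds, ih h, ih', hxy]
    by_cases hxy : x = y
    · simp [run, hxy]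
    · simp [run, hxy, key _ hxy]

theorem run_arr {p : HProg} {a : ℕ} (h : p.stores a = false) (s : Memory) :
    (p.run s).arr a = s.arr a := by
  induction p generalizing s with
  | set y e => rfl
  | store b i e =>
    simp [stores] at h; funext j; simp [run, Memory.setArr_arr, Ne.symm h]
  | seq p q ih ih' => simp [stores] at h; simp [run, ih h.1, ih' h.2]
  | ite e p q ih ih' =>
    simp [stores] at h; simp only [run]; split <;> simp [ih h.1, ih' h.2]
  | loop y b p ih =>
    have key : ∀ i, (rounds (fun i s' => p.run (s'.setReg y i)) s i).arr a = s.arr a := by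
      intro i
      induction i with
      | zero => rfl
      | succ i ih' => simp [rounds, ih h, ih']
    simp [run, key]

theorem writes_of_ok {bs : List ℕ} {t x : ℕ} {p : HProg} (hp : p.ok bs t)
    (hx : x ∈ bs ∨ t ≤ x) : p.writes x = false := by
  induction p with
  | set y e => simp [ok] at hp; simp [writes]; grind
  | store a i e => rfl
  | seq p q ih ih' => simp [ok] at hp; simp [writes, ih hp.1, ih' hp.2]
  | ite e p q ih ih' => simp [ok] at hp; simp [writes, ih hp.1.2, ih' hp.2]
  | loop y b p ih => simp [ok] at hp; simp [writes, ih hp.2]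

theorem run_congr {bs : List ℕ} {t₀ t : ℕ} {p : HProg} (hp : p.ok bs t₀) (ht : t₀ ≤ t)
    {s s' : Memory} (h : Agree t s s') : Agree t (p.run s) (p.run s') := by
  induction p generalizing s s' with
  | set x e =>
    simp [ok] at hp
    simp only [run, HExpr.eval_congr (HExpr.ok_mono ht hp.2) h]
    exact h.setReg _ _
  | store a i e =>
    simp [ok] at hp
    simp only [run, HExpr.eval_congr (HExpr.ok_mono ht hp.1) h,
      HExpr.eval_congr (HExpr.ok_mono ht hp.2) h]
    exact h.setArr _ _ _
  | seq p q ih ih' => simp [ok] at hp; exact ih' hp.2 (ih hp.1 h)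
  | ite e p q ih ih' =>
    simp [ok] at hp
    simp only [run, HExpr.eval_congr (HExpr.ok_mono ht hp.1.1) h]
    split
    · exact ih hp.1.2 h
    · exact ih' hp.2 h
  | loop x b p ih =>
    simp [ok] at hp
    simp only [run, h.2 b (by omega), h.2 x (by omega)]
    refine Agree.setReg ?_ _ _
    induction s'.reg b with
    | zero => exact h
    | succ i ih' => exact ih hp.2 (ih'.setReg _ _)

/-- The compiled program simulates the given one within the time bound. -/
theorem exec_toProg {bs : List ℕ} {B t₀ t : ℕ} {p : HProg} (hp : p.ok bs t₀) (ht : t₀ ≤ t)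
    (hbs : ∀ b ∈ bs, b < t) {s : Memory} (hB : ∀ b ∈ bs, s.reg b ≤ B) :
    ∃ τ s', Exec (p.toProg t) s τ s' ∧ τ ≤ p.time B ∧ Agree t s' (p.run s) := by
  induction p generalizing s t with
  | set x e =>
    simp [ok] at hp
    have he := HExpr.ok_mono ht hp.2
    obtain ⟨τ, s', h1, h2, h3, h4⟩ := HExpr.exec_toProg he hbs hB
    refine ⟨_, _, Exec.seq h1 (Exec.setReg s' x (.reg t)), ?_, ?_⟩
    · simp [time, Expr.cost]; omega
    · simp only [Expr.eval, h4, run]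
      exact h3.setReg _ _
  | store a i e =>
    simp [ok] at hp
    have hi := HExpr.ok_mono ht hp.1
    have he := HExpr.ok_mono ht hp.2
    obtain ⟨τ, s', h1, h2, h3, h4⟩ := HExpr.exec_toProg hi hbs hB
    obtain ⟨τ', s'', h1', h2', h3', h4'⟩ := HExpr.exec_toProg (t := t + 1) (s := s')
      (HExpr.ok_mono (by omega) he)
      (fun b hb => (hbs b hb).trans (by omega)) (fun b hb => by rw [h3.2 b (hbs b hb)]; exact hB b hb)
    refine ⟨_, _, Exec.seq h1 (Exec.seq h1' (Exec.setArr s'' a (.reg t) (.reg (t + 1)))), ?_, ?_⟩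
    · simp [time, Expr.cost]; omega
    · simp only [Expr.eval, h4', h3'.2 t (by omega), h4, HExpr.eval_congr he h3, run]
      exact ((h3'.mono (by omega)).trans h3).setArr _ _ _
  | seq p q ih ih' =>
    simp [ok] at hp
    obtain ⟨τ, s', h1, h2, h3⟩ := ih hp.1 ht hbs hB
    obtain ⟨τ', s'', h1', h2', h3'⟩ := ih' hp.2 ht hbs (s := s') (fun b hb => by
      rw [h3.2 b (hbs b hb), run_reg (writes_of_ok hp.1 (.inl hb))]
      exact hB b hb)
    exact ⟨_, _, Exec.seq h1 h1', by simp [time]; omega, h3'.trans (run_congr hp.2 ht h3)⟩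
  | ite e p q ih ih' =>
    simp [ok] at hp
    have he := HExpr.ok_mono ht hp.1.1
    obtain ⟨τ, s', h1, h2, h3, h4⟩ := HExpr.exec_toProg he hbs hB
    have hB' : ∀ b ∈ bs, s'.reg b ≤ B := fun b hb => by rw [h3.2 b (hbs b hb)]; exact hB b hb
    by_cases h : e.eval s = 0
    · obtain ⟨τ', s'', h1', h2', h3'⟩ := ih' hp.2 ht hbs hB'
      refine ⟨_, _, Exec.seq h1 (Exec.iteFalse (e := .reg t) (by simp [Expr.eval, h4, h]) h1'), ?_, ?_⟩
      · simp [time, Expr.cost]; omega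
      · simpa [run, h] using h3'.trans (run_congr hp.2 ht h3)
    · obtain ⟨τ', s'', h1', h2', h3'⟩ := ih hp.1.2 ht hbs hB'
      refine ⟨_, _, Exec.seq h1 (Exec.iteTrue (e := .reg t) (by simp [Expr.eval, h4, h]) h1'), ?_, ?_⟩
      · simp [time, Expr.cost]; omega
      · simpa [run, h] using h3'.trans (run_congr hp.1.2 ht h3)
  | loop x b p ih =>
    simp [ok] at hp
    have hbt : b < t := by omega
    have hxt : x < t := by omega
    have hbx : b ≠ x := by grind
    have e0 : x ≠ t := by omega
    have e2 : t + 1 ≠ x := by omega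
    let R := rounds (fun i s' => p.run (s'.setReg x i)) s
    have hRb : ∀ i, ∀ c ∈ bs, (R i).reg c = s.reg c := by
      intro i c hc
      have hcx : c ≠ x := by grind
      induction i with
      | zero => rfl
      | succ i ih =>
        simpa [R, rounds, run_reg (writes_of_ok hp.2 (.inl hc)), hcx] using ih
    obtain ⟨τ, s', he, hτ, h1, h2, h3⟩ := exec_count (b := b) (z := t) (N := s.reg b)
      (T := p.time B + 6)
      (p := .seq (.setReg x (.reg t)) <| .seq (p.toProg (t + 2)) <|
          .setReg t (.add (.reg t) (.const 1)))
      (I := fun i s' => s'.reg t = i ∧ s'.reg (t + 1) = s.reg x ∧ Agree t s' (R i))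
      (s := (s.setReg t 0).setReg (t + 1) (s.reg x))
      (by
        rintro i s' ⟨h1, h2, h3⟩
        exact ⟨by rw [h3.2 b hbt, hRb _ _ hp.1.1.1.1], h1⟩)
      (by
        rintro i hi s' ⟨h1, h2, h3⟩
        obtain ⟨τ, s'', g1, g2, g3⟩ := ih hp.2 (t := t + 2) (s := s'.setReg x i) (by omega)
          (fun b hb => (hbs b hb).trans (by omega)) (fun c hc => by
            have hcx : c ≠ x := by grind
            simp only [Memory.setReg_reg, hcx, if_false]
            rw [h3.2 c (hbs c hc), hRb _ _ hc]
            exact hB c hc)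
        have w : ∀ y, t ≤ y → y < t + 2 → s''.reg y = s'.reg y := fun y hy hy' => by
          have e5 : y ≠ x := by omega
          rw [g3.2 y hy', run_reg (writes_of_ok hp.2 (.inr (ht.trans hy)))]
          simp [e5]
        refine ⟨2 + (τ + 4), s''.setReg t (i + 1), ?_, by omega, by simp, ?_, ?_⟩
        · refine Exec.seq (s₁ := s'.setReg x i) ?_ (Exec.seq g1 ?_)
          · simpa [Expr.eval, h1, Expr.cost] using Exec.setReg s' x (.reg t)
          · simpa [Expr.eval, w t (by omega) (by omega), h1, Expr.cost] using
              Exec.setReg s'' t (.add (.reg t) (.const 1))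
        · simp [w (t + 1) (by omega) (by omega), h2]
        · exact ((g3.mono (by omega)).trans (run_congr hp.2 ht (h3.setReg x i))).setReg_left
            le_rfl _)
      (by
        refine ⟨by simp, by simp, ?_⟩
        exact ((Agree.refl t s).setReg_left le_rfl _).setReg_left (by omega) _)
    refine ⟨2 + (2 + (τ + 2)), s'.setReg x (s.reg x), ?_, ?_, h3.setReg _ _⟩
    · refine Exec.seq (Exec.setReg s t (.const 0)) (Exec.seq
        (s₁ := (s.setReg t 0).setReg (t + 1) (s.reg x)) ?_ (Exec.seq he ?_))
      · simpa [Expr.eval, Expr.cost, e0] using Exec.setReg (s.setReg t 0) (t + 1) (.reg x)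
      · simpa [Expr.eval, Expr.cost, h2] using Exec.setReg s' x (.reg (t + 1))
    · simp only [time]
      have h4 := hB b hp.1.1.1.1
      have : s.reg b * (p.time B + 6 + 4) ≤ B * (p.time B + 10) := by
        rw [Nat.add_assoc]; gcongr
      omega

end HProg

/-! ### Polynomial time bounds -/

/-- The function is bounded by a polynomial. -/
def PolyBounded (f : ℕ → ℕ) : Prop := ∃ C c : ℕ, ∀ B, f B ≤ C * (B + 1) ^ c

namespace PolyBounded

theorem const (n : ℕ) : PolyBounded fun _ => n := ⟨n, 0, by simp⟩

theorem id' : PolyBounded fun B => B := ⟨1, 1, by simp⟩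

theorem add {f g : ℕ → ℕ} (hf : PolyBounded f) (hg : PolyBounded g) :
    PolyBounded fun B => f B + g B := by
  obtain ⟨C, c, h⟩ := hf
  obtain ⟨C', c', h'⟩ := hg
  refine ⟨C + C', c + c', fun B => ?_⟩
  have h1 : (B + 1) ^ c ≤ (B + 1) ^ (c + c') := Nat.pow_le_pow_right (by omega) (by omega)
  have h2 : (B + 1) ^ c' ≤ (B + 1) ^ (c + c') := Nat.pow_le_pow_right (by omega) (by omega)
  calc f B + g B ≤ C * (B + 1) ^ c + C' * (B + 1) ^ c' := add_le_add (h B) (h' B)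
    _ ≤ C * (B + 1) ^ (c + c') + C' * (B + 1) ^ (c + c') := by gcongr
    _ = _ := by ring

theorem mul {f g : ℕ → ℕ} (hf : PolyBounded f) (hg : PolyBounded g) :
    PolyBounded fun B => f B * g B := by
  obtain ⟨C, c, h⟩ := hf
  obtain ⟨C', c', h'⟩ := hg
  refine ⟨C * C', c + c', fun B => (Nat.mul_le_mul (h B) (h' B)).trans (le_of_eq (by ring))⟩

end PolyBounded

theorem HExpr.polyBounded_time (e : HExpr) : PolyBounded fun B => e.time B := by
  induction e with
  | const | reg => exact .const 2
  | get a i ih => exact ih.add (.const 3)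
  | add e f ih ih' => exact (ih.add ih').add (.const 4)
  | sub e f ih ih' => exact (ih.add ih').add (.const 4)
  | ite c e f ih ih' ih'' => exact ((ih.add ih').add ih'').add (.const 2)
  | sum x b e ih => exact (PolyBounded.id'.mul (ih.add (.const 16))).add (.const 16)
  | sup x b e ih => exact (PolyBounded.id'.mul (ih.add (.const 16))).add (.const 16)

theorem HProg.polyBounded_time (p : HProg) : PolyBounded fun B => p.time B := by
  induction p with
  | set x e => exact e.polyBounded_time.add (.const 2)
  | store a i e => exact (i.polyBounded_time.add e.polyBounded_time).add (.const 3)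
  | seq p q ih ih' => exact ih.add ih'
  | ite e p q ih ih' => exact ((e.polyBounded_time.add (.const 2)).add ih).add ih'
  | loop x b p ih => exact (PolyBounded.id'.mul (ih.add (.const 10))).add (.const 10)

/-! ### Derived expressions and programs -/

namespace HExpr

open RAM Finset

/-- Evaluates to 1 if `e ≤ f`, to 0 otherwise. -/
def le (e f : HExpr) : HExpr := ite (sub e f) (const 0) (const 1)

/-- Evaluates to 1 if `e < f`, to 0 otherwise. -/
def lt (e f : HExpr) : HExpr := ite (sub f e) (const 1) (const 0)

/-- Evaluates to 1 if `e` evaluates to 0, to 0 otherwise. -/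
def not (e : HExpr) : HExpr := ite e (const 0) (const 1)

/-- Evaluates to 1 if both `e` and `f` are nonzero, to 0 otherwise. -/
def and (e f : HExpr) : HExpr := ite e (ite f (const 1) (const 0)) (const 0)

/-- Evaluates to 1 if `e` or `f` is nonzero, to 0 otherwise. -/
def or (e f : HExpr) : HExpr := ite e (const 1) (ite f (const 1) (const 0))

/-- Evaluates to 1 if `e = f`, to 0 otherwise. -/
def eq (e f : HExpr) : HExpr := ite (add (sub e f) (sub f e)) (const 0) (const 1)

/-- The number of those `x` below register `b` that satisfy `e`. -/
def count (x b : ℕ) (e : HExpr) : HExpr := sum x b (ite e (const 1) (const 0))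

/-- The least `x` below register `b` that satisfies `e`; if there is none, the content of
register `b`. -/
def find (x b : ℕ) (e : HExpr) : HExpr :=
  sub (reg b) (sup x b (ite e (sub (reg b) (reg x)) (const 0)))

@[simp] theorem eval_const (n : ℕ) (s : Memory) : (const n).eval s = n := rfl
@[simp] theorem eval_reg (x : ℕ) (s : Memory) : (reg x).eval s = s.reg x := rfl
@[simp] theorem eval_get (a : ℕ) (i : HExpr) (s : Memory) :
    (get a i).eval s = s.arr a (i.eval s) := rfl
@[simp] theorem eval_add (e f : HExpr) (s : Memory) : (add e f).eval s = e.eval s + f.eval s := rfl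
@[simp] theorem eval_sub (e f : HExpr) (s : Memory) : (sub e f).eval s = e.eval s - f.eval s := rfl
@[simp] theorem eval_ite (c e f : HExpr) (s : Memory) :
    (ite c e f).eval s = if c.eval s ≠ 0 then e.eval s else f.eval s := rfl
@[simp] theorem eval_sum (x b : ℕ) (e : HExpr) (s : Memory) :
    (sum x b e).eval s = ∑ i ∈ range (s.reg b), e.eval (s.setReg x i) := rfl
@[simp] theorem eval_sup (x b : ℕ) (e : HExpr) (s : Memory) :
    (sup x b e).eval s = (range (s.reg b)).sup fun i => e.eval (s.setReg x i) := rfl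

@[simp] theorem eval_le (e f : HExpr) (s : Memory) :
    (le e f).eval s = if e.eval s ≤ f.eval s then 1 else 0 := by
  simp only [le, eval_ite, eval_sub, eval_const]; grind

@[simp] theorem eval_lt (e f : HExpr) (s : Memory) :
    (lt e f).eval s = if e.eval s < f.eval s then 1 else 0 := by
  simp only [lt, eval_ite, eval_sub, eval_const]
  congr 1
  simp only [eq_iff_iff]; omega

@[simp] theorem eval_not (e : HExpr) (s : Memory) :
    (not e).eval s = if e.eval s = 0 then 1 else 0 := by
  simp [not]

@[simp] theorem eval_and (e f : HExpr) (s : Memory) :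
    (and e f).eval s = if e.eval s ≠ 0 ∧ f.eval s ≠ 0 then 1 else 0 := by
  simp only [and, eval_ite, eval_const]; grind

@[simp] theorem eval_or (e f : HExpr) (s : Memory) :
    (or e f).eval s = if e.eval s ≠ 0 ∨ f.eval s ≠ 0 then 1 else 0 := by
  simp only [or, eval_ite, eval_const]; grind

@[simp] theorem eval_eq (e f : HExpr) (s : Memory) :
    (eq e f).eval s = if e.eval s = f.eval s then 1 else 0 := by
  simp only [eq, eval_ite, eval_const, eval_add, eval_sub]; grind

theorem eval_count (x b : ℕ) (e : HExpr) (s : Memory) :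
    (count x b e).eval s = #{i ∈ range (s.reg b) | e.eval (s.setReg x i) ≠ 0} := by
  simp only [count, eval_sum, eval_ite, eval_const, card_filter]

theorem eval_count_ne_zero (x b : ℕ) (e : HExpr) (s : Memory) :
    (count x b e).eval s ≠ 0 ↔ ∃ i < s.reg b, e.eval (s.setReg x i) ≠ 0 := by
  simp [eval_count, filter_eq_empty_iff]

/-- The value of `find`, when the bound variable has been set up correctly. -/
theorem eval_find {x b : ℕ} (hxb : b ≠ x) (e : HExpr) (s : Memory) :
    (∃ i < s.reg b, e.eval (s.setReg x i) ≠ 0) ∧ (find x b e).eval s < s.reg b ∧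
        e.eval (s.setReg x ((find x b e).eval s)) ≠ 0 ∧
        (∀ i < (find x b e).eval s, e.eval (s.setReg x i) = 0) ∨
      (∀ i < s.reg b, e.eval (s.setReg x i) = 0) ∧ (find x b e).eval s = s.reg b := by
  set N := s.reg b with hN
  have hv : (find x b e).eval s =
      N - (range N).sup fun i => if e.eval (s.setReg x i) ≠ 0 then N - i else 0 := by
    simp [find, hxb, ← hN]
  set F : ℕ → ℕ := fun i => if e.eval (s.setReg x i) ≠ 0 then N - i else 0 with hF
  by_cases h : ∃ i < N, e.eval (s.setReg x i) ≠ 0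
  · left
    obtain ⟨i, hi, hie⟩ := h
    obtain ⟨j, hj, hj'⟩ := exists_mem_eq_sup (range N) ⟨i, mem_range.2 hi⟩ F
    have h1 : F i ≤ F j := hj' ▸ le_sup (f := F) (mem_range.2 hi)
    have h2 : F i = N - i := by simp [hF, hie]
    have h3 : e.eval (s.setReg x j) ≠ 0 := by
      intro h0
      have : F j = 0 := by simp [hF, h0]
      omega
    have h4 : F j = N - j := by simp [hF, h3]
    rw [mem_range] at hj
    have h5 : (find x b e).eval s = j := by rw [hv, hj', h4]; omega
    refine ⟨⟨i, hi, hie⟩, by omega, by rwa [h5], fun l hl => ?_⟩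
    by_contra h6
    have h7 : F l ≤ F j := hj' ▸ le_sup (f := F) (mem_range.2 (by omega))
    have h8 : F l = N - l := by simp [hF, h6]
    omega
  · right
    push Not at h
    refine ⟨h, ?_⟩
    have : (range N).sup F = 0 := by
      rw [← Nat.bot_eq_zero, Finset.sup_eq_bot_iff]
      intro i hi
      simp [hF, h i (mem_range.1 hi)]
    rw [hv, this, Nat.sub_zero]

end HExpr

namespace RAM

/-- Overwrite the array `a`. -/
def Memory.withArr (s : Memory) (a : ℕ) (f : ℕ → ℕ) : Memory :=
  { s with arr := Function.update s.arr a f }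

@[simp] theorem Memory.withArr_reg (s : Memory) (a : ℕ) (f : ℕ → ℕ) :
    (s.withArr a f).reg = s.reg := rfl

@[simp] theorem Memory.withArr_arr (s : Memory) (a : ℕ) (f : ℕ → ℕ) (b : ℕ) :
    (s.withArr a f).arr b = if b = a then f else s.arr b := by
  simp [Memory.withArr, Function.update_apply]

end RAM

namespace HProg

open RAM

/-- A loop that fills the cells `off, …, off + n - 1` of the array `a`, where `n` is in
register `b`. -/
theorem run_loop_store {a x b off : ℕ} {ix e : HExpr}
    (he : ∀ s f, e.eval (s.withArr a f) = e.eval s) {s : Memory}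
    (hix : ∀ i f, ix.eval ((s.setReg x i).withArr a f) = off + i) :
    (loop x b (store a ix e)).run s = s.withArr a fun p =>
      if off ≤ p ∧ p < off + s.reg b then e.eval (s.setReg x (p - off)) else s.arr a p := by
  have key : ∀ N, rounds (fun i s' => (store a ix e).run (s'.setReg x i)) s N =
      (s.withArr a fun p =>
        if off ≤ p ∧ p < off + N then e.eval (s.setReg x (p - off)) else s.arr a p).setReg x
        (if N = 0 then s.reg x else N - 1) := by
    intro N
    induction N with
    | zero =>
      refine Memory.ext' (fun y => ?_) fun c p => ?_
      · by_cases h : y = x <;> simp [rounds, h]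
      · by_cases h : c = a
        · subst h
          have : ¬(off ≤ p ∧ p < off) := by omega
          simp [rounds, this]
        · simp [rounds, h]
    | succ N ih =>
      rw [rounds, ih]
      have : ((s.withArr a fun p =>
          if off ≤ p ∧ p < off + N then e.eval (s.setReg x (p - off)) else s.arr a p).setReg x
          (if N = 0 then s.reg x else N - 1)).setReg x N = (s.setReg x N).withArr a fun p =>
          if off ≤ p ∧ p < off + N then e.eval (s.setReg x (p - off)) else s.arr a p := by
        refine Memory.ext' (fun y => ?_) fun c p => ?_
        · by_cases h : y = x <;> simp [h]
        · simp
      rw [this]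
      refine Memory.ext' (fun y => ?_) fun c p => ?_
      · simp [run]
      · simp only [run, Memory.setArr_arr, hix, he, Memory.setReg_arr, Memory.withArr_arr]
        by_cases h : c = a
        · subst h
          by_cases h' : p = off + N
          · simp [h']
          · have : (off ≤ p ∧ p < off + (N + 1)) ↔ (off ≤ p ∧ p < off + N) := by omega
            simp [h', this]
        · simp [h]
  rw [run, key]
  refine Memory.ext' (fun y => ?_) fun c p => ?_
  · by_cases h : y = x <;> simp [h]
  · simp

end HProg

namespace HExpr

open RAM

/-- The expression reads the array `a`. -/
def reads (a : ℕ) : HExpr → Bool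
  | const _ => false
  | reg _ => false
  | get b i => b = a || i.reads a
  | add e f => e.reads a || f.reads a
  | sub e f => e.reads a || f.reads a
  | ite c e f => c.reads a || e.reads a || f.reads a
  | sum _ _ e => e.reads a
  | sup _ _ e => e.reads a

theorem eval_withArr {a : ℕ} {e : HExpr} (h : e.reads a = false) (s : Memory) (f : ℕ → ℕ) :
    e.eval (s.withArr a f) = e.eval s := by
  have comm : ∀ (s : Memory) x v, (s.withArr a f).setReg x v = (s.setReg x v).withArr a f :=
    fun _ _ _ => rfl
  induction e generalizing s with
  | const => rfl
  | reg => rfl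
  | get b i ih => simp [reads] at h; simp [ih h.2, h.1]
  | add e f ih ih' => simp [reads] at h; simp [ih h.1, ih' h.2]
  | sub e f ih ih' => simp [reads] at h; simp [ih h.1, ih' h.2]
  | ite c e f ih ih' ih'' => simp [reads] at h; simp [ih h.1.1, ih' h.1.2, ih'' h.2]
  | sum x b e ih => simp [reads] at h; simp [comm, ih h]
  | sup x b e ih => simp [reads] at h; simp [comm, ih h]

/-- Entry `(i, j)` of the matrix with `n` columns that is stored row by row in the array `a`, where
`n`, `i` and `j` are in the registers 0, `x` and `y`. Register 12 is used for the multiplication. -/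
def get₂ (a x y : ℕ) : HExpr := get a (add (sum 12 0 (reg x)) (reg y))

@[simp] theorem eval_get₂ (a : ℕ) {x y : ℕ} (hx : x ≠ 12) (s : Memory) :
    (get₂ a x y).eval s = s.arr a (s.reg x * s.reg 0 + s.reg y) := by
  simp [get₂, hx, mul_comm]

end HExpr

namespace HProg

open RAM

/-- Set the cells `0, …, n - 1` of the array `a`, where `n` is in register 0. In the expression for
the new value the index is in register 10. -/
def fill (a : ℕ) (e : HExpr) : HProg := loop 10 0 (store a (.reg 10) e)

/-- Set the cells `0, …, n² - 1` of the array `a`, where `n` is in register 0. In the expression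
for the new value the row and the column are in the registers 10 and 11. -/
def fill₂ (a : ℕ) (e : HExpr) : HProg :=
  loop 10 0 (loop 11 0 (store a (.add (.sum 12 0 (.reg 10)) (.reg 11)) e))

theorem run_fill {a : ℕ} {e : HExpr} (he : e.reads a = false) (s : Memory) :
    (fill a e).run s = s.withArr a fun i =>
      if i < s.reg 0 then e.eval (s.setReg 10 i) else s.arr a i := by
  rw [fill, run_loop_store (off := 0) (HExpr.eval_withArr he) (by simp)]
  simp

theorem run_fill₂ {a : ℕ} {e : HExpr} (he : e.reads a = false) (s : Memory) :
    (fill₂ a e).run s = s.withArr a fun p =>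
      if p < s.reg 0 * s.reg 0 then
        e.eval ((s.setReg 10 (p / s.reg 0)).setReg 11 (p % s.reg 0))
      else s.arr a p := by
  set n := s.reg 0 with hn
  have key : ∀ N, rounds (fun i s' => (loop 11 0 (store a
      (.add (.sum 12 0 (.reg 10)) (.reg 11)) e)).run (s'.setReg 10 i)) s N =
      (s.withArr a fun p => if p < N * n then
        e.eval ((s.setReg 10 (p / n)).setReg 11 (p % n)) else s.arr a p).setReg 10
        (if N = 0 then s.reg 10 else N - 1) := by
    intro N
    induction N with
    | zero =>
      refine Memory.ext' (fun y => ?_) fun c p => ?_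
      · by_cases h : y = 10 <;> simp [rounds, h]
      · by_cases h : c = a <;> simp [rounds, h]
    | succ N ih =>
      rw [rounds, ih]
      have : ((s.withArr a fun p => if p < N * n then
          e.eval ((s.setReg 10 (p / n)).setReg 11 (p % n)) else s.arr a p).setReg 10
          (if N = 0 then s.reg 10 else N - 1)).setReg 10 N = (s.setReg 10 N).withArr a fun p =>
          if p < N * n then
            e.eval ((s.setReg 10 (p / n)).setReg 11 (p % n)) else s.arr a p := by
        refine Memory.ext' (fun y => ?_) fun c p => ?_
        · by_cases h : y = 10 <;> simp [h]
        · simp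
      rw [this, run_loop_store (off := N * n) (HExpr.eval_withArr he)
        (by intro i f; simp [← hn, mul_comm])]
      refine Memory.ext' (fun y => ?_) fun c p => ?_
      · simp
      · by_cases h : c = a
        · subst h
          simp only [Memory.withArr_arr, if_true, Memory.withArr_reg, Memory.setReg_reg,
            Memory.setReg_arr, ← hn, Nat.add_mul, Nat.one_mul,
            (by decide : (0 : ℕ) = 10 ↔ False), if_false]
          by_cases h1 : p < N * n
          · rw [if_neg (by omega), if_pos h1, if_pos (by omega)]
          · by_cases h2 : p < N * n + n
            · have h3 : p / n = N := by
                exact Nat.div_eq_of_lt_le (by omega) (by rw [Nat.succ_mul]; exact h2)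
              have h4 : p % n = p - N * n := by
                rw [Nat.mod_eq_sub_div_mul, h3]
              rw [if_pos (by omega), if_pos h2, h3, h4]
              exact HExpr.eval_withArr he ((s.setReg 10 N).setReg 11 (p - N * n)) _
            · rw [if_neg (by omega), if_neg h1, if_neg (by omega)]
        · simp [h]
  rw [fill₂, run, key]
  refine Memory.ext' (fun y => ?_) fun c p => ?_
  · by_cases h : y = 10 <;> simp [h]
  · simp [← hn]

/-- The entry in row `i` and column `j` after `fill₂`. -/
theorem fill₂_apply {n i j : ℕ} (hi : i < n) (hj : j < n) (F : ℕ → ℕ → ℕ) (f : ℕ → ℕ) :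
    (if i * n + j < n * n then F ((i * n + j) / n) ((i * n + j) % n) else f (i * n + j)) =
      F i j := by
  have h1 : i * n + j < n * n := by nlinarith
  have h2 : (i * n + j) / n = i := by
    rw [mul_comm, Nat.mul_add_div (by omega), Nat.div_eq_of_lt hj]; omega
  have h3 : (i * n + j) % n = j := by rw [mul_comm, Nat.mul_add_mod, Nat.mod_eq_of_lt hj]
  rw [if_pos h1, h2, h3]

end HProg

/-! ### Eulerian digraphs -/

namespace Digraph

open Finset Classical

variable {V : Type*}

/-- `Trail u w F`: there is a trail from `u` to `w` whose set of arcs is `F`. -/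
inductive Trail : V → V → Finset (V × V) → Prop
  | nil (v : V) : Trail v v ∅
  | cons {u v w : V} {F : Finset (V × V)} : (u, v) ∉ F → Trail v w F → Trail u w (insert (u, v) F)

theorem Trail.append {u v w : V} {F G : Finset (V × V)} (h : Trail u v F) (h' : Trail v w G)
    (hFG : Disjoint F G) : Trail u w (F ∪ G) := by
  induction h with
  | nil v => simpa using h'
  | @cons u v v' F hn ht ih =>
    rw [disjoint_insert_left] at hFG
    rw [insert_union]
    exact .cons (by simp [hn, hFG.1]) (ih h' hFG.2)

/-- A trail can be cut in front of any of its arcs. -/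
theorem Trail.split {a b x y : V} {F : Finset (V × V)} (h : Trail a b F) (hx : (x, y) ∈ F) :
    ∃ F₁ F₂, Disjoint F₁ F₂ ∧ F = F₁ ∪ F₂ ∧ Trail a x F₁ ∧ Trail x b F₂ := by
  induction h with
  | nil v => simp at hx
  | @cons u v w F hn ht ih =>
    rcases mem_insert.1 hx with h | h
    · obtain ⟨rfl, rfl⟩ := Prod.mk.inj h
      exact ⟨∅, insert (x, y) F, by simp, by simp, .nil _, .cons hn ht⟩
    · obtain ⟨F₁, F₂, h1, rfl, h3, h4⟩ := ih h
      simp only [mem_union, not_or] at hn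
      exact ⟨insert (u, v) F₁, F₂, by simp [h1, hn.2], by simp [insert_union], .cons hn.1 h3, h4⟩

/-- A closed trail can be started at the tail of any of its arcs. -/
theorem Trail.rotate {a x y : V} {F : Finset (V × V)} (h : Trail a a F) (hx : (x, y) ∈ F) :
    Trail x x F := by
  obtain ⟨F₁, F₂, h1, rfl, h3, h4⟩ := h.split hx
  rw [union_comm]
  exact h4.append h3 h1.symm

theorem Trail.degree {u w : V} {F : Finset (V × V)} (h : Trail u w F) (x : V) :
    #{a ∈ F | a.1 = x} + (if x = w then 1 else 0) =
      #{a ∈ F | a.2 = x} + (if x = u then 1 else 0) := by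
  induction h with
  | nil v => simp
  | @cons u v w F hn ht ih =>
    rw [filter_insert, filter_insert]
    have h1 : ∀ p : V × V → Prop, (u, v) ∉ F.filter p := fun p h => hn (mem_filter.1 h).1
    split_ifs <;> simp_all [card_insert_of_notMem] <;> grind

theorem Trail.exists_list {u w : V} {F : Finset (V × V)} (h : Trail u w F) :
    ∃ l : List V, l.head? = some u ∧ l.getLast? = some w ∧ (l.zip l.tail).Nodup ∧
      ∀ a, a ∈ l.zip l.tail ↔ a ∈ F := by
  induction h with
  | nil v => exact ⟨[v], by simp⟩
  | @cons u v w F hn ht ih =>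
    obtain ⟨l, h1, h2, h3, h4⟩ := ih
    cases l with
    | nil => simp at h1
    | cons v' l =>
      simp at h1
      subst h1
      refine ⟨u :: v' :: l, by simp, by simpa using h2, ?_, ?_⟩
      · simp only [List.tail_cons, List.zip_cons_cons, List.nodup_cons]
        exact ⟨fun h => hn ((h4 _).1 h), h3⟩
      · intro a
        simp only [List.tail_cons, List.zip_cons_cons, List.mem_cons, mem_insert]
        rw [← h4]
        rfl

theorem Trail.of_list {l : List V} {u w : V} (hu : l.head? = some u) (hw : l.getLast? = some w)
    (hl : (l.zip l.tail).Nodup) : Trail u w (l.zip l.tail).toFinset := by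
  induction l generalizing u with
  | nil => simp at hu
  | cons v l ih =>
    simp at hu
    subst hu
    cases l with
    | nil => simp at hw; subst hw; simpa using Trail.nil v
    | cons v' l =>
      simp only [List.tail_cons, List.zip_cons_cons, List.nodup_cons, List.toFinset_cons] at hl ⊢
      exact .cons (by simpa using hl.1) (ih (by simp) (by simpa using hw) hl.2)

theorem isChain_of_zip {R : V → V → Prop} {l : List V} (h : ∀ a ∈ l.zip l.tail, R a.1 a.2) :
    l.IsChain R := by
  induction l with
  | nil => simp
  | cons v l ih =>
    cases l with
    | nil => simp
    | cons v' l =>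
      simp only [List.tail_cons, List.zip_cons_cons, List.mem_cons] at h
      exact List.IsChain.cons_cons (h _ (.inl rfl)) (ih fun a ha => h a (.inr ha))

theorem zip_of_isChain {R : V → V → Prop} {l : List V} (h : l.IsChain R) :
    ∀ a ∈ l.zip l.tail, R a.1 a.2 := by
  induction l with
  | nil => simp
  | cons v l ih =>
    cases l with
    | nil => simp
    | cons v' l =>
      simp only [List.tail_cons, List.zip_cons_cons, List.mem_cons]
      rw [List.isChain_cons_cons] at h
      rintro a (rfl | ha)
      · exact h.1
      · exact ih h.2 a ha

variable [Fintype V]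

/-- In-degrees are equal to out-degrees. -/
def Balanced (D : Digraph V) : Prop := ∀ v, #{w | D.Adj v w} = #{w | D.Adj w v}

theorem card_arcs_fst (D : Digraph V) (F : Finset (V × V)) (hF : ∀ a, a ∈ F ↔ D.Adj a.1 a.2)
    (v : V) : #{a ∈ F | a.1 = v} = #{w | D.Adj v w} := by
  refine card_bij' (fun a _ => a.2) (fun w _ => (v, w)) ?_ ?_ ?_ ?_ <;> simp [hF]
  · rintro a b h rfl; exact h
  · rintro a b h rfl; rfl

theorem card_arcs_snd (D : Digraph V) (F : Finset (V × V)) (hF : ∀ a, a ∈ F ↔ D.Adj a.1 a.2)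
    (v : V) : #{a ∈ F | a.2 = v} = #{w | D.Adj w v} := by
  refine card_bij' (fun a _ => a.1) (fun w _ => (w, v)) ?_ ?_ ?_ ?_ <;> simp [hF]
  · rintro a b h rfl; exact h
  · rintro a b h rfl; rfl

theorem IsEulerian.balanced {D : Digraph V} (h : D.IsEulerian) : D.Balanced := by
  obtain ⟨w, ⟨h1, h2, h3, h4⟩, -, h6⟩ := h
  intro v
  have hF : ∀ a, a ∈ (w.zip w.tail).toFinset ↔ D.Adj a.1 a.2 := fun a =>
    ⟨fun ha => zip_of_isChain h2 a (by simpa using ha), fun ha => by simpa using h6 _ _ ha⟩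
  obtain ⟨u, hu⟩ : ∃ u, w.head? = some u := by
    cases w with
    | nil => simp at h1
    | cons u w => exact ⟨u, rfl⟩
  have := (Trail.of_list hu (h3 ▸ hu) h4).degree v
  rw [← card_arcs_fst D _ hF, ← card_arcs_snd D _ hF]
  omega

/-- In a balanced digraph, a trail that cannot be prolonged is closed. -/
theorem exists_trail_extend {E F : Finset (V × V)}
    (hE : ∀ v, #{a ∈ E | a.1 = v} = #{a ∈ E | a.2 = v}) (hF : F ⊆ E) {u w : V}
    (h : Trail u w F) : ∃ G, F ⊆ G ∧ G ⊆ E ∧ Trail u u G := by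
  induction hn : #(E \ F) using Nat.strong_induction_on generalizing F w with
  | _ n ih =>
    by_cases huw : u = w
    · subst huw; exact ⟨F, Subset.rfl, hF, h⟩
    obtain ⟨x, hx⟩ : ∃ x, (w, x) ∈ E \ F := by
      by_contra hcon
      push Not at hcon
      have h1 : #{a ∈ E | a.1 = w} ≤ #{a ∈ F | a.1 = w} := by
        refine card_le_card fun a ha => ?_
        rw [mem_filter] at ha ⊢
        have := hcon a.2
        rw [mem_sdiff, not_and_not_right] at this
        obtain ⟨ha1, rfl⟩ := ha
        exact ⟨this ha1, rfl⟩
      have h2 : #{a ∈ F | a.2 = w} ≤ #{a ∈ E | a.2 = w} :=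
        card_le_card (filter_subset_filter _ hF)
      have h3 := h.degree w
      have h4 := hE w
      simp [Ne.symm huw] at h3
      omega
    rw [mem_sdiff] at hx
    have hadd : Trail u x (F ∪ {(w, x)}) :=
      h.append (by simpa using Trail.cons (by simp) (.nil x)) (by simpa using hx.2)
    have hsub : F ∪ {(w, x)} ⊆ E := union_subset hF (by simpa using hx.1)
    obtain ⟨G, h1, h2, h3⟩ := ih _ (by
      rw [← hn]
      refine card_lt_card ⟨sdiff_subset_sdiff Subset.rfl subset_union_left, fun hs => ?_⟩
      have := hs (mem_sdiff.2 hx)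
      simp at this) hsub hadd rfl
    exact ⟨G, subset_union_left.trans h1, h2, h3⟩

/-- A balanced strongly connected digraph has an Eulerian closed trail: a closed trail with the
largest number of arcs can be prolonged by a detour if it misses an arc. -/
theorem isEulerian_of_balanced {D : Digraph V} (hs : D.IsStrong) (hb : D.Balanced) :
    D.IsEulerian := by
  obtain ⟨⟨v₀⟩, hs⟩ := hs
  let E : Finset (V × V) := {a | D.Adj a.1 a.2}
  have hE : ∀ a, a ∈ E ↔ D.Adj a.1 a.2 := by simp [E]
  obtain ⟨F, hF, hmax⟩ := exists_max_image (E.powerset.filter fun F => ∃ u, Trail u u F) card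
    ⟨∅, by simpa using ⟨v₀, .nil v₀⟩⟩
  simp only [mem_filter, mem_powerset] at hF hmax
  obtain ⟨hFE, u, hu⟩ := hF
  -- a closed trail through an arc of `E` that avoids `F`
  have hcl : ∀ x y, (x, y) ∈ E → (x, y) ∉ F → ∃ G, G.Nonempty ∧ G ⊆ E \ F ∧ Trail x x G := by
    intro x y hxy hxy'
    have hbal : ∀ v, #{a ∈ E \ F | a.1 = v} = #{a ∈ E \ F | a.2 = v} := by
      intro v
      have h1 := card_arcs_fst D E hE v
      have h2 := card_arcs_snd D E hE v
      have h3 := hb v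
      have h4 := hu.degree v
      have h5 : ∀ p : V × V → Prop, #{a ∈ E \ F | p a} + #{a ∈ F | p a} = #{a ∈ E | p a} := by
        intro p
        rw [← card_union_of_disjoint (disjoint_filter_filter sdiff_disjoint), ← filter_union,
          sdiff_union_of_subset hFE]
      have h6 := h5 fun a => a.1 = v
      have h7 := h5 fun a => a.2 = v
      omega
    obtain ⟨G, h1, h2, h3⟩ := exists_trail_extend (F := {(x, y)}) hbal (by simp [hxy, hxy'])
      (by simpa using Trail.cons (by simp) (.nil y))
    exact ⟨G, ⟨(x, y), h1 (by simp)⟩, h2, h3⟩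
  have hno : ∀ x, Trail x x F → ∀ y, (x, y) ∈ E → (x, y) ∈ F := by
    intro x hx y hxy
    by_contra hxy'
    obtain ⟨G, h1, h2, h3⟩ := hcl x y hxy hxy'
    have hd : Disjoint F G := disjoint_of_subset_right h2 disjoint_sdiff
    have := hmax (F ∪ G) ⟨union_subset hFE (h2.trans sdiff_subset), x, hx.append h3 hd⟩
    rw [card_union_of_disjoint hd] at this
    have := h1.card_pos
    omega
  have hall : ∀ x, Trail x x F := by
    intro x
    have := hs u x
    induction this with
    | refl => exact hu
    | @tail y z _ hyz ih =>
      have hyz' := hno y ih z ((hE _).2 hyz)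
      obtain ⟨F₁, F₂, h1, h2, h3, h4⟩ := ih.split hyz'
      by_cases hz : ∃ w, (z, w) ∈ F
      · exact ih.rotate hz.choose_spec
      · have h5 := ih.degree z
        have h6 : #{a ∈ F | a.1 = z} = 0 := by
          rw [card_eq_zero, filter_eq_empty_iff]
          rintro ⟨a, b⟩ ha rfl
          exact hz ⟨b, ha⟩
        have h7 : 0 < #{a ∈ F | a.2 = z} := card_pos.2 ⟨(y, z), by simp [hyz']⟩
        omega
  obtain ⟨l, h1, h2, h3, h4⟩ := hu.exists_list
  refine ⟨l, ⟨by rintro rfl; simp at h1, isChain_of_zip fun a ha => (hE a).1 (hFE ((h4 a).1 ha)),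
    h1.trans h2.symm, h3⟩, fun v => ?_, fun x y hxy => (h4 _).2 (hno x (hall x) y ((hE _).2 hxy))⟩
  by_cases hv : ∃ w, (v, w) ∈ F
  · obtain ⟨w, hw⟩ := hv
    exact (List.of_mem_zip ((h4 _).2 hw)).1
  · have hr : u = v := by
      have := hs v u
      cases this.cases_head with
      | inl h => exact h.symm
      | inr h =>
        obtain ⟨c, hc, -⟩ := h
        exact absurd ⟨c, hno v (hall v) c ((hE _).2 hc)⟩ hv
    subst hr
    exact List.mem_of_mem_head? h1

end Digraph

/-! ### Levelled digraphs -/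

open Finset Relation

section Levels

open Classical

variable {α β : Type*}

/-- In a balanced digraph on `L`, a set of vertices that no arc leaves is entered by no arc. -/
theorem balanced_closed {D : α → α → Prop} {L R : Finset α} (hR : R ⊆ L)
    (hbal : ∀ v ∈ L, #{w ∈ L | D v w} = #{w ∈ L | D w v})
    (hout : ∀ v ∈ R, ∀ w ∈ L, D v w → w ∈ R) : ∀ v ∈ R, ∀ w ∈ L, D w v → w ∈ R := by
  have h1 : ∀ v ∈ R, #{w ∈ R | D w v} ≤ #{w ∈ L | D w v} := fun v _ =>
    card_le_card (filter_subset_filter _ hR)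
  have h2 : ∑ v ∈ R, #{w ∈ R | D w v} = ∑ v ∈ R, #{w ∈ L | D w v} := by
    calc ∑ v ∈ R, #{w ∈ R | D w v} = ∑ v ∈ R, #{w ∈ R | D v w} :=
          (sum_card_bipartiteAbove_eq_sum_card_bipartiteBelow (s := R) (t := R) D).symm
      _ = ∑ v ∈ R, #{w ∈ L | D v w} := by
          refine sum_congr rfl fun v hv => congrArg card ?_
          ext w
          simp only [mem_filter]
          exact ⟨fun h => ⟨hR h.1, h.2⟩, fun h => ⟨hout v hv w h.1 h.2, h.2⟩⟩
      _ = ∑ v ∈ R, #{w ∈ L | D w v} := sum_congr rfl fun v hv => hbal v (hR hv)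
  have h3 := (sum_eq_sum_iff_of_le h1).1 h2
  intro v hv w hw hwv
  have h4 := eq_of_subset_of_card_le (filter_subset_filter (fun w => D w v) hR) (h3 v hv).ge
  have : w ∈ L.filter fun w => D w v := by simp [hw, hwv]
  rw [← h4] at this
  exact (mem_filter.1 this).1

/-- The function `c` divides the digraph `D` on the vertex set `S` into levels: no arc goes down,
and each level induces a balanced digraph. -/
def IsLeveled (S : Finset α) (D : α → α → Prop) (c : α → ℕ) : Prop :=
  (∀ x ∈ S, ∀ y ∈ S, D x y → c x ≤ c y) ∧
    ∀ v ∈ S, #{w ∈ S | c w = c v ∧ D v w} = #{w ∈ S | c w = c v ∧ D w v}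

/-- There is a path from `x` to `y` in the digraph that `D` induces on `S`. -/
def Reach (S : Finset α) (D : α → α → Prop) : α → α → Prop :=
  ReflTransGen fun a b => a ∈ S ∧ b ∈ S ∧ D a b

/-- An arc inside a level lies on a cycle. -/
theorem IsLeveled.reach {S : Finset α} {D : α → α → Prop} {c : α → ℕ} (h : IsLeveled S D c)
    {x y : α} (hx : x ∈ S) (hy : y ∈ S) (hxy : D x y) (hc : c x = c y) : Reach S D y x := by
  have := balanced_closed (D := D) (L := {w ∈ S | c w = c y})
    (R := {w ∈ S | c w = c y ∧ Reach S D y w})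
    (fun w hw => by simp only [mem_filter] at hw ⊢; exact ⟨hw.1, hw.2.1⟩)
    (fun v hv => by
      rw [mem_filter] at hv
      have := h.2 v hv.1
      rw [hv.2] at this
      simpa [filter_filter] using this)
    (fun v hv w hw hvw => by
      simp only [mem_filter] at hv hw ⊢
      exact ⟨hw.1, hw.2, hv.2.2.tail ⟨hv.1, hw.1, hvw⟩⟩) y
    (mem_filter.2 ⟨hy, rfl, .refl⟩) x (by simp [hx, hc]) hxy
  exact (mem_filter.1 this).2.2

theorem Reach.monotone {S : Finset α} {D : α → α → Prop} {g : α → ℕ}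
    (hg : ∀ x ∈ S, ∀ y ∈ S, D x y → g x ≤ g y) {x y : α} (h : Reach S D x y) : g x ≤ g y := by
  induction h with
  | refl => rfl
  | tail _ h ih => exact ih.trans (hg _ h.1 _ h.2.1 h.2.2)

theorem IsLeveled.eq_of_monotone {S : Finset α} {D : α → α → Prop} {c g : α → ℕ}
    (h : IsLeveled S D c) (hg : ∀ x ∈ S, ∀ y ∈ S, D x y → g x ≤ g y) {x y : α} (hx : x ∈ S)
    (hy : y ∈ S) (hxy : D x y) (hc : c x = c y) : g x = g y :=
  le_antisymm (hg x hx y hy hxy) ((h.reach hx hy hxy hc).monotone hg)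

/-- A function that is larger than all levels, for the lexicographic combination of levels. -/
theorem exists_level_bound (S : Finset α) (c : α → ℕ) : ∃ N, ∀ x ∈ S, c x < N :=
  ⟨S.sup c + 1, fun _ hx => Nat.lt_succ_of_le (le_sup (f := c) hx)⟩

theorem lex_eq_iff {N a b c d : ℕ} (hb : b < N) (hd : d < N) :
    a * N + b = c * N + d ↔ a = c ∧ b = d := by
  constructor
  · intro h
    rcases lt_trichotomy a c with h' | rfl | h'
    · nlinarith
    · exact ⟨rfl, by omega⟩
    · nlinarith
  · rintro ⟨rfl, rfl⟩; rfl

/-- Levels can be subdivided along any function that increases along the arcs. -/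
theorem IsLeveled.refine {S : Finset α} {D : α → α → Prop} {c g : α → ℕ} (h : IsLeveled S D c)
    (hg : ∀ x ∈ S, ∀ y ∈ S, D x y → g x ≤ g y) {N : ℕ} (hN : ∀ x ∈ S, c x < N) :
    IsLeveled S D fun v => g v * N + c v := by
  refine ⟨fun x hx y hy hxy => ?_, fun v hv => ?_⟩
  · have h1 := hg x hx y hy hxy
    have h2 := h.1 x hx y hy hxy
    have := Nat.mul_le_mul_right N h1
    dsimp only
    omega
  · have h1 : ∀ w ∈ S, (g w * N + c w = g v * N + c v ∧ D v w) ↔ (c w = c v ∧ D v w) := by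
      intro w hw
      rw [lex_eq_iff (hN w hw) (hN v hv)]
      exact ⟨fun h => ⟨h.1.2, h.2⟩,
        fun h' => ⟨⟨(h.eq_of_monotone hg hv hw h'.2 h'.1.symm).symm, h'.1⟩, h'.2⟩⟩
    have h2 : ∀ w ∈ S, (g w * N + c w = g v * N + c v ∧ D w v) ↔ (c w = c v ∧ D w v) := by
      intro w hw
      rw [lex_eq_iff (hN w hw) (hN v hv)]
      exact ⟨fun h => ⟨h.1.2, h.2⟩,
        fun h' => ⟨⟨h.eq_of_monotone hg hw hv h'.2 h'.1, h'.1⟩, h'.2⟩⟩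
    rw [filter_congr h1, filter_congr h2]
    exact h.2 v hv

/-- Every arc inside a strong component is counted: at each vertex, as many arcs that lie on cycles
enter as leave. -/
def IsCyclicallyBalanced (S : Finset α) (D : α → α → Prop) : Prop :=
  ∀ v ∈ S, #{w ∈ S | D v w ∧ Reach S D w v} = #{w ∈ S | D w v ∧ Reach S D v w}

/-- The vertices from which there is a path to a given vertex are counted by a function that
increases along the arcs and separates the strong components that are joined by an arc. -/
theorem exists_component_level (S : Finset α) (D : α → α → Prop) :
    ∃ g : α → ℕ, (∀ x ∈ S, ∀ y ∈ S, D x y → g x ≤ g y) ∧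
      ∀ x ∈ S, ∀ y ∈ S, Reach S D x y → g x = g y → Reach S D y x := by
  have hsub : ∀ {x y}, Reach S D x y → {w ∈ S | Reach S D w x} ⊆ {w ∈ S | Reach S D w y} := by
    intro x y hxy w hw
    simp only [mem_filter] at hw ⊢
    exact ⟨hw.1, hw.2.trans hxy⟩
  refine ⟨fun v => #{w ∈ S | Reach S D w v}, fun x hx y hy hxy => card_le_card
    (hsub (.single ⟨hx, hy, hxy⟩)), fun x hx y hy hxy hc => ?_⟩
  have h1 := eq_of_subset_of_card_le (hsub hxy) hc.ge
  have : y ∈ S.filter fun w => Reach S D w y := mem_filter.2 ⟨hy, .refl⟩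
  rw [← h1] at this
  exact (mem_filter.1 this).2

theorem isCyclicallyBalanced_iff {S : Finset α} {D : α → α → Prop} :
    IsCyclicallyBalanced S D ↔ ∃ c, IsLeveled S D c := by
  constructor
  · intro h
    obtain ⟨g, h1, h2⟩ := exists_component_level S D
    refine ⟨g, h1, fun v hv => ?_⟩
    have h3 : ∀ w ∈ S, (g w = g v ∧ D v w) ↔ (D v w ∧ Reach S D w v) := fun w hw =>
      ⟨fun h => ⟨h.2, h2 v hv w hw (.single ⟨hv, hw, h.2⟩) h.1.symm⟩,
        fun h => ⟨le_antisymm (h.2.monotone h1) (h1 v hv w hw h.1), h.1⟩⟩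
    have h4 : ∀ w ∈ S, (g w = g v ∧ D w v) ↔ (D w v ∧ Reach S D v w) := fun w hw =>
      ⟨fun h => ⟨h.2, h2 w hw v hv (.single ⟨hw, hv, h.2⟩) h.1⟩,
        fun h => ⟨le_antisymm (h1 w hw v hv h.1) (h.2.monotone h1), h.1⟩⟩
    rw [filter_congr h3, filter_congr h4]
    exact h v hv
  · rintro ⟨c, hc⟩ v hv
    have h3 : ∀ w ∈ S, (D v w ∧ Reach S D w v) ↔ (c w = c v ∧ D v w) := fun w hw =>
      ⟨fun h => ⟨le_antisymm (h.2.monotone hc.1) (hc.1 v hv w hw h.1), h.1⟩,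
        fun h => ⟨h.2, hc.reach hv hw h.2 h.1.symm⟩⟩
    have h4 : ∀ w ∈ S, (D w v ∧ Reach S D v w) ↔ (c w = c v ∧ D w v) := fun w hw =>
      ⟨fun h => ⟨le_antisymm (hc.1 w hw v hv h.1) (h.2.monotone hc.1), h.1⟩,
        fun h => ⟨h.2, hc.reach hw hv h.2 h.1⟩⟩
    rw [filter_congr h3, filter_congr h4]
    exact hc.2 v hv

/-- The number of arcs of `T` on the vertex set `S` that are not arcs of `D`. -/
noncomputable def numDeleted (S : Finset α) (T D : α → α → Prop) : ℕ :=
  #{p ∈ S ×ˢ S | T p.1 p.2 ∧ ¬ D p.1 p.2}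

/-- At most `k` arcs of the digraph `T` on `S` can be deleted so that the rest can be divided into
balanced levels. -/
def Solvable (S : Finset α) (T : α → α → Prop) (k : ℕ) : Prop :=
  ∃ (D : α → α → Prop) (c : α → ℕ), (∀ x ∈ S, ∀ y ∈ S, D x y → T x y) ∧ numDeleted S T D ≤ k ∧
    IsLeveled S D c

theorem card_filter_map (f : β ↪ α) (S : Finset β) (p : α → Prop) [DecidablePred p]
    [DecidablePred fun w => p (f w)] :
    #{w ∈ S.map f | p w} = #{w ∈ S | p (f w)} := by
  rw [filter_map, card_map]; congr

theorem solvable_map (f : β ↪ α) (S : Finset β) (T : α → α → Prop) (k : ℕ) :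
    Solvable (S.map f) T k ↔ Solvable S (fun x y => T (f x) (f y)) k := by
  have hdel : ∀ D : α → α → Prop, numDeleted (S.map f) T D =
      numDeleted S (fun x y => T (f x) (f y)) fun x y => D (f x) (f y) := by
    intro D
    unfold numDeleted
    refine (card_bij (fun p _ => (f p.1, f p.2)) ?_ ?_ ?_).symm
    · rintro ⟨a, b⟩ h; simpa using h
    · rintro ⟨a, b⟩ _ ⟨a', b'⟩ _ h; simpa using h
    · rintro ⟨a, b⟩ h
      simp only [mem_filter, mem_product, mem_map] at h
      obtain ⟨⟨⟨a', ha', rfl⟩, ⟨b', hb', rfl⟩⟩, h⟩ := h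
      exact ⟨(a', b'), by simpa [ha', hb'] using h, rfl⟩
  have hlev : ∀ (D : α → α → Prop) c, IsLeveled (S.map f) D c ↔
      IsLeveled S (fun x y => D (f x) (f y)) fun x => c (f x) := by
    intro D c
    simp only [IsLeveled, card_filter_map, forall_mem_map]
  constructor
  · rintro ⟨D, c, h1, h2, h3⟩
    exact ⟨fun x y => D (f x) (f y), fun x => c (f x),
      fun x hx y hy => h1 _ (mem_map_of_mem f hx) _ (mem_map_of_mem f hy), by rwa [← hdel],
      (hlev D c).1 h3⟩
  · rintro ⟨D, c, h1, h2, h3⟩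
    have hc : ∃ c' : α → ℕ, ∀ x, c' (f x) = c x :=
      ⟨Function.extend f c 0, fun x => f.injective.extend_apply _ _ _⟩
    obtain ⟨c', hc'⟩ := hc
    let D' : α → α → Prop := fun a b => ∃ x y, f x = a ∧ f y = b ∧ D x y
    have hD' : ∀ x y, D' (f x) (f y) ↔ D x y := fun x y =>
      ⟨fun ⟨x', y', hx, hy, h⟩ => f.injective hx ▸ f.injective hy ▸ h, fun h => ⟨x, y, rfl, rfl, h⟩⟩
    refine ⟨D', c', ?_, ?_, ?_⟩
    · simpa [hD'] using h1
    · rw [hdel]; simpa [hD'] using h2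
    · rw [hlev]; simpa [hD', hc'] using h3

end Levels

/-! ### Strong components -/

namespace Digraph

open Classical

variable {V : Type*} [Fintype V]

theorem reach_univ {D : Digraph V} {x y : V} :
    Reach univ D.Adj x y ↔ ReflTransGen D.Adj x y := by
  simp [Reach]

omit [Fintype V] in
theorem reflTransGen_induceOn {D : Digraph V} {S : Set V} {x y : S}
    (h : ReflTransGen (D.induceOn S).Adj x y) : ReflTransGen D.Adj (x : V) y := by
  induction h with
  | refl => exact .refl
  | tail _ h ih => exact ih.tail h

omit [Fintype V] in
theorem isStrongComponent_iff {D : Digraph V} {S : Set V} :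
    D.IsStrongComponent S ↔
      ∃ v, S = {w | ReflTransGen D.Adj v w ∧ ReflTransGen D.Adj w v} := by
  have hstrong : ∀ v, (D.induceOn {w | ReflTransGen D.Adj v w ∧ ReflTransGen D.Adj w v}).IsStrong := by
    intro v
    refine ⟨⟨⟨v, .refl, .refl⟩⟩, ?_⟩
    have key : ∀ x y, ReflTransGen D.Adj x y → ∀ (hx : ReflTransGen D.Adj v x ∧ ReflTransGen D.Adj x v)
        (hy : ReflTransGen D.Adj v y ∧ ReflTransGen D.Adj y v),
        ReflTransGen (D.induceOn {w | ReflTransGen D.Adj v w ∧ ReflTransGen D.Adj w v}).Adj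
          ⟨x, hx⟩ ⟨y, hy⟩ := by
      intro x y h
      induction h with
      | refl => exact fun _ _ => .refl
      | @tail y z hxy hyz ih =>
        intro hx hz
        have hy : ReflTransGen D.Adj v y ∧ ReflTransGen D.Adj y v :=
          ⟨hx.1.trans hxy, hz.2.head hyz⟩
        exact (ih hx hy).tail hyz
    rintro ⟨x, hx⟩ ⟨y, hy⟩
    exact key x y (hx.2.trans hy.1) hx hy
  have hsub : ∀ (S : Set V) v, v ∈ S → (D.induceOn S).IsStrong →
      S ⊆ {w | ReflTransGen D.Adj v w ∧ ReflTransGen D.Adj w v} := by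
    intro S v hv hS w hw
    exact ⟨reflTransGen_induceOn (hS.2 ⟨v, hv⟩ ⟨w, hw⟩),
      reflTransGen_induceOn (hS.2 ⟨w, hw⟩ ⟨v, hv⟩)⟩
  constructor
  · intro h
    obtain ⟨⟨v, hv⟩⟩ := h.1.1
    exact ⟨v, (h.eq_of_subset (hstrong v) (hsub S v hv h.1))⟩
  · rintro ⟨v, rfl⟩
    exact ⟨hstrong v, fun S hS hle => hsub S v (hle ⟨.refl, .refl⟩) hS⟩

theorem balanced_induceOn_iff (D : Digraph V) (S : Set V) [Fintype S] :
    (D.induceOn S).Balanced ↔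
      ∀ v ∈ S, #{w | w ∈ S ∧ D.Adj v w} = #{w | w ∈ S ∧ D.Adj w v} := by
  have h : ∀ v : S, #{w : S | (D.induceOn S).Adj v w} = #{w | w ∈ S ∧ D.Adj v w} ∧
      #{w : S | (D.induceOn S).Adj w v} = #{w | w ∈ S ∧ D.Adj w v} := by
    intro v
    constructor
    all_goals
      refine card_bij (fun w _ => w.1) ?_ ?_ ?_
      · rintro ⟨w, hw⟩ h; exact mem_filter.2 ⟨mem_univ _, hw, (mem_filter.1 h).2⟩
      · rintro ⟨w, hw⟩ _ ⟨w', hw'⟩ _ h; simpa using h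
      · intro w hw
        simp only [mem_filter, mem_univ, true_and] at hw
        exact ⟨⟨w, hw.1⟩, mem_filter.2 ⟨mem_univ _, hw.2⟩, rfl⟩
  constructor
  · intro h' v hv
    have := h' ⟨v, hv⟩
    rwa [(h ⟨v, hv⟩).1, (h ⟨v, hv⟩).2] at this
  · intro h' v
    rw [(h v).1, (h v).2]
    exact h' v v.2

/-- All strong components of a digraph are Eulerian if and only if it is cyclically balanced. -/
theorem forall_isEulerian_iff {D : Digraph V} :
    (∀ S : Set V, D.IsStrongComponent S → (D.induceOn S).IsEulerian) ↔
      IsCyclicallyBalanced univ D.Adj := by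
  have hcard : ∀ v w : V, ∀ S : Set V,
      (∀ u, u ∈ S ↔ ReflTransGen D.Adj v u ∧ ReflTransGen D.Adj u v) → w ∈ S →
      #{u | u ∈ S ∧ D.Adj w u} = #{u | D.Adj w u ∧ ReflTransGen D.Adj u w} ∧
      #{u | u ∈ S ∧ D.Adj u w} = #{u | D.Adj u w ∧ ReflTransGen D.Adj w u} := by
    intro v w S hS h
    rw [hS] at h
    constructor
    all_goals
      refine congrArg card (filter_congr fun u _ => ?_)
      rw [hS, and_comm]
      refine and_congr_right fun hu => ?_
    · exact ⟨fun h' => h'.2.trans h.1, fun h' => ⟨h.1.tail hu, h'.trans h.2⟩⟩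
    · exact ⟨fun h' => h.2.trans h'.1, fun h' => ⟨h.1.trans h', h.2.head hu⟩⟩
  simp only [IsCyclicallyBalanced, reach_univ, mem_univ, true_implies]
  constructor
  · intro h v
    obtain ⟨S, hS⟩ : ∃ S : Set V, S = {u | ReflTransGen D.Adj v u ∧ ReflTransGen D.Adj u v} :=
      ⟨_, rfl⟩
    have hS' : ∀ u, u ∈ S ↔ ReflTransGen D.Adj v u ∧ ReflTransGen D.Adj u v := by simp [hS]
    have hv : v ∈ S := (hS' v).2 ⟨.refl, .refl⟩
    have h1 := (balanced_induceOn_iff D S).1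
      (h S (isStrongComponent_iff.2 ⟨v, hS⟩)).balanced v hv
    rwa [(hcard v v S hS' hv).1, (hcard v v S hS' hv).2] at h1
  · intro h S hS
    refine isEulerian_of_balanced hS.1 ((balanced_induceOn_iff D S).2 fun w hw => ?_)
    obtain ⟨v, hv⟩ := isStrongComponent_iff.1 hS
    have hS' : ∀ u, u ∈ S ↔ ReflTransGen D.Adj v u ∧ ReflTransGen D.Adj u v := by simp [hv]
    rw [(hcard v w S hS' hw).1, (hcard v w S hS' hw).2]
    exact h w

theorem exists_isDESCSet_iff {D : Digraph V} {k : ℕ} :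
    (∃ A : Finset (V × V), D.IsDESCSet A ∧ #A ≤ k) ↔ Solvable univ D.Adj k := by
  constructor
  · rintro ⟨A, ⟨h1, h2⟩, h3⟩
    obtain ⟨c, hc⟩ := isCyclicallyBalanced_iff.1 (forall_isEulerian_iff.1 h2)
    refine ⟨_, c, fun x _ y _ h => h.1, ?_, hc⟩
    refine (card_le_card fun p hp => ?_).trans h3
    simp [deleteArcs] at hp
    exact hp.2 hp.1
  · rintro ⟨E, c, h1, h2, h3⟩
    simp only [mem_univ, true_implies] at h1
    let A : Finset (V × V) := {p | D.Adj p.1 p.2 ∧ ¬ E p.1 p.2}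
    refine ⟨A, ⟨fun a ha => ?_, ?_⟩, by simpa [numDeleted, A] using h2⟩
    · simp [A] at ha; exact ha.1
    · have : (D.deleteArcs A).Adj = E := by
        funext x y
        simp [deleteArcs, A]
        exact ⟨fun h => h.2 h.1, fun h => ⟨h1 x y h, fun _ => h⟩⟩
      rw [forall_isEulerian_iff, this, isCyclicallyBalanced_iff]
      exact ⟨c, h3⟩

end Digraph

/-! ### Degrees and levels in tournaments -/

section Tournaments

open Classical Finset Relation

variable {α : Type*} {S : Finset α} {T D : α → α → Prop} {c : α → ℕ} {κ : ℕ}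

/-- The digraph `T` on the vertex set `S` is a tournament. -/
def IsTournamentOn (S : Finset α) (T : α → α → Prop) : Prop :=
  (∀ x ∈ S, ¬ T x x) ∧ ∀ x ∈ S, ∀ y ∈ S, x ≠ y → (T x y ↔ ¬ T y x)

/-- The in-degree of `v` in the digraph `T` on `S`. -/
noncomputable def inDeg (S : Finset α) (T : α → α → Prop) (v : α) : ℕ := #{u ∈ S | T u v}

/-- `D` arises from `T` by the deletion of at most `k` arcs, and `c` divides it into balanced
levels. -/
structure IsSolution (S : Finset α) (T D : α → α → Prop) (c : α → ℕ) (k : ℕ) : Prop where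
  sub : ∀ x ∈ S, ∀ y ∈ S, D x y → T x y
  card : numDeleted S T D ≤ k
  leveled : IsLeveled S D c

theorem solvable_iff {k : ℕ} : Solvable S T k ↔ ∃ D c, IsSolution S T D c k :=
  ⟨fun ⟨D, c, h1, h2, h3⟩ => ⟨D, c, h1, h2, h3⟩, fun ⟨D, c, h⟩ => ⟨D, c, h.1, h.2, h.3⟩⟩

/-- The number of deleted arcs at the vertex `v`. -/
noncomputable def numDeletedAt (S : Finset α) (T D : α → α → Prop) (v : α) : ℕ :=
  #{w ∈ S | T v w ∧ ¬ D v w} + #{w ∈ S | T w v ∧ ¬ D w v}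

/-- The vertices with deleted arcs. -/
noncomputable def affected (S : Finset α) (T D : α → α → Prop) : Finset α :=
  {v ∈ S | numDeletedAt S T D v ≠ 0}

theorem card_filter_product (S : Finset α) (R : α → α → Prop)
    [DecidablePred fun p : α × α => R p.1 p.2] [∀ v, DecidablePred (R v)] :
    #{p ∈ S ×ˢ S | R p.1 p.2} = ∑ v ∈ S, #{w ∈ S | R v w} := by
  simp only [card_filter, sum_product]

theorem sum_numDeletedAt (S : Finset α) (T D : α → α → Prop) :
    ∑ v ∈ S, numDeletedAt S T D v = 2 * numDeleted S T D := by
  have h : ∑ v ∈ S, #{w ∈ S | T w v ∧ ¬ D w v} = ∑ v ∈ S, #{w ∈ S | T v w ∧ ¬ D v w} :=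
    (sum_card_bipartiteAbove_eq_sum_card_bipartiteBelow (s := S) (t := S)
      fun v w => T v w ∧ ¬ D v w).symm
  simp only [numDeletedAt, sum_add_distrib, h, numDeleted,
    card_filter_product S fun v w => T v w ∧ ¬ D v w]
  ring

theorem card_affected_erase_add (v : α) (hv : v ∈ S) :
    #((affected S T D).erase v) + numDeletedAt S T D v ≤ 2 * numDeleted S T D := by
  rw [← sum_numDeletedAt, ← add_sum_erase _ _ hv, add_comm]
  refine Nat.add_le_add_left ?_ _
  rw [card_eq_sum_ones]
  calc ∑ x ∈ (affected S T D).erase v, 1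
      ≤ ∑ x ∈ (affected S T D).erase v, numDeletedAt S T D x := by
        refine sum_le_sum fun x hx => ?_
        have := (mem_filter.1 (mem_of_mem_erase hx)).2
        omega
    _ ≤ _ := sum_le_sum_of_subset (erase_subset_erase _ (filter_subset _ _))

theorem card_affected_le : #(affected S T D) ≤ 2 * numDeleted S T D := by
  rw [← sum_numDeletedAt, card_eq_sum_ones]
  calc ∑ x ∈ affected S T D, 1 ≤ ∑ x ∈ affected S T D, numDeletedAt S T D x := by
        refine sum_le_sum fun x hx => ?_
        have := (mem_filter.1 hx).2
        omega
    _ ≤ _ := sum_le_sum_of_subset (filter_subset _ _)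

theorem iff_of_not_affected (h : ∀ x ∈ S, ∀ y ∈ S, D x y → T x y) {v w : α} (hv : v ∈ S)
    (hw : w ∈ S) (hva : v ∉ affected S T D) : (D v w ↔ T v w) ∧ (D w v ↔ T w v) := by
  have h0 : numDeletedAt S T D v = 0 := by
    by_contra h0; exact hva (mem_filter.2 ⟨hv, h0⟩)
  simp only [numDeletedAt, Nat.add_eq_zero_iff, card_eq_zero, filter_eq_empty_iff] at h0
  have h1 := h0.1 hw
  have h2 := h0.2 hw
  have h3 := h v hv w hw
  have h4 := h w hw v hv
  tauto

theorem card_filter_split (S : Finset α) (p q : α → Prop) [DecidablePred p]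
    [DecidablePred fun w => p w ∧ q w] [DecidablePred fun w => p w ∧ ¬ q w] :
    #{w ∈ S | p w} = #{w ∈ S | p w ∧ q w} + #{w ∈ S | p w ∧ ¬ q w} := by
  rw [← card_filter_add_card_filter_not (s := S.filter p) q, filter_filter, filter_filter]
  congr

theorem card_filter_congr {p q : α → Prop} [DecidablePred p] [DecidablePred q]
    (h : ∀ w ∈ S, p w ↔ q w) : #{w ∈ S | p w} = #{w ∈ S | q w} :=
  congrArg card (filter_congr h)

/-- The number of vertices below the level of `v`. -/
noncomputable def numBelow (S : Finset α) (c : α → ℕ) (v : α) : ℕ := #{w ∈ S | c w < c v}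

/-- The number of vertices in the level of `v`. -/
noncomputable def levelSize (S : Finset α) (c : α → ℕ) (v : α) : ℕ := #{w ∈ S | c w = c v}

theorem numBelow_add_le {u v : α} (h : c u < c v) :
    numBelow S c u + levelSize S c u ≤ numBelow S c v := by
  unfold numBelow levelSize
  rw [← card_union_of_disjoint]
  · refine card_le_card fun w hw => ?_
    simp only [mem_union, mem_filter] at hw ⊢
    rcases hw with hw | hw
    · exact ⟨hw.1, hw.2.trans h⟩
    · exact ⟨hw.1, hw.2 ▸ h⟩
  · rw [disjoint_filter]
    intro w _ h1 h2
    omega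

theorem levelSize_pos {v : α} (hv : v ∈ S) : 0 < levelSize S c v :=
  card_pos.2 ⟨v, by simp [hv]⟩

/-- The neighbours of a vertex `v` in its level: without the deleted arcs, the in-degree and the
out-degree are equal. -/
theorem IsSolution.level_degrees {k : ℕ} (h : IsSolution S T D c k) {v : α} (hv : v ∈ S) :
    #{w ∈ S | c w = c v ∧ T v w} + #{w ∈ S | c w = c v ∧ T w v ∧ ¬ D w v} =
      #{w ∈ S | c w = c v ∧ T w v} + #{w ∈ S | c w = c v ∧ T v w ∧ ¬ D v w} := by
  have h1 := card_filter_split S (fun w => c w = c v ∧ T v w) fun w => D v w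
  have h2 := card_filter_split S (fun w => c w = c v ∧ T w v) fun w => D w v
  have h3 := h.leveled.2 v hv
  have h4 : #{w ∈ S | (c w = c v ∧ T v w) ∧ D v w} = #{w ∈ S | c w = c v ∧ D v w} :=
    (card_filter_congr fun w hw => by have := h.sub v hv w hw; tauto)
  have h5 : #{w ∈ S | (c w = c v ∧ T w v) ∧ D w v} = #{w ∈ S | c w = c v ∧ D w v} :=
    (card_filter_congr fun w hw => by have := h.sub w hw v hv; tauto)
  simp only [and_assoc] at h1 h2 h4 h5
  omega

/-- The in-degree of a vertex is determined by its level up to the number of deleted arcs at the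
vertex. -/
theorem IsSolution.inDeg_bounds {k : ℕ} (hT : IsTournamentOn S T) (h : IsSolution S T D c k)
    {v : α} (hv : v ∈ S) :
    2 * inDeg S T v + 1 ≤ 2 * numBelow S c v + levelSize S c v + 2 * numDeletedAt S T D v ∧
      2 * numBelow S c v + levelSize S c v ≤ 2 * inDeg S T v + 1 + 2 * numDeletedAt S T D v := by
  have hne : ∀ w ∈ S, w ≠ v → (T v w ↔ ¬ T w v) := fun w hw hwv =>
    hT.2 v hv w hw (Ne.symm hwv)
  -- the in-neighbours and the out-neighbours below, in, and above the level
  have e1 : numBelow S c v = #{w ∈ S | c w < c v ∧ T w v} + #{w ∈ S | c w < c v ∧ T v w} := by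
    rw [numBelow, card_filter_split S _ fun w => T w v]
    congr 2
    refine filter_congr fun w hw => and_congr_right fun hc => ?_
    rw [hne w hw (by rintro rfl; exact absurd hc (lt_irrefl _))]
  have e2 : levelSize S c v =
      #{w ∈ S | c w = c v ∧ T w v} + #{w ∈ S | c w = c v ∧ T v w} + 1 := by
    rw [levelSize, card_filter_split S _ fun w => T w v, add_assoc]
    congr 1
    rw [card_filter_split S _ fun w => w ≠ v]
    congr 1
    · refine (card_filter_congr fun w hw => ?_)
      constructor
      · rintro ⟨⟨h1, h2⟩, h3⟩; exact ⟨h1, (hne w hw h3).2 h2⟩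
      · rintro ⟨h1, h2⟩
        have : w ≠ v := by rintro rfl; exact hT.1 w hw h2
        exact ⟨⟨h1, (hne w hw this).1 h2⟩, this⟩
    · rw [card_eq_one]
      refine ⟨v, ?_⟩
      ext w
      simp only [mem_filter, mem_singleton, ne_eq, not_not]
      constructor
      · exact fun h => h.2.2
      · rintro rfl; exact ⟨hv, ⟨rfl, hT.1 w hv⟩, rfl⟩
  have e3 : inDeg S T v = #{w ∈ S | c w < c v ∧ T w v} + #{w ∈ S | c w = c v ∧ T w v} +
      #{w ∈ S | c v < c w ∧ T w v} := by
    rw [inDeg, card_filter_split S _ fun w => c w < c v,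
      card_filter_split S (fun w => T w v ∧ ¬ c w < c v) fun w => c w = c v, ← add_assoc]
    congr 1
    · congr 1
      · exact (card_filter_congr fun w _ => and_comm)
      · refine (card_filter_congr fun w _ => ?_)
        constructor
        · rintro ⟨⟨h1, -⟩, h2⟩; exact ⟨h2, h1⟩
        · rintro ⟨h1, h2⟩; exact ⟨⟨h2, by omega⟩, h1⟩
    · refine (card_filter_congr fun w _ => ?_)
      constructor
      · rintro ⟨⟨h1, h2⟩, h3⟩; exact ⟨by omega, h1⟩
      · rintro ⟨h1, h2⟩; exact ⟨⟨h2, by omega⟩, by omega⟩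
  have e4 := h.level_degrees hv
  -- arcs that go down are deleted
  have e5 : #{w ∈ S | c w = c v ∧ T v w ∧ ¬ D v w} + #{w ∈ S | c w < c v ∧ T v w} ≤
      #{w ∈ S | T v w ∧ ¬ D v w} := by
    rw [← card_union_of_disjoint (disjoint_filter.2 fun w _ h1 h2 => by omega)]
    refine card_le_card fun w hw => ?_
    simp only [mem_union, mem_filter] at hw ⊢
    rcases hw with hw | hw
    · exact ⟨hw.1, hw.2.2⟩
    · exact ⟨hw.1, hw.2.2, fun hD => by
        have := h.leveled.1 v hv w hw.1 hD
        omega⟩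
  have e6 : #{w ∈ S | c w = c v ∧ T w v ∧ ¬ D w v} + #{w ∈ S | c v < c w ∧ T w v} ≤
      #{w ∈ S | T w v ∧ ¬ D w v} := by
    rw [← card_union_of_disjoint (disjoint_filter.2 fun w _ h1 h2 => by omega)]
    refine card_le_card fun w hw => ?_
    simp only [mem_union, mem_filter] at hw ⊢
    rcases hw with hw | hw
    · exact ⟨hw.1, hw.2.2⟩
    · exact ⟨hw.1, hw.2.2, fun hD => by
        have := h.leveled.1 w hw.1 v hv hD
        omega⟩
  unfold numDeletedAt
  omega

theorem IsSolution.inDeg_eq {k : ℕ} (hT : IsTournamentOn S T) (h : IsSolution S T D c k)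
    {v : α} (hv : v ∈ S) (hva : v ∉ affected S T D) :
    2 * inDeg S T v + 1 = 2 * numBelow S c v + levelSize S c v := by
  have h0 : numDeletedAt S T D v = 0 := by
    by_contra h0; exact hva (mem_filter.2 ⟨hv, h0⟩)
  have := h.inDeg_bounds hT hv
  omega

/-- Unaffected vertices have the same in-degree if and only if they are in the same level. -/
theorem IsSolution.inDeg_eq_iff {k : ℕ} (hT : IsTournamentOn S T) (h : IsSolution S T D c k)
    {u v : α} (hu : u ∈ S) (hua : u ∉ affected S T D) (hv : v ∈ S) (hva : v ∉ affected S T D) :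
    inDeg S T u = inDeg S T v ↔ c u = c v := by
  have h1 := h.inDeg_eq hT hu hua
  have h2 := h.inDeg_eq hT hv hva
  constructor
  · intro h3
    by_contra h4
    have h5 := levelSize_pos (c := c) hu
    have h6 := levelSize_pos (c := c) hv
    rcases Nat.lt_or_gt_of_ne h4 with h4 | h4
    · have := numBelow_add_le (S := S) h4
      omega
    · have := numBelow_add_le (S := S) h4
      omega
  · intro h3
    have h4 : numBelow S c u = numBelow S c v := by simp [numBelow, h3]
    have h5 : levelSize S c u = levelSize S c v := by simp [levelSize, h3]
    omega

/-! ### Large classes of vertices of the same in-degree -/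

/-- The vertices of in-degree `d`. -/
noncomputable def degClass (S : Finset α) (T : α → α → Prop) (d : ℕ) : Finset α :=
  {x ∈ S | inDeg S T x = d}

theorem card_le_numDeleted_left (h : ∀ x ∈ S, ∀ y ∈ S, D x y → c x ≤ c y) {X : Finset α}
    (hX : X ⊆ S) {v : α} (hv : v ∈ S) (hc : ∀ x ∈ X, c v < c x) :
    #{x ∈ X | T x v} ≤ numDeleted S T D := by
  refine card_le_card_of_injOn (fun x => (x, v)) (fun x hx => ?_) (fun x _ y _ h => by simpa using h)
  simp only [coe_filter, Set.mem_ofPred_eq, mem_product] at hx ⊢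
  refine ⟨⟨hX hx.1, hv⟩, hx.2, fun hD => ?_⟩
  have := h x (hX hx.1) v hv hD
  have := hc x hx.1
  omega

theorem card_le_numDeleted_right (h : ∀ x ∈ S, ∀ y ∈ S, D x y → c x ≤ c y) {X : Finset α}
    (hX : X ⊆ S) {v : α} (hv : v ∈ S) (hc : ∀ x ∈ X, c x < c v) :
    #{x ∈ X | T v x} ≤ numDeleted S T D := by
  refine card_le_card_of_injOn (fun x => (v, x)) (fun x hx => ?_) (fun x _ y _ h => by simpa using h)
  simp only [coe_filter, Set.mem_ofPred_eq, mem_product] at hx ⊢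
  refine ⟨⟨hv, hX hx.1⟩, hx.2, fun hD => ?_⟩
  have := h v hv x (hX hx.1) hD
  have := hc x hx.1
  omega

/-- A large class of vertices of the same in-degree lies in a single level of every solution, and
this level can be recognized: its vertices are those with more than `κ` in-neighbours and more than
`κ` out-neighbours in the class. At most `2 * κ` vertices are affected, so that the class has at
least `2 * κ + 2` unaffected vertices. These share a level, and the in-degrees in a level of this
size are far from those in the other levels. The arcs of `T` that go down are all deleted, so at
most `κ` of them join a vertex outside the level to the class. -/
theorem IsSolution.exists_level (hT : IsTournamentOn S T) (h : IsSolution S T D c κ) {d : ℕ}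
    (hd : 4 * κ + 2 ≤ #(degClass S T d)) :
    ∃ l, (∀ x ∈ degClass S T d, c x = l) ∧ ∀ v ∈ S,
      (c v < l → #{x ∈ degClass S T d | T x v} ≤ κ) ∧
      (l < c v → #{x ∈ degClass S T d | T v x} ≤ κ) ∧
      (c v = l → κ < #{x ∈ degClass S T d | T x v} ∧ κ < #{x ∈ degClass S T d | T v x}) := by
  set X := degClass S T d with hX
  have hXS : X ⊆ S := filter_subset _ _
  have haff : #(affected S T D) ≤ 2 * κ := card_affected_le.trans (by have := h.card; omega)
  have hsd : #X ≤ #(X \ affected S T D) + #(affected S T D) := by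
    have := card_le_card_sdiff_add_card (s := X) (t := affected S T D)
    omega
  obtain ⟨x₀, hx₀⟩ : (X \ affected S T D).Nonempty := card_pos.1 (by omega)
  rw [mem_sdiff] at hx₀
  have hXd : ∀ x ∈ X, inDeg S T x = d := fun x hx => (mem_filter.1 hx).2
  have hun : ∀ x ∈ S, x ∉ affected S T D → (x ∈ X ↔ c x = c x₀) := fun x hx hxa => by
    rw [← h.inDeg_eq_iff hT hx hxa (hXS hx₀.1) hx₀.2, hXd x₀ hx₀.1, hX, degClass, mem_filter]
    exact ⟨fun h => h.2, fun h => ⟨hx, h⟩⟩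
  have hlev : #(X \ affected S T D) ≤ levelSize S c x₀ := by
    refine card_le_card fun x hx => ?_
    rw [mem_sdiff] at hx
    exact mem_filter.2 ⟨hXS hx.1, (hun x (hXS hx.1) hx.2).1 hx.1⟩
  have hXl : ∀ x ∈ X, c x = c x₀ := by
    intro x hx
    by_contra hc
    have h1 := h.inDeg_bounds hT (hXS hx)
    have h2 := h.inDeg_eq hT (hXS hx₀.1) hx₀.2
    rw [hXd x hx] at h1
    rw [hXd x₀ hx₀.1] at h2
    have h3 := card_affected_erase_add (T := T) (D := D) x (hXS hx)
    have h4 := pred_card_le_card_erase (s := affected S T D) (a := x)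
    have h5 := h.card
    have h6 := levelSize_pos (c := c) (hXS hx)
    -- the level of `x₀` is too large for `x` to make up for the difference by deleted arcs
    rcases Nat.lt_or_gt_of_ne hc with hc | hc
    · have := numBelow_add_le (S := S) hc
      omega
    · have := numBelow_add_le (S := S) hc
      omega
  refine ⟨c x₀, hXl, fun v hv => ⟨fun hc => ?_, fun hc => ?_, fun hc => ?_⟩⟩
  · exact (card_le_numDeleted_left h.leveled.1 hXS hv fun x hx => by rw [hXl x hx]; exact hc).trans
      h.card
  · exact (card_le_numDeleted_right h.leveled.1 hXS hv fun x hx => by rw [hXl x hx]; exact hc).trans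
      h.card
  · have e1 := h.level_degrees hv
    have e2 : ∀ R : α → Prop, #{w ∈ S | c w = c v ∧ R w} =
        #{x ∈ X | R x} + #{w ∈ S | (c w = c v ∧ R w) ∧ w ∉ X} := by
      intro R
      rw [card_filter_split S _ fun w => w ∈ X]
      congr 2
      ext w
      simp only [mem_filter]
      exact ⟨fun h => ⟨h.2.2, h.2.1.2⟩, fun h => ⟨hXS h.1, ⟨by rw [hXl w h.1, hc], h.2⟩, h.1⟩⟩
    have e3 := e2 fun w => T v w
    have e4 := e2 fun w => T w v
    have e5 : #{w ∈ S | (c w = c v ∧ T v w) ∧ w ∉ X} + #{w ∈ S | (c w = c v ∧ T w v) ∧ w ∉ X} ≤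
        #((affected S T D).erase v) := by
      rw [← card_union_of_disjoint (disjoint_filter.2 fun w hw h1 h2 => by
        by_cases hwv : w = v
        · subst hwv; exact hT.1 w hw h1.1.2
        · exact (hT.2 w hw v hv hwv).1 h2.1.2 h1.1.2)]
      refine card_le_card fun w hw => ?_
      simp only [mem_union, mem_filter] at hw
      have h1 : w ∈ S := by tauto
      have h2 : w ∉ X := by tauto
      have h3 : c w = c v := by tauto
      refine mem_erase.2 ⟨?_, ?_⟩
      · rintro rfl
        have := hT.1 w h1
        tauto
      · by_contra h4
        exact h2 ((hun w h1 h4).2 (h3.trans hc))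
    have e6 := card_affected_erase_add (T := T) (D := D) v hv
    have e7 : #{w ∈ S | c w = c v ∧ T v w ∧ ¬ D v w} ≤ #{w ∈ S | T v w ∧ ¬ D v w} :=
      card_le_card fun w hw => by simp only [mem_filter] at hw ⊢; tauto
    have e8 : #{w ∈ S | c w = c v ∧ T w v ∧ ¬ D w v} ≤ #{w ∈ S | T w v ∧ ¬ D w v} :=
      card_le_card fun w hw => by simp only [mem_filter] at hw ⊢; tauto
    have e9 : #X ≤ #{x ∈ X | T x v} + #{x ∈ X | T v x} + 1 := by
      have h1 := card_filter_add_card_filter_not (s := X.erase v) fun x => T x v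
      have h2 := pred_card_le_card_erase (s := X) (a := v)
      have h3 : #{x ∈ X.erase v | T x v} ≤ #{x ∈ X | T x v} :=
        card_le_card (filter_subset_filter _ (erase_subset _ _))
      have h4 : #{x ∈ X.erase v | ¬ T x v} ≤ #{x ∈ X | T v x} := by
        refine card_le_card fun x hx => ?_
        simp only [mem_filter, mem_erase] at hx ⊢
        exact ⟨hx.1.2, (hT.2 v hv x (hXS hx.1.2) (Ne.symm hx.1.1)).2 hx.2⟩
      omega
    have e10 := h.card
    unfold numDeletedAt at e6
    constructor <;> omega

end Tournaments

/-! ### Splitting a tournament at a level that is known -/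

section Rules

open Classical Finset Relation

variable {α : Type*} {S : Finset α} {T D : α → α → Prop} {c : α → ℕ} {κ : ℕ}

/-- The digraph `D` on `L` is balanced. -/
def IsBalancedOn (L : Finset α) (D : α → α → Prop) : Prop :=
  ∀ v ∈ L, #{w ∈ L | D v w} = #{w ∈ L | D w v}

/-- The least number of arcs that have to be deleted from the digraph `T` on `L` to make it
balanced is `m`. -/
def IsBalanceCost (L : Finset α) (T : α → α → Prop) (m : ℕ) : Prop :=
  (∃ E, (∀ x ∈ L, ∀ y ∈ L, E x y → T x y) ∧ IsBalancedOn L E ∧ numDeleted L T E = m) ∧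
    ∀ E, (∀ x ∈ L, ∀ y ∈ L, E x y → T x y) → IsBalancedOn L E → m ≤ numDeleted L T E

/-- The position of `v` relative to the level that contains the class `X`: 0 below, 1 inside, and 2
above. -/
noncomputable def position (T : α → α → Prop) (κ : ℕ) (X : Finset α) (v : α) : ℕ :=
  if #{x ∈ X | T x v} ≤ κ then 0 else if #{x ∈ X | T v x} ≤ κ then 2 else 1

/-- Arcs between different positions go up, the vertices with position 1 are ordered transitively
by `r`, and all other arcs are as in `T`. -/
def splitAt (T : α → α → Prop) (g r : α → ℕ) (x y : α) : Prop :=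
  if g x = g y then if g x = 1 then r x < r y else T x y else g x < g y

/-- The number of arcs that go down with respect to `g`. -/
noncomputable def numDown (S : Finset α) (T : α → α → Prop) (g : α → ℕ) : ℕ :=
  #{p ∈ S ×ˢ S | T p.1 p.2 ∧ g p.2 < g p.1}

/-- The vertices with position 1. -/
def middle (S : Finset α) (g : α → ℕ) : Finset α := {v ∈ S | g v = 1}

theorem card_three {ι : Type*} {s : Finset ι} {p q₁ q₂ q₃ : ι → Prop} [DecidablePred p]
    [DecidablePred q₁] [DecidablePred q₂] [DecidablePred q₃]
    (h₁ : ∀ x ∈ s, q₁ x → p x ∧ ¬ q₂ x ∧ ¬ q₃ x) (h₂ : ∀ x ∈ s, q₂ x → p x ∧ ¬ q₃ x)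
    (h₃ : ∀ x ∈ s, q₃ x → p x) :
    #{x ∈ s | q₁ x} + #{x ∈ s | q₂ x} + #{x ∈ s | q₃ x} ≤ #{x ∈ s | p x} := by
  rw [← card_union_of_disjoint (disjoint_filter.2 fun x hx h h' => (h₁ x hx h).2.1 h'),
    ← card_union_of_disjoint]
  · refine card_le_card fun x hx => ?_
    simp only [mem_union, mem_filter] at hx ⊢
    rcases hx with (hx | hx) | hx
    · exact ⟨hx.1, (h₁ x hx.1 hx.2).1⟩
    · exact ⟨hx.1, (h₂ x hx.1 hx.2).1⟩
    · exact ⟨hx.1, h₃ x hx.1 hx.2⟩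
  · rw [disjoint_left]
    intro x hx hx'
    simp only [mem_union, mem_filter] at hx hx'
    rcases hx with hx | hx
    · exact (h₁ x hx.1 hx.2).2.2 hx'.2
    · exact (h₂ x hx.1 hx.2).2 hx'.2

theorem card_eq_of_iff {p q p' q' : α → Prop} {_ : DecidablePred p} {_ : DecidablePred q}
    [DecidablePred p'] [DecidablePred q'] (h : #{w ∈ S | p' w} = #{w ∈ S | q' w})
    (hp : ∀ w ∈ S, p w ↔ p' w) (hq : ∀ w ∈ S, q w ↔ q' w) : #{w ∈ S | p w} = #{w ∈ S | q w} := by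
  rw [card_filter_congr hp, card_filter_congr hq, h]

theorem numDeleted_middle (g : α → ℕ) (E : α → α → Prop) :
    numDeleted (middle S g) T E =
      #{p ∈ S ×ˢ S | (g p.1 = 1 ∧ g p.2 = 1) ∧ T p.1 p.2 ∧ ¬ E p.1 p.2} := by
  unfold numDeleted
  congr 1
  ext p
  simp only [middle, mem_filter, mem_product]
  tauto

theorem card_middle (g : α → ℕ) (p : α → Prop) :
    #{w ∈ middle S g | p w} = #{w ∈ S | g w = 1 ∧ p w} := by
  rw [middle, filter_filter]

/-- If the positions describe a level of a solution, then the tournament can be split at this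
level. -/
theorem IsSolution.split {k m l : ℕ} {g r : α → ℕ} (h : IsSolution S T D c k)
    (hg : ∀ v ∈ S, (c v < l → g v = 0) ∧ (c v = l → g v = 1) ∧ (l < c v → g v = 2))
    (hm : IsBalanceCost (middle S g) T m) :
    m + numDown S T g ≤ k ∧ Solvable S (splitAt T g r) (k - (m + numDown S T g)) := by
  have hg' : ∀ v ∈ S, (g v = 0 ↔ c v < l) ∧ (g v = 1 ↔ c v = l) ∧ (g v = 2 ↔ l < c v) := by
    intro v hv
    have := hg v hv
    rcases lt_trichotomy (c v) l with h1 | h1 | h1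
    · have := this.1 h1; omega
    · have := this.2.1 h1; omega
    · have := this.2.2 h1; omega
  have hlt : ∀ x ∈ S, ∀ y ∈ S, g x < g y → c x < c y := by
    intro x hx y hy hxy
    have h1 := hg' x hx
    have h2 := hg' y hy
    have h3 := hg x hx
    have h4 := hg y hy
    omega
  have hbal : IsBalancedOn (middle S g) D := by
    intro v hv
    have hv' := mem_filter.1 hv
    rw [card_middle, card_middle]
    have h1 : ∀ w ∈ S, g w = 1 ↔ c w = c v := fun w hw => by
      rw [(hg' w hw).2.1, (hg' v hv'.1).2.1.1 hv'.2]
    exact card_eq_of_iff (h.leveled.2 v hv'.1) (fun w hw => by rw [h1 w hw])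
      fun w hw => by rw [h1 w hw]
  have hm' := hm.2 D (fun x hx y hy => h.sub x (mem_filter.1 hx).1 y (mem_filter.1 hy).1) hbal
  rw [numDeleted_middle] at hm'
  have hcount := card_three (s := S ×ˢ S) (p := fun p : α × α => T p.1 p.2 ∧ ¬ D p.1 p.2)
    (q₁ := fun p => (g p.1 = 1 ∧ g p.2 = 1) ∧ T p.1 p.2 ∧ ¬ D p.1 p.2)
    (q₂ := fun p => T p.1 p.2 ∧ g p.2 < g p.1)
    (q₃ := fun p => (g p.1 = g p.2 ∧ g p.1 ≠ 1) ∧ T p.1 p.2 ∧ ¬ D p.1 p.2)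
    (fun p _ h1 => ⟨h1.2, by omega, by tauto⟩)
    (fun p hp h1 => by
      rw [mem_product] at hp
      refine ⟨⟨h1.1, fun hD => ?_⟩, by omega⟩
      have h2 := h.leveled.1 _ hp.1 _ hp.2 hD
      have h3 := hlt _ hp.2 _ hp.1 h1.2
      omega)
    (fun p _ h1 => h1.2)
  have hk := h.card
  unfold numDeleted at hk
  rw [show #{p ∈ S ×ˢ S | T p.1 p.2 ∧ g p.2 < g p.1} = numDown S T g from rfl] at hcount
  refine ⟨by omega, ?_⟩
  obtain ⟨N, hN⟩ := exists_level_bound S r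
  obtain ⟨D₂, hD₂⟩ : ∃ D₂ : α → α → Prop, ∀ x y,
      D₂ x y ↔ if g x = g y ∧ g x ≠ 1 then D x y else splitAt T g r x y := ⟨_, fun _ _ => Iff.rfl⟩
  have hc2 : ∀ v ∈ S, (if g v = 1 then r v else 0) < N := by
    intro v hv
    have := hN v hv
    split_ifs <;> omega
  refine ⟨D₂, fun v => c v * N + if g v = 1 then r v else 0, ?_, ?_, ?_, ?_⟩
  · intro x hx y hy hD
    simp only [hD₂] at hD
    split_ifs at hD with h1
    · rw [splitAt, if_pos h1.1, if_neg h1.2]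
      exact h.sub x hx y hy hD
    · exact hD
  · refine le_trans (card_le_card (t := {p ∈ S ×ˢ S |
      (g p.1 = g p.2 ∧ g p.1 ≠ 1) ∧ T p.1 p.2 ∧ ¬ D p.1 p.2}) fun p hp => ?_) (by omega)
    simp only [mem_filter] at hp ⊢
    refine ⟨hp.1, ?_⟩
    obtain ⟨-, h1, h2⟩ := hp
    simp only [hD₂] at h2
    by_cases h3 : g p.1 = g p.2 ∧ g p.1 ≠ 1
    · rw [if_pos h3] at h2
      simp only [splitAt, if_pos h3.1, if_neg h3.2] at h1
      exact ⟨h3, h1, h2⟩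
    · rw [if_neg h3] at h2
      exact absurd h1 h2
  · intro x hx y hy hD
    simp only [hD₂, splitAt] at hD ⊢
    have hx2 := hc2 x hx
    have hy2 := hc2 y hy
    by_cases h1 : g x = g y
    · by_cases h2 : g x = 1
      · have h3 : c x = c y := by
          rw [(hg' x hx).2.1.1 h2, (hg' y hy).2.1.1 (h1 ▸ h2)]
        have h4 : g y = 1 := h1 ▸ h2
        simp [h2, h4] at hD
        simp [h2, h4, h3, hD.le]
      · have h4 : g y ≠ 1 := h1 ▸ h2
        simp [h1, h4] at hD
        have := Nat.mul_le_mul_right N (h.leveled.1 x hx y hy hD)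
        simp [h2, h4, this]
    · simp [h1] at hD
      have h3 := hlt x hx y hy hD
      have := Nat.mul_le_mul_right N (Nat.succ_le_of_lt h3)
      rw [Nat.succ_mul] at this
      omega
  · intro v hv
    have hlex : ∀ w ∈ S, (c w * N + (if g w = 1 then r w else 0) =
        c v * N + (if g v = 1 then r v else 0)) ↔
        (c w = c v ∧ (if g w = 1 then r w else 0) = if g v = 1 then r v else 0) :=
      fun w hw => lex_eq_iff (hc2 w hw) (hc2 v hv)
    have hgc : ∀ w ∈ S, c w = c v → g w = g v := by
      intro w hw hwv
      have h1 := hg' w hw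
      have h2 := hg' v hv
      have h3 := hg w hw
      have h4 := hg v hv
      omega
    by_cases h1 : g v = 1
    · refine card_eq_of_iff (p' := fun _ => False)
        (q' := fun _ => False) rfl ?_ ?_
      · intro w hw
        rw [show _ ↔ _ from hlex w hw]
        simp only [iff_false]
        rintro ⟨⟨h2, h3⟩, h4⟩
        have h5 := hgc w hw h2
        simp [h1, h5] at h3
        simp [hD₂, splitAt, h1, h5, h3] at h4
      · intro w hw
        rw [show _ ↔ _ from hlex w hw]
        simp only [iff_false]
        rintro ⟨⟨h2, h3⟩, h4⟩
        have h5 := hgc w hw h2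
        simp [h1, h5] at h3
        simp [hD₂, splitAt, h1, h5, h3] at h4
    · refine card_eq_of_iff (p' := fun w => c w = c v ∧ D v w)
        (q' := fun w => c w = c v ∧ D w v) ?_ ?_ ?_
      · exact h.leveled.2 v hv
      · intro w hw
        rw [show _ ↔ _ from hlex w hw]
        constructor
        · rintro ⟨⟨h2, h3⟩, h4⟩
          have h5 := hgc w hw h2
          simp [hD₂, h1, h5] at h4
          exact ⟨h2, h4⟩
        · rintro ⟨h2, h4⟩
          have h5 := hgc w hw h2
          simp [hD₂, h1, h5, h2, h4]
      · intro w hw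
        rw [show _ ↔ _ from hlex w hw]
        constructor
        · rintro ⟨⟨h2, h3⟩, h4⟩
          have h5 := hgc w hw h2
          simp [hD₂, h1, h5] at h4
          exact ⟨h2, h4⟩
        · rintro ⟨h2, h4⟩
          have h5 := hgc w hw h2
          simp [hD₂, h1, h5, h2, h4]

/-- A solution for a tournament that has been split yields a solution for the original one. -/
theorem solvable_of_split {k m : ℕ} {g r : α → ℕ} (hm : IsBalanceCost (middle S g) T m)
    (h : Solvable S (splitAt T g r) k) : Solvable S T (k + (m + numDown S T g)) := by
  obtain ⟨D, c, h1, h2, h3⟩ := h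
  obtain ⟨⟨E, hE1, hE2, hE3⟩, -⟩ := hm
  obtain ⟨N, hN⟩ := exists_level_bound S c
  have hmono : ∀ x ∈ S, ∀ y ∈ S, D x y → g x ≤ g y := by
    intro x hx y hy hD
    have := h1 x hx y hy hD
    simp only [splitAt] at this
    split_ifs at this <;> omega
  have h4 := h3.refine hmono hN
  obtain ⟨D₂, hD₂⟩ : ∃ D₂ : α → α → Prop, ∀ x y, D₂ x y ↔
      if g x = g y then if g x = 1 then E x y else D x y else g x < g y ∧ T x y :=
    ⟨_, fun _ _ => Iff.rfl⟩
  have hc2 : ∀ v ∈ S, (if g v = 1 then 0 else c v) < N := by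
    intro v hv
    have := hN v hv
    split_ifs <;> omega
  refine ⟨D₂, fun v => g v * N + if g v = 1 then 0 else c v, ?_, ?_, ?_, ?_⟩
  · intro x hx y hy hD
    simp only [hD₂] at hD
    split_ifs at hD with h5 h6
    · exact hE1 x (mem_filter.2 ⟨hx, h6⟩) y (mem_filter.2 ⟨hy, h5 ▸ h6⟩) hD
    · have := h1 x hx y hy hD
      simpa [splitAt, h5, h5 ▸ h6] using this
    · exact hD.2
  · rw [numDeleted_middle] at hE3
    have hsub : {p ∈ S ×ˢ S | T p.1 p.2 ∧ ¬ D₂ p.1 p.2} ⊆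
        {p ∈ S ×ˢ S | splitAt T g r p.1 p.2 ∧ ¬ D p.1 p.2} ∪
        ({p ∈ S ×ˢ S | (g p.1 = 1 ∧ g p.2 = 1) ∧ T p.1 p.2 ∧ ¬ E p.1 p.2} ∪
        {p ∈ S ×ˢ S | T p.1 p.2 ∧ g p.2 < g p.1}) := by
      intro p hp
      simp only [mem_union, mem_filter] at hp ⊢
      obtain ⟨hp1, hp2, hp3⟩ := hp
      simp only [hD₂] at hp3
      by_cases h5 : g p.1 = g p.2
      · by_cases h6 : g p.1 = 1
        · rw [if_pos h5, if_pos h6] at hp3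
          exact .inr (.inl ⟨hp1, ⟨h6, h5 ▸ h6⟩, hp2, hp3⟩)
        · rw [if_pos h5, if_neg h6] at hp3
          exact .inl ⟨hp1, by simp [splitAt, h5, h5 ▸ h6, hp2], hp3⟩
      · rw [if_neg h5] at hp3
        exact .inr (.inr ⟨hp1, hp2, by grind⟩)
    have h5 := card_le_card hsub
    have h6 := card_union_le {p ∈ S ×ˢ S | splitAt T g r p.1 p.2 ∧ ¬ D p.1 p.2}
        ({p ∈ S ×ˢ S | (g p.1 = 1 ∧ g p.2 = 1) ∧ T p.1 p.2 ∧ ¬ E p.1 p.2} ∪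
        {p ∈ S ×ˢ S | T p.1 p.2 ∧ g p.2 < g p.1})
    have h7 := card_union_le
        {p ∈ S ×ˢ S | (g p.1 = 1 ∧ g p.2 = 1) ∧ T p.1 p.2 ∧ ¬ E p.1 p.2}
        {p ∈ S ×ˢ S | T p.1 p.2 ∧ g p.2 < g p.1}
    unfold numDeleted at h2 ⊢
    unfold numDown
    omega
  · intro x hx y hy hD
    simp only [hD₂] at hD ⊢
    have hx2 := hc2 x hx
    have hy2 := hc2 y hy
    split_ifs at hD with h5 h6
    · simp [h6, ← h5]
    · have := h3.1 x hx y hy hD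
      simp [h6, ← h5, this]
    · have := Nat.mul_le_mul_right N (Nat.succ_le_of_lt hD.1)
      rw [Nat.succ_mul] at this
      omega
  · intro v hv
    have hlex : ∀ w ∈ S, (g w * N + (if g w = 1 then 0 else c w) =
        g v * N + (if g v = 1 then 0 else c v)) ↔
        (g w = g v ∧ (if g w = 1 then 0 else c w) = if g v = 1 then 0 else c v) :=
      fun w hw => lex_eq_iff (hc2 w hw) (hc2 v hv)
    by_cases h5 : g v = 1
    · have h6 := hE2 v (mem_filter.2 ⟨hv, h5⟩)
      rw [card_middle, card_middle] at h6
      refine card_eq_of_iff (p' := fun w => g w = 1 ∧ E v w)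
        (q' := fun w => g w = 1 ∧ E w v) ?_ ?_ ?_
      · exact h6
      · intro w hw
        rw [show _ ↔ _ from hlex w hw]
        simp only [hD₂, h5, if_true]
        constructor
        · rintro ⟨⟨h7, -⟩, h8⟩
          simp [h7] at h8
          exact ⟨h7, h8⟩
        · rintro ⟨h7, h8⟩
          simp [h7, h8]
      · intro w hw
        rw [show _ ↔ _ from hlex w hw]
        simp only [hD₂, h5, if_true]
        constructor
        · rintro ⟨⟨h7, -⟩, h8⟩
          simp [h7] at h8
          exact ⟨h7, h8⟩
        · rintro ⟨h7, h8⟩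
          simp [h7, h8]
    · have h6 := h4.2 v hv
      simp only at h6
      have hlex' : ∀ w ∈ S, (g w * N + c w = g v * N + c v) ↔ (g w = g v ∧ c w = c v) :=
        fun w hw => lex_eq_iff (hN w hw) (hN v hv)
      refine card_eq_of_iff (p' := fun w => g w * N + c w = g v * N + c v ∧ D v w)
        (q' := fun w => g w * N + c w = g v * N + c v ∧ D w v) ?_ ?_ ?_
      · exact h6
      · intro w hw
        rw [show _ ↔ _ from hlex w hw, show _ ↔ _ from hlex' w hw]
        constructor
        · rintro ⟨⟨h7, h8⟩, h9⟩
          simp [h7, h5] at h8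
          simp [hD₂, h7, h5] at h9
          exact ⟨⟨h7, h8⟩, h9⟩
        · rintro ⟨⟨h7, h8⟩, h9⟩
          simp [hD₂, h7, h5, h8, h9]
      · intro w hw
        rw [show _ ↔ _ from hlex w hw, show _ ↔ _ from hlex' w hw]
        constructor
        · rintro ⟨⟨h7, h8⟩, h9⟩
          simp [h7, h5] at h8
          simp [hD₂, h7, h5] at h9
          exact ⟨⟨h7, h8⟩, h9⟩
        · rintro ⟨⟨h7, h8⟩, h9⟩
          simp [hD₂, h7, h5, h8, h9]

/-- In every solution with at most `κ` deleted arcs, the positions relative to a large class are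
relative to a level that contains this class. -/
theorem IsSolution.position_spec (hT : IsTournamentOn S T) (h : IsSolution S T D c κ) {d : ℕ}
    (hd : 4 * κ + 2 ≤ #(degClass S T d)) :
    ∃ l, (∀ x ∈ degClass S T d, c x = l) ∧ ∀ v ∈ S,
      (c v < l → position T κ (degClass S T d) v = 0) ∧
      (c v = l → position T κ (degClass S T d) v = 1) ∧
      (l < c v → position T κ (degClass S T d) v = 2) := by
  obtain ⟨l, h1, h2⟩ := h.exists_level hT hd
  refine ⟨l, h1, fun v hv => ?_⟩
  have h3 := h2 v hv
  refine ⟨fun hc => by simp [position, h3.1 hc], fun hc => ?_, fun hc => ?_⟩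
  · have := h3.2.2 hc
    rw [position, if_neg (Nat.not_le.2 this.1), if_neg (Nat.not_le.2 this.2)]
  · have h4 := h3.2.1 hc
    have h5 : ¬ #{x ∈ degClass S T d | T x v} ≤ κ := by
      intro h6
      have h7 := card_filter_add_card_filter_not (s := (degClass S T d).erase v) fun x => T x v
      have h8 := pred_card_le_card_erase (s := degClass S T d) (a := v)
      have h9 : #{x ∈ (degClass S T d).erase v | T x v} ≤ #{x ∈ degClass S T d | T x v} :=
        card_le_card (filter_subset_filter _ (erase_subset _ _))
      have h10 : #{x ∈ (degClass S T d).erase v | ¬ T x v} ≤ #{x ∈ degClass S T d | T v x} := by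
        refine card_le_card fun x hx => ?_
        simp only [mem_filter, mem_erase] at hx ⊢
        exact ⟨hx.1.2, (hT.2 v hv x (mem_filter.1 hx.1.2).1 (Ne.symm hx.1.1)).2 hx.2⟩
      omega
    simp [position, h4, h5]

/-- Splitting at the level of a large class leads to an equivalent instance. -/
theorem solvable_iff_split (hT : IsTournamentOn S T) {d k m : ℕ} {r : α → ℕ} (hk : k ≤ κ)
    (hd : 4 * κ + 2 ≤ #(degClass S T d))
    (hm : IsBalanceCost (middle S (position T κ (degClass S T d))) T m) :
    Solvable S T k ↔
      (∀ x ∈ degClass S T d, position T κ (degClass S T d) x = 1) ∧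
      m + numDown S T (position T κ (degClass S T d)) ≤ k ∧
      Solvable S (splitAt T (position T κ (degClass S T d)) r)
        (k - (m + numDown S T (position T κ (degClass S T d)))) := by
  constructor
  · rw [solvable_iff]
    rintro ⟨D, c, h⟩
    have h' : IsSolution S T D c κ := ⟨h.sub, h.card.trans hk, h.leveled⟩
    obtain ⟨l, h1, h2⟩ := h'.position_spec hT hd
    exact ⟨fun x hx => (h2 x (mem_filter.1 hx).1).2.1 (h1 x hx), h.split h2 hm⟩
  · rintro ⟨-, h1, h2⟩
    have := solvable_of_split hm h2
    rwa [Nat.sub_add_cancel h1] at this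

theorem isTournamentOn_splitAt (hT : IsTournamentOn S T) {g r : α → ℕ}
    (hr : Set.InjOn r S) : IsTournamentOn S (splitAt T g r) := by
  refine ⟨fun x hx => ?_, fun x hx y hy hxy => ?_⟩
  · have := hT.1 x hx
    simp [splitAt, this]
  · have h1 := hT.2 x hx y hy hxy
    have h2 : r x ≠ r y := fun h => hxy (hr hx hy h)
    unfold splitAt
    by_cases h3 : g x = g y
    · by_cases h4 : g x = 1
      · have h5 : g y = 1 := h3 ▸ h4
        simp only [h4, h5, if_true]; omega
      · have h5 : g y ≠ 1 := h3 ▸ h4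
        simp only [h3, h5, if_true, if_false, h1]
    · simp only [h3, Ne.symm h3, if_false]; omega

/-- The vertices that lie on directed triangles. -/
noncomputable def onTriangle (S : Finset α) (T : α → α → Prop) : Finset α :=
  {v ∈ S | ∃ u ∈ S, ∃ w ∈ S, T v u ∧ T u w ∧ T w v}

theorem mem_onTriangle_of_inDeg_eq (hT : IsTournamentOn S T) {x y : α} (hx : x ∈ S) (hy : y ∈ S)
    (hne : x ≠ y) (h : inDeg S T x = inDeg S T y) : x ∈ onTriangle S T := by
  -- an arc `u → v` between vertices of the same in-degree lies in a triangle
  have key : ∀ u ∈ S, ∀ v ∈ S, T u v → inDeg S T u = inDeg S T v → ∃ w ∈ S, T v w ∧ T w u := by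
    intro u hu v hv huv huv'
    by_contra hcon
    push Not at hcon
    have : inDeg S T u < inDeg S T v := by
      refine card_lt_card ((ssubset_iff_of_subset fun w hw => ?_).2 ⟨u, by simp [hu, huv], by
        simp [hT.1 u hu]⟩)
      simp only [mem_filter] at hw ⊢
      refine ⟨hw.1, ?_⟩
      have hwv : w ≠ v := by
        rintro rfl
        exact (hT.2 w hw.1 u hu (by rintro rfl; exact hT.1 w hw.1 huv)).1 hw.2 huv
      rw [hT.2 w hw.1 v hv hwv]
      exact fun hvw => hcon w hw.1 hvw hw.2
    omega
  by_cases hxy : T x y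
  · obtain ⟨w, hw, h1, h2⟩ := key x hx y hy hxy h
    exact mem_filter.2 ⟨hx, y, hy, w, hw, hxy, h1, h2⟩
  · have hyx : T y x := by
      have := hT.2 x hx y hy hne
      tauto
    obtain ⟨w, hw, h1, h2⟩ := key y hy x hx hyx h.symm
    exact mem_filter.2 ⟨hx, w, hw, y, hy, h1, h2, hyx⟩

/-- After splitting at a level, the middle vertices lie on no triangle any more. -/
theorem card_onTriangle_splitAt_lt (hT : IsTournamentOn S T) {g r : α → ℕ} {d : ℕ}
    (hd : 2 ≤ #(degClass S T d)) (hg : ∀ x ∈ degClass S T d, g x = 1) :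
    #(onTriangle S (splitAt T g r)) < #(onTriangle S T) := by
  obtain ⟨x, hx, y, hy, hxy⟩ := one_lt_card.1 hd
  have hx' := mem_filter.1 hx
  have hy' := mem_filter.1 hy
  have key : ∀ v u w, splitAt T g r v u → splitAt T g r u w → splitAt T g r w v →
      g v ≠ 1 ∧ T v u ∧ T u w ∧ T w v := by
    intro v u w h1 h2 h3
    unfold splitAt at h1 h2 h3
    split_ifs at h1 h2 h3 <;> first | omega | exact ⟨by assumption, h1, h2, h3⟩
  refine card_lt_card ((ssubset_iff_of_subset fun v hv => ?_).2 ⟨x,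
    mem_onTriangle_of_inDeg_eq hT hx'.1 hy'.1 hxy (hx'.2.trans hy'.2.symm), fun hx2 => ?_⟩)
  · obtain ⟨h1, u, hu, w, hw, h2, h3, h4⟩ := mem_filter.1 hv
    exact mem_filter.2 ⟨h1, u, hu, w, hw, (key v u w h2 h3 h4).2⟩
  · obtain ⟨h1, u, hu, w, hw, h2, h3, h4⟩ := mem_filter.1 hx2
    exact (key x u w h2 h3 h4).1 (hg x hx)

/-! ### Reversing an arc in many triangles -/

/-- The digraph `T` with the arc from `q` to `p` reversed. -/
def reverseArc (T : α → α → Prop) (q p : α) (x y : α) : Prop :=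
  T x y ∧ ¬ (x = q ∧ y = p) ∨ x = p ∧ y = q

/-- The vertices that form a triangle with the arc from `q` to `p`. -/
noncomputable def triangleVertices (S : Finset α) (T : α → α → Prop) (q p : α) : Finset α :=
  {u ∈ S | T p u ∧ T u q}

/-- If many vertices `u` lie between `p` and `q`, and not too many of them have the same in-degree,
then `p` is below `q` in every solution: at least `4 * κ + 2` of these vertices are unaffected,
their levels are between those of `p` and `q`, and they are not all the same. -/
theorem IsSolution.lt_of_triangles (hT : IsTournamentOn S T) (h : IsSolution S T D c κ)
    {p q : α} (hp : p ∈ S) (hq : q ∈ S) {U : Finset α} (hUS : U ⊆ S)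
    (hU : ∀ u ∈ U, T p u ∧ T u q) (hcard : 6 * κ + 2 ≤ #U)
    (hsmall : ∀ d, #{u ∈ U | inDeg S T u = d} < 4 * κ + 2) : c p < c q := by
  have haff : #(affected S T D) ≤ 2 * κ := card_affected_le.trans (by have := h.card; omega)
  have hsd := card_le_card_sdiff_add_card (s := U) (t := affected S T D)
  have hU' : ∀ u ∈ U \ affected S T D, c p ≤ c u ∧ c u ≤ c q := by
    intro u hu
    rw [mem_sdiff] at hu
    have huS := hUS hu.1
    exact ⟨h.leveled.1 p hp u huS ((iff_of_not_affected h.sub huS hp hu.2).2.2 (hU u hu.1).1),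
      h.leveled.1 u huS q hq ((iff_of_not_affected h.sub huS hq hu.2).1.2 (hU u hu.1).2)⟩
  obtain ⟨u₀, hu₀⟩ : (U \ affected S T D).Nonempty := card_pos.1 (by omega)
  by_contra hcon
  have h0 := hU' u₀ hu₀
  have h1 := hsmall (inDeg S T u₀)
  have h2 : #(U \ affected S T D) ≤ #{u ∈ U | inDeg S T u = inDeg S T u₀} := by
    refine card_le_card fun u hu => ?_
    have h3 := hU' u hu
    rw [mem_sdiff] at hu hu₀
    refine mem_filter.2 ⟨hu.1, (h.inDeg_eq_iff hT (hUS hu.1) hu.2 (hUS hu₀.1) hu₀.2).2 (by omega)⟩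
  omega

theorem isTournamentOn_reverseArc (hT : IsTournamentOn S T) {p q : α} (hp : p ∈ S) (hq : q ∈ S)
    (hqp : T q p) : IsTournamentOn S (reverseArc T q p) := by
  have hne : p ≠ q := by rintro rfl; exact hT.1 p hp hqp
  refine ⟨fun x hx => ?_, fun x hx y hy hxy => ?_⟩
  · have := hT.1 x hx
    unfold reverseArc
    rintro (h | ⟨rfl, rfl⟩)
    · exact this h.1
    · exact hne rfl
  · have h1 := hT.2 x hx y hy hxy
    have h2 := hT.2 p hp q hq hne
    unfold reverseArc
    by_cases h3 : x = q ∧ y = p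
    · obtain ⟨rfl, rfl⟩ := h3
      simp [hxy]
    · by_cases h4 : x = p ∧ y = q
      · obtain ⟨rfl, rfl⟩ := h4; simp [hxy]
      · have h5 : ¬ (y = q ∧ x = p) := fun h => h4 ⟨h.2, h.1⟩
        have h6 : ¬ (y = p ∧ x = q) := fun h => h3 ⟨h.2, h.1⟩
        simp [h3, h4, h5, h6, h1]

/-- An arc that lies in many triangles is deleted in every solution, if there are no large classes
of vertices of the same in-degree, so it may as well be reversed at the expense of one deletion. -/
theorem solvable_iff_reverseArc (hT : IsTournamentOn S T) {k : ℕ} (hk : k ≤ κ) {p q : α}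
    (hp : p ∈ S) (hq : q ∈ S) (hqp : T q p) (htri : 6 * κ + 2 ≤ #(triangleVertices S T q p))
    (hsmall : ∀ d, #(degClass S T d) < 4 * κ + 2) :
    Solvable S T k ↔ k ≠ 0 ∧ Solvable S (reverseArc T q p) (k - 1) := by
  have hne : p ≠ q := by rintro rfl; exact hT.1 p hp hqp
  have hsm : ∀ d, #{u ∈ triangleVertices S T q p | inDeg S T u = d} < 4 * κ + 2 := fun d =>
    (card_le_card (fun u hu => by
      simp only [mem_filter, triangleVertices, degClass] at hu ⊢
      exact ⟨hu.1.1, hu.2⟩)).trans_lt (hsmall d)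
  have hU : ∀ u ∈ triangleVertices S T q p, T p u ∧ T u q ∧ u ∈ S ∧ u ≠ p ∧ u ≠ q := by
    intro u hu
    obtain ⟨h1, h2, h3⟩ := mem_filter.1 hu
    refine ⟨h2, h3, h1, ?_, ?_⟩
    · rintro rfl; exact hT.1 u hp h2
    · rintro rfl; exact hT.1 u hq h3
  rw [solvable_iff, solvable_iff]
  constructor
  · rintro ⟨D, c, h⟩
    have hc := IsSolution.lt_of_triangles hT ⟨h.sub, h.card.trans hk, h.leveled⟩ hp hq
      (filter_subset _ _) (fun u hu => ⟨(hU u hu).1, (hU u hu).2.1⟩) htri hsm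
    have hD : ¬ D q p := fun hD => by have := h.leveled.1 q hq p hp hD; omega
    have hdel : (q, p) ∈ {p ∈ S ×ˢ S | T p.1 p.2 ∧ ¬ D p.1 p.2} := by simp [hp, hq, hqp, hD]
    have h0 : numDeleted S T D ≠ 0 := (card_pos.2 ⟨_, hdel⟩).ne'
    obtain ⟨D₂, hD₂⟩ : ∃ D₂ : α → α → Prop, ∀ x y, D₂ x y ↔ D x y ∨ x = p ∧ y = q :=
      ⟨_, fun _ _ => Iff.rfl⟩
    refine ⟨by have := h.card; omega, D₂, c, ?_, ?_, ?_, ?_⟩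
    · intro x hx y hy hxy
      rcases (hD₂ x y).1 hxy with hxy | hxy
      · refine .inl ⟨h.sub x hx y hy hxy, ?_⟩
        rintro ⟨rfl, rfl⟩
        exact hD hxy
      · exact .inr hxy
    · have h1 : {e ∈ S ×ˢ S | reverseArc T q p e.1 e.2 ∧ ¬ D₂ e.1 e.2} ⊆
          ({e ∈ S ×ˢ S | T e.1 e.2 ∧ ¬ D e.1 e.2}).erase (q, p) := by
        rintro ⟨x, y⟩ he
        obtain ⟨h1, h2 | h2, h3⟩ := mem_filter.1 he <;> rw [hD₂] at h3
        · exact mem_erase.2 ⟨fun h => h2.2 (Prod.mk.inj h), mem_filter.2 ⟨h1, h2.1, by tauto⟩⟩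
        · exact absurd (.inr h2) h3
      have h2 := card_le_card h1
      rw [card_erase_of_mem hdel] at h2
      have h3 := h.card
      unfold numDeleted at h3 ⊢
      omega
    · intro x hx y hy hxy
      rcases (hD₂ x y).1 hxy with hxy | ⟨rfl, rfl⟩
      · exact h.leveled.1 x hx y hy hxy
      · exact hc.le
    · intro v hv
      refine card_eq_of_iff (p' := fun w => c w = c v ∧ D v w)
        (q' := fun w => c w = c v ∧ D w v) ?_ ?_ ?_
      · exact h.leveled.2 v hv
      · intro w _
        rw [hD₂]
        refine and_congr_right fun hw => or_iff_left ?_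
        rintro ⟨rfl, rfl⟩; omega
      · intro w _
        rw [hD₂]
        refine and_congr_right fun hw => or_iff_left ?_
        rintro ⟨rfl, rfl⟩; omega
  · rintro ⟨hk0, D, c, h⟩
    have hT' := isTournamentOn_reverseArc hT hp hq hqp
    have hdeg : ∀ u ∈ triangleVertices S T q p, inDeg S (reverseArc T q p) u = inDeg S T u := by
      intro u hu
      have := hU u hu
      exact card_filter_congr fun w _ => by simp [reverseArc, this]
    have hc := IsSolution.lt_of_triangles (κ := κ) hT' ⟨h.sub, h.card.trans (by omega), h.leveled⟩
      hp hq (U := triangleVertices S T q p) (filter_subset _ _) (fun u hu => by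
        have := hU u hu
        simp [reverseArc, this]) htri (fun d => by
        rw [card_filter_congr (q := fun u => inDeg S T u = d) fun u hu => by rw [hdeg u hu]]
        exact hsm d)
    obtain ⟨D₂, hD₂⟩ : ∃ D₂ : α → α → Prop, ∀ x y, D₂ x y ↔ D x y ∧ ¬ (x = p ∧ y = q) :=
      ⟨_, fun _ _ => Iff.rfl⟩
    refine ⟨D₂, c, ?_, ?_, ?_, ?_⟩
    · intro x hx y hy hxy
      obtain ⟨h1, h2⟩ := (hD₂ x y).1 hxy
      have := h.sub x hx y hy h1
      unfold reverseArc at this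
      tauto
    · have h1 : {e ∈ S ×ˢ S | T e.1 e.2 ∧ ¬ D₂ e.1 e.2} ⊆
          insert (q, p) {e ∈ S ×ˢ S | reverseArc T q p e.1 e.2 ∧ ¬ D e.1 e.2} := by
        rintro ⟨x, y⟩ he
        obtain ⟨h1, h2, h3⟩ := mem_filter.1 he
        rw [hD₂] at h3
        by_cases h4 : x = p ∧ y = q
        · obtain ⟨rfl, rfl⟩ := h4
          exact absurd h2 ((hT.2 y hq x hp (Ne.symm hne)).1 hqp)
        · by_cases h5 : x = q ∧ y = p
          · obtain ⟨rfl, rfl⟩ := h5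
            exact mem_insert_self _ _
          · exact mem_insert_of_mem (mem_filter.2 ⟨h1, .inl ⟨h2, h5⟩, by tauto⟩)
      have h2 := card_le_card h1
      have h3 := card_insert_le (q, p) {e ∈ S ×ˢ S | reverseArc T q p e.1 e.2 ∧ ¬ D e.1 e.2}
      have h4 := h.card
      unfold numDeleted at h4 ⊢
      omega
    · intro x hx y hy hxy
      exact h.leveled.1 x hx y hy ((hD₂ x y).1 hxy).1
    · intro v hv
      refine card_eq_of_iff (p' := fun w => c w = c v ∧ D v w)
        (q' := fun w => c w = c v ∧ D w v) ?_ ?_ ?_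
      · exact h.leveled.2 v hv
      · intro w _
        rw [hD₂]
        refine and_congr_right fun hw => and_iff_left ?_
        rintro ⟨rfl, rfl⟩; omega
      · intro w _
        rw [hD₂]
        refine and_congr_right fun hw => and_iff_left ?_
        rintro ⟨rfl, rfl⟩; omega

end Rules

/-! ### The vertices outside balanced strong components -/

section Kernel

open Classical Finset Relation

variable {α : Type*} {S : Finset α} {T D : α → α → Prop} {c : α → ℕ} {κ k : ℕ}

/-- Among the arcs that lie on cycles, as many arcs enter `v` as leave `v`. -/
def IsCyclicallyBalancedAt (S : Finset α) (T : α → α → Prop) (v : α) : Prop :=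
  #{w ∈ S | T v w ∧ Reach S T w v} = #{w ∈ S | T w v ∧ Reach S T v w}

/-- The vertices in the strong components that are not balanced. -/
noncomputable def unbalancedPart (S : Finset α) (T : α → α → Prop) : Finset α :=
  {v ∈ S | ∃ u ∈ S, Reach S T v u ∧ Reach S T u v ∧ ¬ IsCyclicallyBalancedAt S T u}

theorem Reach.mono (h : ∀ x ∈ S, ∀ y ∈ S, D x y → T x y) {x y : α} (hxy : Reach S D x y) :
    Reach S T x y :=
  ReflTransGen.mono (fun a b hab => ⟨hab.1, hab.2.1, h a hab.1 b hab.2.1 hab.2.2⟩) _ _ hxy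

theorem mem_unbalancedPart_congr {v w : α} (hv : v ∈ S) (hw : w ∈ S) (hvw : Reach S T v w)
    (hwv : Reach S T w v) : v ∈ unbalancedPart S T ↔ w ∈ unbalancedPart S T := by
  constructor <;> intro h <;> obtain ⟨-, u, hu, h1, h2, h3⟩ := mem_filter.1 h
  · exact mem_filter.2 ⟨hw, u, hu, hwv.trans h1, h2.trans hvw, h3⟩
  · exact mem_filter.2 ⟨hv, u, hu, hvw.trans h1, h2.trans hwv, h3⟩

theorem Solvable.restrict (h : Solvable S T k) : Solvable (unbalancedPart S T) T k := by
  obtain ⟨D, c, h1, h2, h3⟩ := h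
  have hsub : unbalancedPart S T ⊆ S := filter_subset _ _
  refine ⟨D, c, fun x hx y hy => h1 x (hsub hx) y (hsub hy), le_trans (card_le_card ?_) h2,
    fun x hx y hy => h3.1 x (hsub hx) y (hsub hy), fun v hv => ?_⟩
  · exact filter_subset_filter _ (product_subset_product hsub hsub)
  · have key : ∀ w ∈ S, c w = c v → D v w ∨ D w v → w ∈ unbalancedPart S T := by
      intro w hw hc hD
      rcases hD with hD | hD
      · exact (mem_unbalancedPart_congr (hsub hv) hw (.single ⟨hsub hv, hw, h1 v (hsub hv) w hw hD⟩)
          ((h3.reach (hsub hv) hw hD hc.symm).mono h1)).1 hv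
      · exact (mem_unbalancedPart_congr (hsub hv) hw ((h3.reach hw (hsub hv) hD hc).mono h1)
          (.single ⟨hw, hsub hv, h1 w hw v (hsub hv) hD⟩)).1 hv
    have h4 := h3.2 v (hsub hv)
    convert h4 using 2 <;> ext w <;> simp only [mem_filter] <;>
      exact ⟨fun h => ⟨hsub h.1, h.2⟩, fun h => ⟨key w h.1 h.2.1 (by tauto), h.2⟩⟩

/-- A solution on the unbalanced part is extended by all arcs that do not lie inside it. The levels
are the strong components of `T` in the order of `exists_component_level`, subdivided in the
unbalanced part by the levels of the solution. -/
theorem solvable_of_unbalancedPart (h : Solvable (unbalancedPart S T) T k) : Solvable S T k := by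
  obtain ⟨D, c, h1, h2, h3⟩ := h
  set W := unbalancedPart S T with hW
  have hsub : W ⊆ S := filter_subset _ _
  obtain ⟨g, hg1, hg2⟩ := exists_component_level S T
  obtain ⟨N, hN⟩ := exists_level_bound W c
  have hN' : ∀ w ∈ S, (if w ∈ W then c w else 0) < N + 1 := fun w _ => by
    split_ifs with hw
    · exact (hN w hw).trans (Nat.lt_succ_self _)
    · exact Nat.succ_pos _
  obtain ⟨E, hE⟩ : ∃ E : α → α → Prop, ∀ x y, E x y ↔ if x ∈ W ∧ y ∈ W then D x y else T x y :=
    ⟨_, fun _ _ => Iff.rfl⟩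
  have hET : ∀ x ∈ S, ∀ y ∈ S, E x y → T x y := by
    intro x hx y hy hxy
    rw [hE] at hxy
    split_ifs at hxy with h
    · exact h1 x h.1 y h.2 hxy
    · exact hxy
  have hcomp : ∀ x ∈ S, ∀ y ∈ S, T x y → g x = g y → (x ∈ W ↔ y ∈ W) := fun x hx y hy hxy h =>
    mem_unbalancedPart_congr hx hy (.single ⟨hx, hy, hxy⟩) (hg2 x hx y hy (.single ⟨hx, hy, hxy⟩) h)
  have h4 := h3.refine (fun x hx y hy hxy => hg1 x (hsub hx) y (hsub hy) (h1 x hx y hy hxy))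
    (fun x hx => (hN x hx).trans (Nat.lt_succ_self _))
  refine ⟨E, fun v => g v * (N + 1) + if v ∈ W then c v else 0, hET, le_trans (card_le_card ?_) h2,
    ?_, fun v hv => ?_⟩
  · rintro ⟨x, y⟩ he
    obtain ⟨-, he1, he2⟩ := mem_filter.1 he
    rw [hE] at he2
    split_ifs at he2 with h
    · exact mem_filter.2 ⟨mem_product.2 h, he1, he2⟩
    · exact absurd he1 he2
  · intro x hx y hy hxy
    have hT := hET x hx y hy hxy
    have h5 := hN' x hx
    have h6 := hN' y hy
    dsimp only
    rcases (hg1 x hx y hy hT).lt_or_eq with h7 | h7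
    · have := Nat.mul_le_mul_right (N + 1) (Nat.succ_le_of_lt h7)
      rw [Nat.succ_mul] at this
      omega
    · have h8 := hcomp x hx y hy hT h7
      rw [hE] at hxy
      by_cases h9 : x ∈ W
      · rw [if_pos ⟨h9, h8.1 h9⟩] at hxy
        have := h3.1 x h9 y (h8.1 h9) hxy
        simp [h9, h8.1 h9, h7, this]
      · simp [h9, h7]
  · have hlex : ∀ w ∈ S, (g w * (N + 1) + (if w ∈ W then c w else 0) =
        g v * (N + 1) + if v ∈ W then c v else 0) ↔
        g w = g v ∧ (if w ∈ W then c w else 0) = if v ∈ W then c v else 0 :=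
      fun w hw => lex_eq_iff (hN' w hw) (hN' v hv)
    by_cases hvW : v ∈ W
    · convert h4.2 v hvW using 2 <;> ext w <;> simp only [mem_filter]
      · constructor
        · rintro ⟨h5, h6, h7⟩
          have h8 := (hcomp v hv w h5 (hET v hv w h5 h7) ((hlex w h5).1 h6).1.symm).1 hvW
          rw [hE, if_pos ⟨hvW, h8⟩] at h7
          simp only [hvW, h8, if_true] at h6
          exact ⟨h8, h6, h7⟩
        · rintro ⟨h5, h6, h7⟩
          exact ⟨hsub h5, by simp only [hvW, h5, if_true]; exact h6,
            by rw [hE, if_pos ⟨hvW, h5⟩]; exact h7⟩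
      · constructor
        · rintro ⟨h5, h6, h7⟩
          have h8 := (hcomp w h5 v hv (hET w h5 v hv h7) ((hlex w h5).1 h6).1).2 hvW
          rw [hE, if_pos ⟨h8, hvW⟩] at h7
          simp only [hvW, h8, if_true] at h6
          exact ⟨h8, h6, h7⟩
        · rintro ⟨h5, h6, h7⟩
          exact ⟨hsub h5, by simp only [hvW, h5, if_true]; exact h6,
            by rw [hE, if_pos ⟨h5, hvW⟩]; exact h7⟩
    · have h5 : IsCyclicallyBalancedAt S T v := by
        by_contra h5
        exact hvW (mem_filter.2 ⟨hv, v, hv, .refl, .refl, h5⟩)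
      have hEv : ∀ w, (E v w ↔ T v w) ∧ (E w v ↔ T w v) := fun w => by
        rw [hE, hE, if_neg fun h => hvW h.1, if_neg fun h => hvW h.2]
        exact ⟨Iff.rfl, Iff.rfl⟩
      refine card_eq_of_iff h5 (fun w hw => ?_) fun w hw => ?_
      · rw [show _ ↔ _ from hlex w hw, (hEv w).1]
        constructor
        · rintro ⟨⟨h6, -⟩, h7⟩
          exact ⟨h7, hg2 v hv w hw (.single ⟨hv, hw, h7⟩) h6.symm⟩
        · rintro ⟨h6, h7⟩
          have h8 := le_antisymm (h7.monotone hg1) (hg1 v hv w hw h6)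
          have h9 := (not_congr (hcomp v hv w hw h6 h8.symm)).1 hvW
          simp [h8, h9, hvW, h6]
      · rw [show _ ↔ _ from hlex w hw, (hEv w).2]
        constructor
        · rintro ⟨⟨h6, -⟩, h7⟩
          exact ⟨h7, hg2 w hw v hv (.single ⟨hw, hv, h7⟩) h6⟩
        · rintro ⟨h6, h7⟩
          have h8 := le_antisymm (hg1 w hw v hv h6) (h7.monotone hg1)
          have h9 := (not_congr (hcomp w hw v hv h6 h8)).2 hvW
          simp [h8, h9, hvW, h6]

theorem solvable_unbalancedPart_iff : Solvable (unbalancedPart S T) T k ↔ Solvable S T k :=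
  ⟨solvable_of_unbalancedPart, Solvable.restrict⟩

/-- A vertex whose level contains no affected vertex and that lies in no triangle with a deleted
arc belongs to a balanced strong component: the level is a union of such components. -/
theorem IsSolution.not_mem_unbalancedPart (hT : IsTournamentOn S T) (h : IsSolution S T D c k)
    {v : α} (hv : ∀ a ∈ affected S T D, c a ≠ c v)
    (htri : ∀ q ∈ S, ∀ p ∈ S, T q p → ¬ D q p → v ∉ triangleVertices S T q p) :
    v ∉ unbalancedPart S T := by
  intro hvW
  obtain ⟨hvS, u, hu, h1, h2, h3⟩ := mem_filter.1 hvW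
  have haff : ∀ w ∈ S, c w = c v → ∀ x ∈ S, (D w x ↔ T w x) ∧ (D x w ↔ T x w) :=
    fun w hw hc x hx => iff_of_not_affected h.sub hw hx fun hw' => hv w hw' hc
  obtain ⟨g, hg⟩ : ∃ g : α → ℕ, ∀ w, g w = if c w < c v then 0 else if c w = c v then 1 else 2 :=
    ⟨_, fun _ => rfl⟩
  have hg1 : ∀ x ∈ S, ∀ y ∈ S, T x y → g x ≤ g y := by
    intro x hx y hy hxy
    by_cases hD : D x y
    · have := h.leveled.1 x hx y hy hD
      rw [hg, hg]
      split_ifs <;> omega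
    · by_contra hgt
      have hx' : c x ≠ c v := fun hc => hD ((haff x hx hc y hy).1.2 hxy)
      have hy' : c y ≠ c v := fun hc => hD ((haff y hy hc x hx).2.2 hxy)
      have h4 : c y < c v ∧ c v < c x := by
        rw [hg, hg] at hgt
        split_ifs at hgt <;> omega
      refine htri x hx y hy hxy hD (mem_filter.2 ⟨hvS, ?_, ?_⟩)
      · by_contra hyv
        have hvy := (hT.2 v hvS y hy (by rintro rfl; exact hy' rfl)).2 hyv
        have := h.leveled.1 v hvS y hy ((haff v hvS rfl y hy).1.2 hvy)
        omega
      · by_contra hvx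
        have hxv := (hT.2 x hx v hvS (by rintro rfl; exact hx' rfl)).2 hvx
        have := h.leveled.1 x hx v hvS ((haff v hvS rfl x hx).2.2 hxv)
        omega
  have hlev : ∀ w, g w = 1 ↔ c w = c v := fun w => by
    rw [hg]; split_ifs <;> grind
  have hu1 : c u = c v := by
    rw [← hlev, le_antisymm (h2.monotone hg1) (h1.monotone hg1), hlev]
  refine h3 (card_eq_of_iff (h.leveled.2 u hu) (fun w hw => ?_) fun w hw => ?_)
  · constructor
    · rintro ⟨h4, h5⟩
      have h6 := le_antisymm (h5.monotone hg1) (hg1 u hu w hw h4)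
      rw [(hlev u).2 hu1, hlev] at h6
      exact ⟨h6.trans hu1.symm, (haff u hu hu1 w hw).1.2 h4⟩
    · rintro ⟨h4, h5⟩
      exact ⟨h.sub u hu w hw h5, (h.leveled.reach hu hw h5 h4.symm).mono h.sub⟩
  · constructor
    · rintro ⟨h4, h5⟩
      have h6 := le_antisymm (hg1 w hw u hu h4) (h5.monotone hg1)
      rw [(hlev u).2 hu1, hlev] at h6
      exact ⟨h6.trans hu1.symm, (haff u hu hu1 w hw).2.2 h4⟩
    · rintro ⟨h4, h5⟩
      exact ⟨h.sub w hw u hu h5, (h.leveled.reach hw hu h5 h4).mono h.sub⟩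

/-- If no rule applies to a yes-instance, then few vertices are outside the balanced strong
components: the at most `2 * κ` affected ones, at most `4 * κ + 1` others in the level of each of
them, and those that form a triangle with one of the at most `κ` deleted arcs. -/
theorem card_unbalancedPart_le (hT : IsTournamentOn S T) (h : Solvable S T κ)
    (hsmall : ∀ d, #(degClass S T d) < 4 * κ + 2)
    (htri : ∀ q ∈ S, ∀ p ∈ S, T q p → #(triangleVertices S T q p) < 6 * κ + 2) :
    #(unbalancedPart S T) ≤ κ * (16 * κ + 8) := by
  obtain ⟨D, c, h⟩ := solvable_iff.1 h
  have haff : #(affected S T D) ≤ 2 * κ := card_affected_le.trans (by have := h.card; omega)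
  have hcover : unbalancedPart S T ⊆ affected S T D ∪
      ((affected S T D).biUnion fun a => {v ∈ S | v ∉ affected S T D ∧ c v = c a}) ∪
      ({p ∈ S ×ˢ S | T p.1 p.2 ∧ ¬ D p.1 p.2}).biUnion fun p =>
        triangleVertices S T p.1 p.2 := by
    intro v hv
    by_contra hcon
    simp only [mem_union, not_or, mem_biUnion, not_exists, not_and] at hcon
    refine h.not_mem_unbalancedPart hT (fun a ha hc => ?_) (fun q hq p hp hqp hD => ?_) hv
    · exact hcon.1.2 a ha (mem_filter.2 ⟨(mem_filter.1 hv).1, hcon.1.1, hc.symm⟩)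
    · exact hcon.2 (q, p) (mem_filter.2 ⟨mem_product.2 ⟨hq, hp⟩, hqp, hD⟩)
  have h1 : #((affected S T D).biUnion fun a => {v ∈ S | v ∉ affected S T D ∧ c v = c a}) ≤
      #(affected S T D) * (4 * κ + 1) := by
    refine card_biUnion_le_card_mul _ _ _ fun a _ => ?_
    rcases ({v ∈ S | v ∉ affected S T D ∧ c v = c a} : Finset α).eq_empty_or_nonempty with h0 | h0
    · rw [h0]; simp
    · obtain ⟨u, hu⟩ := h0
      obtain ⟨hu1, hu2, hu3⟩ := mem_filter.1 hu
      refine Nat.le_of_lt_succ (lt_of_le_of_lt (card_le_card fun v hv => ?_)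
        (hsmall (inDeg S T u)))
      obtain ⟨hv1, hv2, hv3⟩ := mem_filter.1 hv
      exact mem_filter.2 ⟨hv1, (h.inDeg_eq_iff hT hv1 hv2 hu1 hu2).2 (hv3.trans hu3.symm)⟩
  have h2 : #(({p ∈ S ×ˢ S | T p.1 p.2 ∧ ¬ D p.1 p.2}).biUnion fun p =>
      triangleVertices S T p.1 p.2) ≤ #{p ∈ S ×ˢ S | T p.1 p.2 ∧ ¬ D p.1 p.2} * (6 * κ + 1) := by
    refine card_biUnion_le_card_mul _ _ _ fun p hp => ?_
    obtain ⟨hp1, hp2, -⟩ := mem_filter.1 hp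
    rw [mem_product] at hp1
    exact Nat.le_of_lt_succ (htri p.1 hp1.1 p.2 hp1.2 hp2)
  have h3 := (card_le_card hcover).trans ((card_union_le _ _).trans
    (Nat.add_le_add_right (card_union_le _ _) _))
  have h4 : #{p ∈ S ×ˢ S | T p.1 p.2 ∧ ¬ D p.1 p.2} ≤ κ := h.card
  have h5 := Nat.mul_le_mul_right (4 * κ + 1) haff
  have h6 := Nat.mul_le_mul_right (6 * κ + 1) h4
  nlinarith

end Kernel

/-! ### Cheapest balanced subgraphs of a tournament -/

section Flow

open Classical Finset Relation

variable {α : Type*} {S L : Finset α} {T R : α → α → Prop}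

/-- `R` is a tournament on `L` with the same score sequence as `T`. Such tournaments correspond to
the balanced subgraphs of `T`: the arcs of `T` that are reversed in `R` form a balanced digraph. -/
structure IsReorientation (L : Finset α) (T R : α → α → Prop) : Prop where
  isTournamentOn : IsTournamentOn L R
  outDeg : ∀ v ∈ L, #{w ∈ L | R v w} = #{w ∈ L | T v w}

/-- The number of arcs of the tournament `T` on `L` that are not reversed in `R`. -/
noncomputable def numCommon (L : Finset α) (T R : α → α → Prop) : ℕ :=
  #{p ∈ L ×ˢ L | R p.1 p.2 ∧ T p.1 p.2}

theorem IsTournamentOn.outDeg_add_inDeg (hT : IsTournamentOn L T) {v : α} (hv : v ∈ L) :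
    #{w ∈ L | T v w} + #{w ∈ L | T w v} + 1 = #L := by
  rw [← card_erase_add_one hv, ← card_filter_add_card_filter_not (s := L.erase v) fun w => T v w]
  congr 2
  · congr 1
    ext w
    simp only [mem_filter, mem_erase]
    exact ⟨fun h => ⟨⟨fun h' => hT.1 v hv (h' ▸ h.2), h.1⟩, h.2⟩, fun h => ⟨h.1.2, h.2⟩⟩
  · congr 1
    ext w
    simp only [mem_filter, mem_erase]
    refine ⟨fun h => ?_, fun h => ⟨h.1.2, (hT.2 w h.1.2 v hv h.1.1).2 h.2⟩⟩
    have hne : w ≠ v := fun h' => hT.1 v hv (h' ▸ h.2)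
    exact ⟨⟨hne, h.1⟩, (hT.2 w h.1 v hv hne).1 h.2⟩

theorem IsReorientation.inDeg (h : IsReorientation L T R) (hT : IsTournamentOn L T) {v : α}
    (hv : v ∈ L) : #{w ∈ L | R w v} = #{w ∈ L | T w v} := by
  have h1 := hT.outDeg_add_inDeg hv
  have h2 := h.isTournamentOn.outDeg_add_inDeg hv
  have h3 := h.outDeg v hv
  omega

theorem sum_arcs_potential (R : α → α → Prop) (π : α → ℤ) :
    ∑ p ∈ L ×ˢ L, (if R p.1 p.2 then π p.2 - π p.1 else 0) =
      ∑ v ∈ L, π v * #{w ∈ L | R w v} - ∑ v ∈ L, π v * #{w ∈ L | R v w} := by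
  have h : ∀ p : α × α, (if R p.1 p.2 then π p.2 - π p.1 else 0) =
      (if R p.1 p.2 then π p.2 else 0) - if R p.1 p.2 then π p.1 else 0 := fun p => by
    split_ifs <;> simp
  simp only [h, sum_sub_distrib]
  congr 1
  · rw [sum_product_right]
    refine sum_congr rfl fun v _ => ?_
    simp only [← sum_filter, sum_const, nsmul_eq_mul, mul_comm]
  · rw [sum_product]
    refine sum_congr rfl fun v _ => ?_
    simp only [← sum_filter, sum_const, nsmul_eq_mul, mul_comm]

theorem IsReorientation.sum_sign (h : IsReorientation L T R) :
    ∑ p ∈ L ×ˢ L, (if R p.1 p.2 then if T p.1 p.2 then (1 : ℤ) else -1 else 0) =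
      2 * numCommon L T R - ∑ v ∈ L, (#{w ∈ L | T v w} : ℤ) := by
  have h1 : ∀ p : α × α, (if R p.1 p.2 then if T p.1 p.2 then (1 : ℤ) else -1 else 0) =
      2 * (if R p.1 p.2 ∧ T p.1 p.2 then 1 else 0) - if R p.1 p.2 then 1 else 0 := fun p => by
    by_cases h1 : R p.1 p.2 <;> by_cases h2 : T p.1 p.2 <;> simp [h1, h2]
  simp only [h1, sum_sub_distrib, ← mul_sum, sum_boole]
  congr 1
  rw [card_filter_product L R, Nat.cast_sum]
  exact sum_congr rfl fun v hv => by rw [h.outDeg v hv]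

/-- The reversal of a balanced subgraph of a tournament does not change the score sequence. -/
theorem isReorientation_of_balanced (hT : IsTournamentOn L T) {E : α → α → Prop}
    (hE : ∀ x ∈ L, ∀ y ∈ L, E x y → T x y) (hbal : IsBalancedOn L E) :
    IsReorientation L T fun x y => (T x y ∧ ¬ E x y) ∨ E y x := by
  constructor
  · refine ⟨fun x hx => ?_, fun x hx y hy hxy => ?_⟩
    · have := hT.1 x hx
      have := hE x hx x hx
      tauto
    · have := hT.2 x hx y hy hxy
      have := hE x hx y hy
      have := hE y hy x hx
      tauto
  · intro v hv
    have h1 := card_filter_split L (fun w => T v w ∧ ¬ E v w ∨ E w v) fun w => E w v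
    have h2 := card_filter_split L (fun w => T v w) fun w => E v w
    have h3 := hbal v hv
    have h4 : #{w ∈ L | (T v w ∧ ¬ E v w ∨ E w v) ∧ E w v} = #{w ∈ L | E w v} :=
      card_filter_congr fun w _ => by tauto
    have h5 : #{w ∈ L | (T v w ∧ ¬ E v w ∨ E w v) ∧ ¬ E w v} = #{w ∈ L | T v w ∧ ¬ E v w} :=
      card_filter_congr fun w hw => by
        have h6 := hE w hw v hv
        have h7 : T v w → ¬ T w v := fun h => by
          by_cases hvw : v = w
          · subst hvw; exact absurd h (hT.1 v hv)
          · exact (hT.2 v hv w hw hvw).1 h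
        tauto
    have h6 : #{w ∈ L | T v w ∧ E v w} = #{w ∈ L | E v w} :=
      card_filter_congr fun w hw => by have := hE v hv w hw; tauto
    have h8 : #{w ∈ L | T v w ∧ ¬ E v w ∨ E w v} = #{w ∈ L | T v w} := by omega
    convert h8

/-- Linear programming duality: a potential whose differences bound the gain of every arc of `R`
certifies that the arcs of `T` that are reversed in `R` form a largest balanced subgraph. -/
theorem IsReorientation.isBalanceCost (hT : IsTournamentOn L T) (h : IsReorientation L T R)
    {π : α → ℤ}
    (hπ : ∀ x ∈ L, ∀ y ∈ L, R x y → (if T x y then 1 else -1) ≤ π y - π x) :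
    IsBalanceCost L T (numCommon L T R) := by
  constructor
  · refine ⟨fun x y => T x y ∧ ¬ R x y, fun x _ y _ h => h.1, fun v hv => ?_, ?_⟩
    · have h1 := card_filter_split L (fun w => T v w) fun w => R v w
      have h2 := card_filter_split L (fun w => R v w) fun w => T v w
      have h3 := h.outDeg v hv
      have h4 : #{w ∈ L | T v w ∧ R v w} = #{w ∈ L | R v w ∧ T v w} :=
        card_filter_congr fun w _ => and_comm
      have h5 : #{w ∈ L | T w v ∧ ¬ R w v} = #{w ∈ L | R v w ∧ ¬ T v w} :=
        card_filter_congr fun w hw => by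
          by_cases hvw : v = w
          · subst hvw
            exact iff_of_false (fun h => hT.1 v hv h.1) fun h' => h.isTournamentOn.1 v hv h'.1
          · have := hT.2 v hv w hw hvw
            have := h.isTournamentOn.2 v hv w hw hvw
            tauto
      have h6 : #{w ∈ L | T v w ∧ ¬ R v w} = #{w ∈ L | T w v ∧ ¬ R w v} := by omega
      convert h6
    · unfold numDeleted numCommon
      congr 1
      ext p
      simp only [mem_filter]
      tauto
  · intro E hE hbal
    obtain ⟨R', hR', h', hE'⟩ : ∃ R' : α → α → Prop,
        (∀ x y, R' x y ↔ (T x y ∧ ¬ E x y) ∨ E y x) ∧ IsReorientation L T R' ∧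
        numCommon L T R' = numDeleted L T E := by
      refine ⟨_, fun _ _ => Iff.rfl, isReorientation_of_balanced hT hE hbal, ?_⟩
      unfold numDeleted numCommon
      congr 1
      ext p
      simp only [mem_filter]
      refine and_congr_right fun hp => ?_
      have h1 := hE p.2 (mem_product.1 hp).2 p.1 (mem_product.1 hp).1
      have h2 : T p.1 p.2 → ¬ T p.2 p.1 := fun h2 => by
        by_cases hvw : p.1 = p.2
        · rw [hvw] at h2; exact absurd h2 (hT.1 _ (mem_product.1 hp).2)
        · exact (hT.2 _ (mem_product.1 hp).1 _ (mem_product.1 hp).2 hvw).1 h2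
      tauto
    rw [← hE']
    have h1 := h.sum_sign
    have h2 := h'.sum_sign
    have h3 : ∑ p ∈ L ×ˢ L, (if R p.1 p.2 then π p.2 - π p.1 else 0) =
        ∑ p ∈ L ×ˢ L, (if R' p.1 p.2 then π p.2 - π p.1 else 0) := by
      rw [sum_arcs_potential, sum_arcs_potential]
      congr 1
      · exact sum_congr rfl fun v hv => by rw [h.inDeg hT hv, h'.inDeg hT hv]
      · exact sum_congr rfl fun v hv => by rw [h.outDeg v hv, h'.outDeg v hv]
    -- on every pair of vertices, `R` chooses the orientation with the smaller reduced weight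
    have h4 : ∑ p ∈ L ×ˢ L, ((if R p.1 p.2 then if T p.1 p.2 then (1 : ℤ) else -1 else 0) -
          if R p.1 p.2 then π p.2 - π p.1 else 0) ≤
        ∑ p ∈ L ×ˢ L, ((if R' p.1 p.2 then if T p.1 p.2 then (1 : ℤ) else -1 else 0) -
          if R' p.1 p.2 then π p.2 - π p.1 else 0) := by
      refine sum_le_sum fun p hp => ?_
      obtain ⟨hx, hy⟩ := mem_product.1 hp
      by_cases hxy : p.1 = p.2
      · have h5 : ¬ R p.1 p.2 := by rw [hxy]; exact h.isTournamentOn.1 _ hy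
        have h6 : ¬ R' p.1 p.2 := by rw [hxy]; exact h'.isTournamentOn.1 _ hy
        simp [h5, h6]
      · have h5 := h.isTournamentOn.2 _ hx _ hy hxy
        have h7 := hT.2 _ hx _ hy hxy
        have h8 := hπ _ hx _ hy
        have h9 := hπ _ hy _ hx
        by_cases h10 : R p.1 p.2 <;> by_cases h11 : R' p.1 p.2 <;> by_cases h12 : T p.1 p.2 <;>
          simp_all <;> omega
    rw [sum_sub_distrib, sum_sub_distrib, h1, h2, h3] at h4
    omega

/-! ### The reversal of cycles of positive gain -/

/-- The arcs from `f 0` to `f 1`, from `f 1` to `f 2` and so on are reversed one after the other. -/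
def reversePath (R : α → α → Prop) (f : ℕ → α) : ℕ → α → α → Prop
  | 0 => R
  | i + 1 => reverseArc (reversePath R f i) (f i) (f (i + 1))

theorem sum_reverseArc (hR : IsTournamentOn L R) {q p : α} (hq : q ∈ L) (hp : p ∈ L)
    (hqp : R q p) (h : α × α → ℤ) :
    ∑ e ∈ L ×ˢ L with reverseArc R q p e.1 e.2, h e =
      ∑ e ∈ L ×ˢ L with R e.1 e.2, h e - h (q, p) + h (p, q) := by
  have hne : p ≠ q := by rintro rfl; exact hR.1 p hp hqp
  have h1 : {e ∈ L ×ˢ L | reverseArc R q p e.1 e.2} =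
      insert (p, q) ({e ∈ L ×ˢ L | R e.1 e.2}.erase (q, p)) := by
    ext ⟨x, y⟩
    simp only [mem_filter, mem_insert, mem_erase, mem_product, Prod.mk.injEq, ne_eq]
    simp only [reverseArc]
    constructor
    · rintro ⟨h1, h2 | h2⟩
      · exact .inr ⟨h2.2, h1, h2.1⟩
      · exact .inl h2
    · rintro (⟨rfl, rfl⟩ | h1)
      · exact ⟨⟨hp, hq⟩, .inr ⟨rfl, rfl⟩⟩
      · exact ⟨h1.2.1, .inl ⟨h1.2.2, h1.1⟩⟩
  have h2 : (p, q) ∉ ({e ∈ L ×ˢ L | R e.1 e.2}.erase (q, p)) := fun h2 =>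
    (hR.2 q hq p hp (Ne.symm hne)).1 hqp (mem_filter.1 (mem_of_mem_erase h2)).2
  have h3 : (q, p) ∈ {e ∈ L ×ˢ L | R e.1 e.2} := mem_filter.2 ⟨mem_product.2 ⟨hq, hp⟩, hqp⟩
  rw [h1, sum_insert h2, ← add_sum_erase _ h h3]
  ring

theorem reversePath_arc {f : ℕ → α} {m : ℕ} (harc : ∀ i < m, R (f i) (f (i + 1)))
    (hinj : ∀ i < m, ∀ j < m, f i = f j → i = j) {i : ℕ} (him : i < m) :
    ∀ j ≤ i, reversePath R f j (f i) (f (i + 1)) := by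
  intro j
  induction j with
  | zero => exact fun _ => harc i him
  | succ j ih =>
    intro hj
    refine .inl ⟨ih (by omega), ?_⟩
    rintro ⟨h1, -⟩
    have := hinj i him j (by omega) h1
    omega

theorem reversePath_spec (hR : IsTournamentOn L R) {f : ℕ → α} {m : ℕ}
    (hf : ∀ i ≤ m, f i ∈ L) (harc : ∀ i < m, R (f i) (f (i + 1)))
    (hinj : ∀ i < m, ∀ j < m, f i = f j → i = j) {i : ℕ} (him : i ≤ m) :
    IsTournamentOn L (reversePath R f i) ∧ ∀ h : α × α → ℤ,
      ∑ e ∈ L ×ˢ L with reversePath R f i e.1 e.2, h e =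
        ∑ e ∈ L ×ˢ L with R e.1 e.2, h e -
          ∑ j ∈ range i, (h (f j, f (j + 1)) - h (f (j + 1), f j)) := by
  induction i with
  | zero =>
    refine ⟨hR, fun h => ?_⟩
    rw [range_zero, sum_empty, sub_zero]
    rfl
  | succ i ih =>
    have h1 := ih (by omega)
    have h2 := reversePath_arc harc hinj (i := i) him i le_rfl
    refine ⟨isTournamentOn_reverseArc h1.1 (hf _ him) (hf i (by omega)) h2, fun h => ?_⟩
    have := sum_reverseArc h1.1 (hf i (by omega)) (hf _ him) h2 h
    rw [h1.2] at this
    rw [sum_range_succ]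
    refine Eq.trans this ?_
    ring

/-- The reversal of a cycle preserves the score sequence, and it decreases the number of common
arcs if more than half of the arcs of the cycle are common. -/
theorem IsReorientation.reversePath (h : IsReorientation L T R) (hT : IsTournamentOn L T)
    {f : ℕ → α} {m : ℕ} (hf : ∀ i ≤ m, f i ∈ L) (hclosed : f m = f 0)
    (harc : ∀ i < m, R (f i) (f (i + 1))) (hinj : ∀ i < m, ∀ j < m, f i = f j → i = j)
    (hgain : m < ∑ i ∈ range m, if T (f i) (f (i + 1)) then 2 else 0) :
    IsReorientation L T (reversePath R f m) ∧
      numCommon L T (_root_.reversePath R f m) < numCommon L T R := by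
  obtain ⟨h1, h2⟩ := reversePath_spec h.isTournamentOn hf harc hinj le_rfl
  refine ⟨⟨h1, fun v hv => ?_⟩, ?_⟩
  · rw [← h.outDeg v hv]
    have key : ∀ Q : α → α → Prop, (#{w ∈ L | Q v w} : ℤ) =
        ∑ e ∈ L ×ˢ L with Q e.1 e.2, if e.1 = v then 1 else 0 := by
      intro Q
      rw [sum_boole, filter_filter]
      congr 1
      refine card_bij' (fun w _ => (v, w)) (fun e _ => e.2) ?_ ?_ ?_ ?_
      · intro w hw
        obtain ⟨h3, h4⟩ := mem_filter.1 hw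
        exact mem_filter.2 ⟨mem_product.2 ⟨hv, h3⟩, h4, rfl⟩
      · intro e he
        obtain ⟨h3, h4, h5⟩ := mem_filter.1 he
        exact mem_filter.2 ⟨(mem_product.1 h3).2, h5 ▸ h4⟩
      · intro w _; rfl
      · rintro ⟨a, b⟩ he
        obtain ⟨-, -, rfl⟩ := mem_filter.1 he
        rfl
    have h3 := h2 fun e => if e.1 = v then 1 else 0
    rw [← key, ← key] at h3
    have h4 : ∑ j ∈ range m, ((if f j = v then (1 : ℤ) else 0) - if f (j + 1) = v then 1 else 0) =
        0 := by
      rw [sum_range_sub' (fun j => if f j = v then (1 : ℤ) else 0), hclosed, sub_self]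
    simp only [h4] at h3
    omega
  · have key : ∀ Q : α → α → Prop, (numCommon L T Q : ℤ) =
        ∑ e ∈ L ×ˢ L with Q e.1 e.2, if T e.1 e.2 then 1 else 0 := by
      intro Q
      rw [sum_boole, filter_filter, numCommon]
    have h3 := h2 fun e => if T e.1 e.2 then 1 else 0
    rw [← key, ← key] at h3
    have h4 : ∀ j ∈ range m, ((if T (f j) (f (j + 1)) then (1 : ℤ) else 0) -
        if T (f (j + 1)) (f j) then 1 else 0) =
        ((if T (f j) (f (j + 1)) then 2 else 0 : ℕ) : ℤ) - 1 := by
      intro j hj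
      have hj' := mem_range.1 hj
      have h5 : f j ≠ f (j + 1) := fun h5 =>
        h.isTournamentOn.1 (f j) (hf j hj'.le) (by have := harc j hj'; rwa [← h5] at this)
      have h6 := hT.2 _ (hf j hj'.le) _ (hf (j + 1) hj') h5
      by_cases h7 : T (f (j + 1)) (f j)
      · simp [h7, h6]
      · simp [h7, h6]
    dsimp only at h3
    rw [sum_congr rfl h4, sum_sub_distrib, ← Nat.cast_sum, sum_const, card_range] at h3
    simp only [nsmul_eq_mul, mul_one] at h3
    omega

/-! ### Walks of maximum weight -/

/-- If there is a walk with `m` arcs from `u` to `v` in `R`, then this is 1 plus the maximum weight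
of such a walk, where the arcs of `T` have weight 2 and all others have weight 0; otherwise this
is 0. -/
noncomputable def walkValue (S : Finset α) (R T : α → α → Prop) : ℕ → α → α → ℕ
  | 0, u, v => if u = v then 1 else 0
  | m + 1, u, v => S.sup fun w => if R u w ∧ walkValue S R T m w v ≠ 0 then
      walkValue S R T m w v + (if T u w then 2 else 0) else 0

theorem walkValue_cons {m : ℕ} {u w v : α} (hw : w ∈ S) (huw : R u w)
    (h : walkValue S R T m w v ≠ 0) :
    walkValue S R T m w v + (if T u w then 2 else 0) ≤ walkValue S R T (m + 1) u v := by
  refine le_trans ?_ (le_sup (f := fun w => if R u w ∧ walkValue S R T m w v ≠ 0 then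
      walkValue S R T m w v + (if T u w then 2 else 0) else 0) hw)
  exact (if_pos (c := R u w ∧ walkValue S R T m w v ≠ 0) ⟨huw, h⟩).ge

theorem exists_walkValue_succ {m : ℕ} {u v : α} (h : walkValue S R T (m + 1) u v ≠ 0) :
    ∃ w ∈ S, R u w ∧ walkValue S R T m w v ≠ 0 ∧
      walkValue S R T m w v + (if T u w then 2 else 0) = walkValue S R T (m + 1) u v := by
  have hS : S.Nonempty := by
    rw [nonempty_iff_ne_empty]
    rintro rfl
    exact h rfl
  obtain ⟨w, hw, h1⟩ := exists_mem_eq_sup S hS fun w => if R u w ∧ walkValue S R T m w v ≠ 0 then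
      walkValue S R T m w v + (if T u w then 2 else 0) else 0
  have h1' : walkValue S R T (m + 1) u v = if R u w ∧ walkValue S R T m w v ≠ 0 then
      walkValue S R T m w v + (if T u w then 2 else 0) else 0 := h1
  by_cases h2 : R u w ∧ walkValue S R T m w v ≠ 0
  · rw [if_pos h2] at h1'
    exact ⟨w, hw, h2.1, h2.2, h1'.symm⟩
  · rw [if_neg h2] at h1'
    exact absurd h1' h

theorem walkValue_trans {a b : ℕ} {x y z : α} (h1 : walkValue S R T a x y ≠ 0)
    (h2 : walkValue S R T b y z ≠ 0) :
    walkValue S R T a x y + walkValue S R T b y z ≤ walkValue S R T (a + b) x z + 1 := by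
  induction a generalizing x with
  | zero =>
    have : x = y := by by_contra h; exact h1 (if_neg h)
    subst this
    rw [Nat.zero_add, show walkValue S R T 0 x x = 1 from if_pos rfl]
    omega
  | succ a ih =>
    obtain ⟨w, hw, h3, h4, h5⟩ := exists_walkValue_succ h1
    have h6 := ih h4
    have h7 : walkValue S R T (a + b) w z ≠ 0 := by omega
    have h8 := walkValue_cons hw h3 h7
    rw [show a + 1 + b = a + b + 1 by omega]
    omega

theorem walkValue_arc {u v : α} (hv : v ∈ S) (h : R u v) :
    1 + (if T u v then 2 else 0) ≤ walkValue S R T 1 u v := by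
  have h1 : walkValue S R T 0 v v = 1 := if_pos rfl
  have h2 : _ ≤ walkValue S R T 1 u v := walkValue_cons (T := T) hv h (m := 0) (v := v) (by omega)
  rwa [h1] at h2

theorem le_walkValue {f : ℕ → α} {a : ℕ} (d : ℕ) (hf : ∀ i, a < i → i ≤ a + d → f i ∈ S)
    (harc : ∀ i, a ≤ i → i < a + d → R (f i) (f (i + 1))) :
    1 + ∑ i ∈ Ico a (a + d), (if T (f i) (f (i + 1)) then 2 else 0) ≤
      walkValue S R T d (f a) (f (a + d)) := by
  induction d with
  | zero => simp [walkValue]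
  | succ d ih =>
    have h1 := ih (fun i hi hi' => hf i hi (by omega)) fun i hi hi' => harc i hi (by omega)
    have h2 := walkValue_arc (T := T) (hf (a + d + 1) (by omega) (by omega))
      (harc (a + d) (by omega) (by omega))
    have h3 := walkValue_trans (show walkValue S R T d (f a) (f (a + d)) ≠ 0 by omega)
      (show walkValue S R T 1 (f (a + d)) (f (a + d + 1)) ≠ 0 by omega)
    rw [← add_assoc, sum_Ico_succ_top (by omega)]
    omega

/-- The walk `f` from `f 0` to `v` has `m` arcs and maximum weight. -/
def IsBestWalk (S : Finset α) (R T : α → α → Prop) (m : ℕ) (v : α) (f : ℕ → α) : Prop :=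
  ∀ i < m, f (i + 1) ∈ S ∧ R (f i) (f (i + 1)) ∧ walkValue S R T (m - i - 1) (f (i + 1)) v ≠ 0 ∧
    walkValue S R T (m - i - 1) (f (i + 1)) v + (if T (f i) (f (i + 1)) then 2 else 0) =
      walkValue S R T (m - i) (f i) v

theorem IsBestWalk.value {m : ℕ} {v : α} {f : ℕ → α} (h : IsBestWalk S R T m v f)
    (h0 : walkValue S R T m (f 0) v ≠ 0) : ∀ i ≤ m, walkValue S R T (m - i) (f i) v ≠ 0 ∧
      walkValue S R T m (f 0) v = walkValue S R T (m - i) (f i) v +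
        ∑ j ∈ range i, if T (f j) (f (j + 1)) then 2 else 0 := by
  intro i
  induction i with
  | zero => simp [h0]
  | succ i ih =>
    intro hi
    have h1 := ih (by omega)
    obtain ⟨-, -, h2, h3⟩ := h i hi
    rw [sum_range_succ, show m - (i + 1) = m - i - 1 by omega]
    exact ⟨h2, by omega⟩

theorem IsBestWalk.last {m : ℕ} {v : α} {f : ℕ → α} (h : IsBestWalk S R T m v f)
    (h0 : walkValue S R T m (f 0) v ≠ 0) : f m = v ∧ walkValue S R T m (f 0) v = 1 +
        ∑ j ∈ range m, if T (f j) (f (j + 1)) then 2 else 0 := by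
  obtain ⟨h1, h2⟩ := h.value h0 m le_rfl
  rw [Nat.sub_self] at h1 h2
  have h3 : f m = v := by by_contra h; exact h1 (if_neg h)
  rw [show walkValue S R T 0 (f m) v = 1 from if_pos h3] at h2
  exact ⟨h3, h2⟩

theorem exists_isBestWalk {m : ℕ} {u v : α} (h : walkValue S R T m u v ≠ 0) :
    ∃ f : ℕ → α, f 0 = u ∧ IsBestWalk S R T m v f := by
  induction m generalizing u with
  | zero => exact ⟨fun _ => u, rfl, fun i hi => absurd hi (Nat.not_lt_zero i)⟩
  | succ m ih =>
    obtain ⟨w, hw, h3, h4, h5⟩ := exists_walkValue_succ h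
    obtain ⟨f, rfl, hf⟩ := ih h4
    refine ⟨fun i => Nat.casesOn i u f, rfl, fun i hi => ?_⟩
    cases i with
    | zero => exact ⟨hw, h3, h4, h5⟩
    | succ i =>
      have := hf i (by omega)
      rw [show m + 1 - (i + 1) = m - i by omega]
      exact this

/-- There is a closed walk with `m` arcs and of positive gain: more than half of its arcs are arcs
of `T`. -/
def HasGain (S : Finset α) (R T : α → α → Prop) (m : ℕ) (u : α) : Prop :=
  m + 1 < walkValue S R T m u u

/-- A shortest closed walk of positive gain is a cycle: otherwise it consists of two shorter closed
walks, and one of them has positive gain. -/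
theorem IsBestWalk.injective {m : ℕ} {f : ℕ → α} (h : IsBestWalk S R T m (f 0) f)
    (hgain : HasGain S R T m (f 0)) (hf0 : f 0 ∈ S)
    (hmin : ∀ l < m, ∀ u ∈ S, ¬ HasGain S R T l u) : ∀ i < m, ∀ j < m, f i = f j → i = j := by
  have key : ∀ i < m, ∀ j < m, f i = f j → ¬ i < j := by
    intro i hi j hj hij hlt
    unfold HasGain at hgain hmin
    obtain ⟨h1, h2⟩ := h.last (by omega)
    have hS : ∀ i ≤ m, f i ∈ S := fun i hi => by
      cases i with
      | zero => exact hf0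
      | succ i => exact (h i hi).1
    have h3 := le_walkValue (S := S) (R := R) (T := T) (f := f) (a := 0) i
      (fun l _ _ => hS l (by omega)) fun l _ _ => (h l (by omega)).2.1
    have h4 := le_walkValue (S := S) (R := R) (T := T) (f := f) (a := i) (j - i)
      (fun l _ _ => hS l (by omega)) fun l _ _ => (h l (by omega)).2.1
    have h5 := le_walkValue (S := S) (R := R) (T := T) (f := f) (a := j) (m - j)
      (fun l _ _ => hS l (by omega)) fun l _ _ => (h l (by omega)).2.1
    rw [show i + (j - i) = j by omega] at h4
    rw [show j + (m - j) = m by omega, h1, ← hij] at h5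
    rw [zero_add] at h3
    have h6 := walkValue_trans (show walkValue S R T i (f 0) (f i) ≠ 0 by omega)
      (show walkValue S R T (m - j) (f i) (f 0) ≠ 0 by omega)
    have h7 := hmin (i + (m - j)) (by omega) (f 0) hf0
    rw [← hij] at h4
    have h8 := hmin (j - i) (by omega) (f i) (hS i hi.le)
    have h9 := sum_Ico_consecutive (fun j => if T (f j) (f (j + 1)) then 2 else 0)
      (Nat.zero_le i) hlt.le
    have h10 := sum_Ico_consecutive (fun j => if T (f j) (f (j + 1)) then 2 else 0)
      (Nat.zero_le j) hj.le
    rw [range_eq_Ico] at h2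
    omega
  intro i hi j hj hij
  have h1 := key i hi j hj hij
  have h2 := key j hj i hi hij.symm
  omega

/-- If no closed walk has positive gain, then longer walks have no larger gain. -/
theorem exists_shorter_walk {m : ℕ} {u v : α} (hu : u ∈ S) (hm : #S ≤ m)
    (h : walkValue S R T m u v ≠ 0) (hmin : ∀ l ≤ m, ∀ u ∈ S, ¬ HasGain S R T l u) :
    ∃ l < m, walkValue S R T l u v ≠ 0 ∧
      walkValue S R T m u v + l ≤ walkValue S R T l u v + m := by
  obtain ⟨f, rfl, hf⟩ := exists_isBestWalk h
  obtain ⟨h1, h2⟩ := hf.last h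
  have hS : ∀ i ≤ m, f i ∈ S := fun i hi => by
    cases i with
    | zero => exact hu
    | succ i => exact (hf i hi).1
  obtain ⟨i, hi, j, hj, hne, hij⟩ := exists_ne_map_eq_of_card_lt_of_maps_to
    (s := range (m + 1)) (t := S) (by rw [card_range]; omega) (f := f)
    fun i hi => hS i (Nat.le_of_lt_succ (mem_range.1 hi))
  rw [mem_range] at hi hj
  have key : ∀ i j, i < j → j ≤ m → f i = f j → ∃ l < m, walkValue S R T l (f 0) v ≠ 0 ∧
      walkValue S R T m (f 0) v + l ≤ walkValue S R T l (f 0) v + m := by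
    intro i j hlt hj hij
    unfold HasGain at hmin
    have h3 := le_walkValue (S := S) (R := R) (T := T) (f := f) (a := 0) i
      (fun l _ _ => hS l (by omega)) fun l _ _ => (hf l (by omega)).2.1
    have h4 := le_walkValue (S := S) (R := R) (T := T) (f := f) (a := i) (j - i)
      (fun l _ _ => hS l (by omega)) fun l _ _ => (hf l (by omega)).2.1
    have h5 := le_walkValue (S := S) (R := R) (T := T) (f := f) (a := j) (m - j)
      (fun l _ _ => hS l (by omega)) fun l _ _ => (hf l (by omega)).2.1
    rw [show i + (j - i) = j by omega] at h4
    rw [show j + (m - j) = m by omega, h1, ← hij] at h5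
    rw [zero_add] at h3
    have h6 := walkValue_trans (show walkValue S R T i (f 0) (f i) ≠ 0 by omega)
      (show walkValue S R T (m - j) (f i) v ≠ 0 by omega)
    rw [← hij] at h4
    have h8 := hmin (j - i) (by omega) (f i) (hS i (by omega))
    have h9 := sum_Ico_consecutive (fun j => if T (f j) (f (j + 1)) then 2 else 0)
      (Nat.zero_le i) hlt.le
    have h10 := sum_Ico_consecutive (fun j => if T (f j) (f (j + 1)) then 2 else 0)
      (Nat.zero_le j) hj
    rw [range_eq_Ico] at h2
    exact ⟨i + (m - j), by omega, by omega, by omega⟩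
  rcases Nat.lt_or_gt_of_ne hne with hlt | hlt
  · exact key i j hlt (by omega) hij
  · exact key j i hlt (by omega) hij.symm

/-- If no closed walk has positive gain, then the maximum gain of the walks that end in a vertex is
a potential. -/
theorem IsReorientation.isBalanceCost_of_no_gain (hT : IsTournamentOn L T)
    (h : IsReorientation L T R) (hLS : L ⊆ S)
    (hmin : ∀ l ≤ #S, ∀ u ∈ S, ¬ HasGain S R T l u) :
    IsBalanceCost L T (numCommon L T R) := by
  set n := #S
  obtain ⟨φ, hφ⟩ : ∃ φ : ℕ × α → α → ℕ, ∀ q v, φ q v =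
    if walkValue S R T q.1 q.2 v = 0 then 0 else walkValue S R T q.1 q.2 v + n - q.1 :=
    ⟨_, fun _ _ => rfl⟩
  obtain ⟨π, hπ⟩ : ∃ π : α → ℕ, ∀ v, π v = (range (n + 1) ×ˢ S).sup fun q => φ q v :=
    ⟨_, fun _ => rfl⟩
  have hle : ∀ m ≤ n, ∀ u ∈ S, ∀ v, walkValue S R T m u v ≠ 0 →
      walkValue S R T m u v + n ≤ π v + m := by
    intro m hm u hu v h0
    have h1 := le_sup (f := fun q => φ q v) (mem_product.2 ⟨mem_range.2 (Nat.lt_succ_of_le hm), hu⟩ :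
      (m, u) ∈ range (n + 1) ×ˢ S)
    rw [← hπ, hφ, if_neg h0] at h1
    dsimp only at h1
    omega
  have hex : ∀ v ∈ S, ∃ m < n, ∃ u ∈ S, walkValue S R T m u v ≠ 0 ∧
      π v + m ≤ walkValue S R T m u v + n := by
    intro v hv
    obtain ⟨⟨m, u⟩, hq, h1⟩ := exists_mem_eq_sup (range (n + 1) ×ˢ S)
      ⟨(0, v), mem_product.2 ⟨mem_range.2 (Nat.succ_pos _), hv⟩⟩ fun q => φ q v
    rw [← hπ, hφ] at h1
    obtain ⟨hm, hu⟩ := mem_product.1 hq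
    rw [mem_range] at hm
    dsimp only at hm hu h1
    have h2 : walkValue S R T 0 v v = 1 := if_pos rfl
    have h3 := hle 0 (Nat.zero_le _) v hv v (by omega)
    split_ifs at h1 with h4
    · omega
    · rcases Nat.lt_or_ge m n with h5 | h5
      · exact ⟨m, h5, u, hu, h4, by omega⟩
      · obtain ⟨l, hl, h6, h7⟩ := exists_shorter_walk hu h5 h4 fun l hl => hmin l (by omega)
        exact ⟨l, by omega, u, hu, h6, by omega⟩
  refine h.isBalanceCost hT (π := fun v => (π v : ℤ)) fun x hx y hy hxy => ?_
  obtain ⟨m, hm, u, hu, h1, h2⟩ := hex x (hLS hx)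
  have h3 := walkValue_arc (S := S) (T := T) (hLS hy) hxy
  have h4 := walkValue_trans h1 (show walkValue S R T 1 x y ≠ 0 by omega)
  have h5 := hle (m + 1) hm u hu y (by omega)
  split_ifs at h3 ⊢ <;> omega

end Flow

/-! ### Reachability and maximum weight walks as programs -/

open RAM Finset Relation

/-- The entry in row `i` and column `j` of the matrix in the array `a` is not zero. The matrices
are square matrices, stored row by row, and their order is in register 0. -/
def RAM.Memory.rel (s : Memory) (a i j : ℕ) : Prop := s.arr a (i * s.reg 0 + j) ≠ 0

namespace HExpr

theorem eval_count_eq {x b : ℕ} {e : HExpr} {s : Memory} {P : ℕ → Prop} [DecidablePred P]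
    (h : ∀ i < s.reg b, e.eval (s.setReg x i) ≠ 0 ↔ P i) :
    (count x b e).eval s = #{i ∈ range (s.reg b) | P i} := by
  rw [eval_count]
  congr 1
  ext i
  simp only [mem_filter, mem_range]
  exact and_congr_right fun hi => h i hi

theorem le_ne_zero {e f : HExpr} {s : Memory} :
    (le e f).eval s ≠ 0 ↔ e.eval s ≤ f.eval s := by simp

theorem lt_ne_zero {e f : HExpr} {s : Memory} :
    (lt e f).eval s ≠ 0 ↔ e.eval s < f.eval s := by simp

theorem eq_ne_zero {e f : HExpr} {s : Memory} :
    (eq e f).eval s ≠ 0 ↔ e.eval s = f.eval s := by simp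

theorem not_ne_zero {e : HExpr} {s : Memory} : (not e).eval s ≠ 0 ↔ ¬ e.eval s ≠ 0 := by simp

theorem and_ne_zero {e f : HExpr} {s : Memory} :
    (and e f).eval s ≠ 0 ↔ e.eval s ≠ 0 ∧ f.eval s ≠ 0 := by simp

theorem or_ne_zero {e f : HExpr} {s : Memory} :
    (or e f).eval s ≠ 0 ↔ e.eval s ≠ 0 ∨ f.eval s ≠ 0 := by simp; tauto

end HExpr

namespace HProg

/-- The program that does nothing. -/
def skip : HProg := set 39 (.reg 39)

/-- Execute `p` if `e` is not zero. -/
def when (e : HExpr) (p : HProg) : HProg := ite e p skip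

@[simp] theorem run_skip (s : Memory) : skip.run s = s := by
  refine Memory.ext' (fun x => ?_) fun _ _ => rfl
  simp only [skip, run, HExpr.eval_reg, Memory.setReg_reg]
  split_ifs with h
  · rw [h]
  · rfl

theorem run_seq (p q : HProg) (s : Memory) : (seq p q).run s = q.run (p.run s) := rfl

theorem run_set (x : ℕ) (e : HExpr) (s : Memory) : (set x e).run s = s.setReg x (e.eval s) := rfl

theorem run_store (a : ℕ) (i e : HExpr) (s : Memory) :
    (store a i e).run s = s.setArr a (i.eval s) (e.eval s) := rfl

theorem run_when (e : HExpr) (p : HProg) (s : Memory) :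
    (when e p).run s = if e.eval s ≠ 0 then p.run s else s := by
  rw [when, run, run_skip]

theorem run_ite (e : HExpr) (p q : HProg) (s : Memory) :
    (ite e p q).run s = if e.eval s ≠ 0 then p.run s else q.run s := rfl

theorem run_loop_induction {x b : ℕ} {p : HProg} {s : Memory} (I : ℕ → Memory → Prop)
    (h0 : I 0 s) (hstep : ∀ i < s.reg b, ∀ s', I i s' → I (i + 1) (p.run (s'.setReg x i))) :
    ∃ s', I (s.reg b) s' ∧ (loop x b p).run s = s'.setReg x (s.reg x) := by
  have key : ∀ N ≤ s.reg b, I N (rounds (fun i s' => p.run (s'.setReg x i)) s N) := by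
    intro N
    induction N with
    | zero => exact fun _ => h0
    | succ N ih => exact fun h => hstep N h _ (ih (by omega))
  exact ⟨_, key _ le_rfl, rfl⟩

theorem arr_fill₂ {a n i j : ℕ} {e : HExpr} (he : e.reads a = false) {s : Memory}
    (hn : s.reg 0 = n) (hi : i < n) (hj : j < n) :
    ((fill₂ a e).run s).arr a (i * n + j) = e.eval ((s.setReg 10 i).setReg 11 j) := by
  rw [run_fill₂ he, Memory.withArr_arr, if_pos rfl, hn]
  exact fill₂_apply hi hj (fun i j => e.eval ((s.setReg 10 i).setReg 11 j)) _

theorem arr_fill₂_of_ne {a b : ℕ} {e : HExpr} (hb : b ≠ a) (he : e.reads a = false)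
    (s : Memory) : ((fill₂ a e).run s).arr b = s.arr b := by
  rw [run_fill₂ he, Memory.withArr_arr, if_neg hb]

theorem reg_fill₂ {a : ℕ} {e : HExpr} (he : e.reads a = false) (s : Memory) (x : ℕ) :
    ((fill₂ a e).run s).reg x = s.reg x := by
  rw [run_fill₂ he, Memory.withArr_reg]

theorem arr_fill {a i : ℕ} {e : HExpr} (he : e.reads a = false) {s : Memory}
    (hi : i < s.reg 0) : ((fill a e).run s).arr a i = e.eval (s.setReg 10 i) := by
  rw [run_fill he, Memory.withArr_arr, if_pos rfl, if_pos hi]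

theorem reg_fill {a : ℕ} {e : HExpr} (he : e.reads a = false) (s : Memory) (x : ℕ) :
    ((fill a e).run s).reg x = s.reg x := by
  rw [run_fill he, Memory.withArr_reg]

/-- Compute in array 8 the reflexive transitive closure of the digraph in array `a`, by the
algorithm of Warshall. Array 5 is auxiliary. -/
def closure (a : ℕ) : HProg :=
  seq (fill₂ 8 (.or (.eq (.reg 10) (.reg 11)) (.get₂ a 10 11))) <|
  loop 20 0 <|
    seq (fill₂ 5 (.or (.get₂ 8 10 11) (.and (.get₂ 8 10 20) (.get₂ 8 20 11))))
      (fill₂ 8 (.get₂ 5 10 11))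

theorem closure_spec {a n : ℕ} (ha' : a ≠ 8) {s : Memory} (hn : s.reg 0 = n)
    {i j : ℕ} (hi : i < n) (hj : j < n) :
    ((closure a).run s).arr 8 (i * n + j) ≠ 0 ↔ Reach (range n) (s.rel a) i j := by
  obtain ⟨s₁, hs₁⟩ : ∃ s₁, s₁ = (fill₂ 8 (.or (.eq (.reg 10) (.reg 11)) (.get₂ a 10 11))).run s :=
    ⟨_, rfl⟩
  have hr : HExpr.reads 8 (.or (.eq (.reg 10) (.reg 11)) (.get₂ a 10 11)) = false := by
    simp [HExpr.or, HExpr.eq, HExpr.get₂, HExpr.reads, ha']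
  have h1 : ∀ i < n, ∀ j < n, s₁.arr 8 (i * n + j) ≠ 0 ↔ i = j ∨ s.rel a i j := by
    intro i hi j hj
    rw [hs₁, arr_fill₂ hr hn hi hj]
    simp [Memory.rel, hn]
    tauto
  have hn₁ : s₁.reg 0 = n := by rw [hs₁, reg_fill₂ hr, hn]
  -- the relation is transitive at the intermediate vertices that have been treated
  obtain ⟨s₂, ⟨-, h2, h3, h4⟩, h5⟩ := run_loop_induction (x := 20) (b := 0)
    (p := seq (fill₂ 5 (.or (.get₂ 8 10 11) (.and (.get₂ 8 10 20) (.get₂ 8 20 11))))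
      (fill₂ 8 (.get₂ 5 10 11))) (s := s₁)
    (fun m s' => s'.reg 0 = n ∧
      (∀ i < n, ∀ j < n, i = j ∨ s.rel a i j → s'.arr 8 (i * n + j) ≠ 0) ∧
      (∀ i < n, ∀ j < n, s'.arr 8 (i * n + j) ≠ 0 → Reach (range n) (s.rel a) i j) ∧
      ∀ k < m, ∀ i < n, ∀ j < n, k < n → s'.arr 8 (i * n + k) ≠ 0 → s'.arr 8 (k * n + j) ≠ 0 →
        s'.arr 8 (i * n + j) ≠ 0)
    (by
      refine ⟨hn₁, fun i hi j hj => (h1 i hi j hj).2, fun i hi j hj h => ?_, by omega⟩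
      rcases (h1 i hi j hj).1 h with rfl | h
      · exact .refl
      · exact .single ⟨mem_range.2 hi, mem_range.2 hj, h⟩)
    (by
      rintro m hm s' ⟨g1, g2, g3, g4⟩
      have hm' : m < n := hn₁ ▸ hm
      have e1 : HExpr.reads 5 (.or (.get₂ 8 10 11) (.and (.get₂ 8 10 20) (.get₂ 8 20 11))) =
          false := rfl
      have e2 : HExpr.reads 8 (.get₂ 5 10 11) = false := rfl
      have g5 : ∀ i < n, ∀ j < n, ((seq (fill₂ 5 (.or (.get₂ 8 10 11) (.and (.get₂ 8 10 20)
          (.get₂ 8 20 11)))) (fill₂ 8 (.get₂ 5 10 11))).run (s'.setReg 20 m)).arr 8 (i * n + j) ≠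
          0 ↔ s'.arr 8 (i * n + j) ≠ 0 ∨
            s'.arr 8 (i * n + m) ≠ 0 ∧ s'.arr 8 (m * n + j) ≠ 0 := by
        intro i hi j hj
        rw [run_seq, arr_fill₂ e2 (by rw [reg_fill₂ e1]; simpa using g1) hi hj]
        simp only [HExpr.eval_get₂ _ (show 10 ≠ 12 by decide), Memory.setReg_reg,
          Memory.setReg_arr, reg_fill₂ e1]
        simp only [Nat.reduceEqDiff, if_true, if_false, g1]
        rw [arr_fill₂ e1 (by simpa using g1) hi hj]
        simp [g1]
        tauto
      refine ⟨?_, fun i hi j hj h => (g5 i hi j hj).2 (.inl (g2 i hi j hj h)),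
        fun i hi j hj h => ?_, fun k hk i hi j hj hkn h h' => ?_⟩
      · rw [run_seq, reg_fill₂ e2, reg_fill₂ e1]; simpa using g1
      · rcases (g5 i hi j hj).1 h with h | h
        · exact g3 i hi j hj h
        · exact (g3 i hi m hm' h.1).trans (g3 m hm' j hj h.2)
      · rw [g5 _ hi _ hkn] at h
        rw [g5 _ hkn _ hj] at h'
        rw [g5 _ hi _ hj]
        rcases Nat.lt_succ_iff_lt_or_eq.1 hk with hk | rfl
        · have := g4 k hk i hi j hj hkn
          have := g4 k hk i hi m hm' hkn
          have := g4 k hk m hm' j hj hkn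
          have := g4 k hk m hm' m hm' hkn
          tauto
        · tauto)
  rw [hn₁] at h4
  have h6 : ((closure a).run s).arr 8 = s₂.arr 8 := by
    rw [closure, run_seq, ← hs₁, h5, Memory.setReg_arr]
  rw [h6]
  refine ⟨h3 i hi j hj, fun h => ?_⟩
  induction h with
  | refl => exact h2 i hi i hi (.inl rfl)
  | @tail b c _ hbc ih =>
    have hb := mem_range.1 hbc.1
    have hc := mem_range.1 hbc.2.1
    exact h4 b hb i hi c hc hb (ih hb) (h2 b hb c hc (.inr hbc.2.2))

/-- Compute in array 4 the matrix of the values `walkValue` of walks with `m` arcs, where `m` is in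
register 36, for the digraphs in the arrays 3 and 0. Array 5 is auxiliary. -/
def walk : HProg :=
  seq (fill₂ 4 (.eq (.reg 10) (.reg 11))) <|
  loop 23 0 <| when (.lt (.reg 23) (.reg 36)) <|
    seq (fill₂ 5 (.sup 13 0 (.ite (.and (.get₂ 3 10 13) (.get₂ 4 13 11))
      (.add (.get₂ 4 13 11) (.ite (.get₂ 0 10 13) (.const 2) (.const 0))) (.const 0))))
    (fill₂ 4 (.get₂ 5 10 11))

theorem walk_spec {n : ℕ} {s : Memory} (hn : s.reg 0 = n) (hm : s.reg 36 ≤ n) {i j : ℕ}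
    (hi : i < n) (hj : j < n) :
    (walk.run s).arr 4 (i * n + j) = walkValue (range n) (s.rel 3) (s.rel 0) (s.reg 36) i j := by
  obtain ⟨s₁, hs₁⟩ : ∃ s₁, s₁ = (fill₂ 4 (.eq (.reg 10) (.reg 11))).run s := ⟨_, rfl⟩
  have hr : HExpr.reads 4 (.eq (.reg 10) (.reg 11)) = false := rfl
  have hn₁ : ∀ x, s₁.reg x = s.reg x := fun x => by rw [hs₁, reg_fill₂ hr]
  obtain ⟨s₂, ⟨-, -, -, -, h1⟩, h2⟩ := run_loop_induction (x := 23) (b := 0)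
    (p := when (.lt (.reg 23) (.reg 36)) <|
      seq (fill₂ 5 (.sup 13 0 (.ite (.and (.get₂ 3 10 13) (.get₂ 4 13 11))
        (.add (.get₂ 4 13 11) (.ite (.get₂ 0 10 13) (.const 2) (.const 0))) (.const 0))))
      (fill₂ 4 (.get₂ 5 10 11))) (s := s₁)
    (fun m s' => s'.reg 0 = n ∧ s'.reg 36 = s.reg 36 ∧ s'.arr 3 = s.arr 3 ∧ s'.arr 0 = s.arr 0 ∧
      ∀ i < n, ∀ j < n, s'.arr 4 (i * n + j) =
        walkValue (range n) (s.rel 3) (s.rel 0) (min m (s.reg 36)) i j)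
    (by
      refine ⟨by rw [hn₁, hn], hn₁ _, ?_, ?_, fun i hi j hj => ?_⟩
      · rw [hs₁, arr_fill₂_of_ne (by decide) hr]
      · rw [hs₁, arr_fill₂_of_ne (by decide) hr]
      · rw [hs₁, arr_fill₂ hr hn hi hj, Nat.zero_min]
        simp [walkValue])
    (by
      rintro m hm s' ⟨g1, g2, g3, g4, g5⟩
      have e1 : HExpr.reads 5 (.sup 13 0 (.ite (.and (.get₂ 3 10 13) (.get₂ 4 13 11))
        (.add (.get₂ 4 13 11) (.ite (.get₂ 0 10 13) (.const 2) (.const 0))) (.const 0))) =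
          false := rfl
      have e2 : HExpr.reads 4 (.get₂ 5 10 11) = false := rfl
      have hc : HExpr.eval (.lt (.reg 23) (.reg 36)) (s'.setReg 23 m) ≠ 0 ↔ m < s.reg 36 := by
        rw [HExpr.lt_ne_zero]
        simp [g2]
      rw [run_when]
      by_cases g7 : m < s.reg 36
      · rw [if_pos (hc.2 g7)]
        refine ⟨?_, ?_, ?_, ?_, fun i hi j hj => ?_⟩
        · rw [run_seq, reg_fill₂ e2, reg_fill₂ e1]; simpa using g1
        · rw [run_seq, reg_fill₂ e2, reg_fill₂ e1]; simpa using g2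
        · rw [run_seq, arr_fill₂_of_ne (by decide) e2, arr_fill₂_of_ne (by decide) e1]; exact g3
        · rw [run_seq, arr_fill₂_of_ne (by decide) e2, arr_fill₂_of_ne (by decide) e1]; exact g4
        · rw [run_seq, arr_fill₂ e2 (by rw [reg_fill₂ e1]; simpa using g1) hi hj]
          simp only [HExpr.eval_get₂ _ (show 10 ≠ 12 by decide), Memory.setReg_reg,
            Memory.setReg_arr, reg_fill₂ e1]
          simp only [Nat.reduceEqDiff, if_true, if_false, g1]
          rw [arr_fill₂ e1 (by simpa using g1) hi hj, Nat.min_eq_left (by omega), walkValue]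
          simp only [HExpr.eval_sup, Memory.setReg_reg, Nat.reduceEqDiff, if_false, g1]
          refine sup_congr rfl fun w hw => ?_
          have hw' := mem_range.1 hw
          have g8 := g5 w hw' j hj
          rw [Nat.min_eq_left (by omega)] at g8
          simp [g1, g8, g3, g4, Memory.rel, hn]
      · rw [if_neg (mt hc.1 g7)]
        refine ⟨by simpa using g1, by simpa using g2, g3, g4, fun i hi j hj => ?_⟩
        have := g5 i hi j hj
        rw [Nat.min_eq_right (by omega)] at this ⊢
        exact this)
  have h3 : (walk.run s).arr 4 = s₂.arr 4 := by
    rw [walk, run_seq, ← hs₁, h2, Memory.setReg_arr]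
  rw [h3, h1 i hi j hj, hn₁, hn, Nat.min_eq_right hm]

end HProg

/-! ### A cheapest balanced subgraph by cycle reversals -/

section FlowLemmas

open Classical Finset

variable {α : Type*} {S L : Finset α} {T R R' : α → α → Prop}

theorem reversePath_congr {f f' : ℕ → α} {i : ℕ} (h : ∀ j ≤ i, f j = f' j) :
    reversePath R f i = reversePath R f' i := by
  induction i with
  | zero => rfl
  | succ i ih =>
    rw [reversePath, reversePath, ih fun j hj => h j (by omega), h i (by omega), h (i + 1) le_rfl]

theorem numCommon_congr (h : ∀ x ∈ L, ∀ y ∈ L, R x y ↔ R' x y) :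
    numCommon L T R = numCommon L T R' := by
  refine card_filter_congr fun p hp => ?_
  rw [h p.1 (mem_product.1 hp).1 p.2 (mem_product.1 hp).2]

theorem numCommon_le : numCommon L T R ≤ #L * #L :=
  (card_filter_le _ _).trans (card_product _ _).le

theorem IsReorientation.congr (h : IsReorientation L T R)
    (hR : ∀ x ∈ L, ∀ y ∈ L, R x y ↔ R' x y) : IsReorientation L T R' := by
  refine ⟨⟨fun x hx => ?_, fun x hx y hy hxy => ?_⟩, fun v hv => ?_⟩
  · rw [← hR x hx x hx]; exact h.isTournamentOn.1 x hx
  · rw [← hR x hx y hy, ← hR y hy x hx]; exact h.isTournamentOn.2 x hx y hy hxy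
  · rw [← h.outDeg v hv]
    exact card_filter_congr fun w hw => (hR v hv w hw).symm

theorem reversePath_mem (hR : ∀ x ∈ S, ∀ y ∈ S, R x y → x ∈ L ∧ y ∈ L) {f : ℕ → α} {i : ℕ}
    (hf : ∀ j ≤ i, f j ∈ L) :
    ∀ x ∈ S, ∀ y ∈ S, reversePath R f i x y → x ∈ L ∧ y ∈ L := by
  induction i with
  | zero => exact hR
  | succ i ih =>
    rintro x hx y hy (h | ⟨rfl, rfl⟩)
    · exact ih (fun j hj => hf j (by omega)) x hx y hy h.1
    · exact ⟨hf _ le_rfl, hf _ (by omega)⟩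

/-- Reversing a shortest closed walk of positive gain is an improvement. -/
theorem IsReorientation.reversePath_of_hasGain (hT : IsTournamentOn L T)
    (h : IsReorientation L T R) (hR : ∀ x ∈ S, ∀ y ∈ S, R x y → x ∈ L ∧ y ∈ L) {m : ℕ}
    {f : ℕ → α} (hf : IsBestWalk S R T m (f 0) f) (hgain : HasGain S R T m (f 0))
    (hf0 : f 0 ∈ S) (hmin : ∀ l < m, ∀ u ∈ S, ¬ HasGain S R T l u) :
    IsReorientation L T (_root_.reversePath R f m) ∧
      numCommon L T (_root_.reversePath R f m) < numCommon L T R ∧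
      ∀ x ∈ S, ∀ y ∈ S, _root_.reversePath R f m x y → x ∈ L ∧ y ∈ L := by
  have h0 : m ≠ 0 := by
    rintro rfl
    simp [HasGain, walkValue] at hgain
  have h1 := hgain
  unfold HasGain at h1
  obtain ⟨h2, h3⟩ := hf.last (by omega)
  have hS : ∀ i ≤ m, f i ∈ S := fun i hi => by
    cases i with
    | zero => exact hf0
    | succ i => exact (hf i hi).1
  have hL : ∀ i < m, f i ∈ L := fun i hi =>
    (hR _ (hS i hi.le) _ (hS (i + 1) hi) (hf i hi).2.1).1
  have hL' : ∀ i ≤ m, f i ∈ L := fun i hi => by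
    rcases hi.lt_or_eq with hi | rfl
    · exact hL i hi
    · rw [h2]; exact hL 0 (by omega)
  obtain ⟨h4, h5⟩ := h.reversePath hT hL' h2 (fun i hi => (hf i hi).2.1)
    (hf.injective hgain hf0 hmin) (by omega)
  exact ⟨h4, h5, reversePath_mem hR hL'⟩

theorem IsReorientation.exists_improvement (hT : IsTournamentOn L T)
    (h : IsReorientation L T R) (hR : ∀ x ∈ S, ∀ y ∈ S, R x y → x ∈ L ∧ y ∈ L) {l : ℕ} {u : α}
    (hu : u ∈ S) (hgain : HasGain S R T l u) : ∃ R', numCommon L T R' < numCommon L T R := by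
  have hex : ∃ l, ∃ u ∈ S, HasGain S R T l u := ⟨l, u, hu, hgain⟩
  obtain ⟨m, ⟨u, hu, hg⟩, hmin⟩ : ∃ m, (∃ u ∈ S, HasGain S R T m u) ∧
      ∀ l < m, ¬ ∃ u ∈ S, HasGain S R T l u :=
    ⟨Nat.find hex, Nat.find_spec hex, fun l hl => Nat.find_min hex hl⟩
  have hg' := hg
  unfold HasGain at hg'
  obtain ⟨f, rfl, hf⟩ := exists_isBestWalk (show walkValue S R T m u u ≠ 0 by omega)
  exact ⟨_, (h.reversePath_of_hasGain hT hR hf hg hu fun l hl u hu hlu =>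
    hmin l hl ⟨u, hu, hlu⟩).2.1⟩

end FlowLemmas

namespace HProg

open RAM Finset

theorem reg_walk {x : ℕ} (hx : x ≠ 39) (s : Memory) : (walk.run s).reg x = s.reg x :=
  run_reg (by simp [walk, writes, when, skip, fill₂, Ne.symm hx]) s

theorem arr_walk {a : ℕ} (ha : a ≠ 4) (ha' : a ≠ 5) (s : Memory) :
    (walk.run s).arr a = s.arr a :=
  run_arr (by simp [walk, stores, when, skip, fill₂, Ne.symm ha, Ne.symm ha']) s

theorem rel_setReg {x : ℕ} (hx : x ≠ 0) (s : Memory) (v a : ℕ) :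
    (s.setReg x v).rel a = s.rel a := by
  unfold Memory.rel; simp [Ne.symm hx]

/-- If no closed walk of positive gain has been found so far, look for one with one more arc than
the content of register 20. -/
def gainSearch : HProg :=
  when (.not (.reg 34)) <| seq (set 36 (.add (.reg 20) (.const 1))) <| seq walk <|
    seq (set 35 (.find 13 0 (.lt (.add (.reg 36) (.const 1)) (.get₂ 4 13 13)))) <|
    when (.lt (.reg 35) (.reg 0)) <| seq (set 34 (.reg 36)) <| seq (set 37 (.reg 35)) <|
    seq (set 38 (.get₂ 4 35 35)) (set 29 (.reg 35))

/-- Find a shortest closed walk of positive gain in the digraph in array 3: its length is written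
to register 34 (0 if there is none), its first vertex to the registers 29 and 37, and its value to
register 38. -/
def findGain : HProg := seq (set 34 (.const 0)) (loop 20 0 gainSearch)

/-- The result of the search for closed walks with at most `i` arcs. -/
structure GainFound (n : ℕ) (R T : ℕ → ℕ → Prop) (i : ℕ) (s : Memory) : Prop where
  none : s.reg 34 = 0 → ∀ l ≤ i, ∀ u < n, ¬ HasGain (range n) R T l u
  le : s.reg 34 ≤ i
  some : s.reg 34 ≠ 0 → s.reg 37 < n ∧ s.reg 29 = s.reg 37 ∧
    s.reg 38 = walkValue (range n) R T (s.reg 34) (s.reg 37) (s.reg 37) ∧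
    HasGain (range n) R T (s.reg 34) (s.reg 37) ∧
    ∀ l < s.reg 34, ∀ u < n, ¬ HasGain (range n) R T l u

theorem gainSearch_spec {n i : ℕ} {s : Memory} (hn : s.reg 0 = n) (hi : i < n)
    (h20 : s.reg 20 = i) (h : GainFound n (s.rel 3) (s.rel 0) i s) :
    GainFound n (s.rel 3) (s.rel 0) (i + 1) (gainSearch.run s) := by
  rw [gainSearch, run_when]
  by_cases h0 : s.reg 34 = 0
  · rw [if_pos (by simp [h0]), run_seq, run_set, run_seq, run_seq]
    obtain ⟨s₁, hs₁⟩ : ∃ s₁, s₁ = s.setReg 36 ((HExpr.add (.reg 20) (.const 1)).eval s) := ⟨_, rfl⟩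
    rw [← hs₁]
    have h36 : s₁.reg 36 = i + 1 := by simp [hs₁, h20]
    have hn₁ : s₁.reg 0 = n := by simp [hs₁, hn]
    have hval := fun {a b : ℕ} (ha : a < n) (hb : b < n) =>
      walk_spec hn₁ (by rw [h36]; omega) ha hb
    rw [h36, hs₁, rel_setReg (by decide), rel_setReg (by decide), ← hs₁] at hval
    obtain ⟨s₂, hs₂⟩ : ∃ s₂, s₂ = walk.run s₁ := ⟨_, rfl⟩
    rw [← hs₂] at hval ⊢
    have hreg : ∀ x, x ≠ 39 → x ≠ 36 → s₂.reg x = s.reg x := fun x hx hx' => by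
      rw [hs₂, reg_walk hx, hs₁]; simp [hx']
    have h36' : s₂.reg 36 = i + 1 := by rw [hs₂, reg_walk (by decide), h36]
    have hn₂ : s₂.reg 0 = n := by rw [hreg _ (by decide) (by decide), hn]
    have hcond : ∀ u < n, (HExpr.lt (.add (.reg 36) (.const 1)) (.get₂ 4 13 13)).eval
        (s₂.setReg 13 u) ≠ 0 ↔ HasGain (range n) (s.rel 3) (s.rel 0) (i + 1) u := by
      intro u hu
      rw [HExpr.lt_ne_zero]
      simp [h36', hn₂, hval hu hu, HasGain]
    have hfind := HExpr.eval_find (show 0 ≠ 13 by decide)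
      (.lt (.add (.reg 36) (.const 1)) (.get₂ 4 13 13)) s₂
    rw [hn₂] at hfind
    rw [run_set, run_when]
    set v := (HExpr.find 13 0 (.lt (.add (.reg 36) (.const 1)) (.get₂ 4 13 13))).eval s₂ with hv
    have hc : HExpr.eval (.lt (.reg 35) (.reg 0)) (s₂.setReg 35 v) ≠ 0 ↔ v < n := by
      rw [HExpr.lt_ne_zero]; simp [hn₂]
    rcases hfind with ⟨-, h1, h2, -⟩ | ⟨h1, h2⟩
    · rw [if_pos (hc.2 h1)]
      have h3 := (hcond v h1).1 h2
      simp only [run_seq, run_set]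
      refine ⟨by simp [h36'], by simp [h36'], fun _ => ?_⟩
      simp only [Memory.setReg_reg, Memory.setReg_arr, HExpr.eval_reg,
        HExpr.eval_get₂ _ (show 35 ≠ 12 by decide), Nat.reduceEqDiff, if_true, if_false, h36', hn₂]
      exact ⟨h1, trivial, hval h1 h1, h3, fun l hl u hu => h.none h0 l (by omega) u hu⟩
    · rw [if_neg fun h => by have := hc.1 h; omega]
      refine ⟨fun _ l hl u hu => ?_, ?_, ?_⟩
      · rcases Nat.lt_or_ge i l with hl' | hl'
        · obtain rfl : l = i + 1 := by omega
          rw [← hcond u hu]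
          simpa using h1 u hu
        · exact h.none h0 l hl' u hu
      · simp [hreg, h0]
      · simp [hreg, h0]
  · rw [if_neg (by simp [h0])]
    exact ⟨fun h' => absurd h' h0, h.le.trans (Nat.le_succ i), h.some⟩

theorem arr_gainSearch {a : ℕ} (ha : a ≠ 4) (ha' : a ≠ 5) (s : Memory) :
    (gainSearch.run s).arr a = s.arr a :=
  run_arr (by simp [gainSearch, walk, stores, when, skip, fill₂, Ne.symm ha, Ne.symm ha']) s

theorem findGain_spec {n : ℕ} {s : Memory} (hn : s.reg 0 = n) :
    GainFound n (s.rel 3) (s.rel 0) n (findGain.run s) := by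
  obtain ⟨s', ⟨-, -, -, h1⟩, h2⟩ := run_loop_induction (x := 20) (b := 0) (p := gainSearch)
    (s := s.setReg 34 0) (fun i s' => s'.reg 0 = n ∧ s'.arr 3 = s.arr 3 ∧ s'.arr 0 = s.arr 0 ∧
      GainFound n (s.rel 3) (s.rel 0) i s')
    ⟨by simp [hn], rfl, rfl, by
      refine ⟨fun _ l hl u _ => ?_, by simp, by simp⟩
      obtain rfl : l = 0 := by omega
      simp [HasGain, walkValue]⟩
    (by
      rintro i hi s' ⟨g1, g2, g3, g4⟩
      have hi' : i < n := by simpa [hn] using hi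
      have e : ∀ a, s'.arr a = s.arr a → (s'.setReg 20 i).rel a = s.rel a := fun a ha => by
        rw [rel_setReg (by decide)]; unfold Memory.rel; rw [ha, g1, hn]
      refine ⟨?_, ?_, ?_, ?_⟩
      · rw [run_reg rfl]; simpa using g1
      · rw [arr_gainSearch (by decide) (by decide)]; exact g2
      · rw [arr_gainSearch (by decide) (by decide)]; exact g3
      · have := gainSearch_spec (s := s'.setReg 20 i) (n := n) (i := i) (by simpa using g1) hi'
          (by simp) (by
            rw [e 3 g2, e 0 g3]
            exact ⟨by simpa using g4.none, by simpa using g4.le, by simpa using g4.some⟩)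
        rwa [e 3 g2, e 0 g3] at this)
  have h3 : findGain.run s = s'.setReg 20 (s.reg 20) := by
    rw [findGain, run_seq, run_set]
    simpa using h2
  have hn' : (s.setReg 34 0).reg 0 = n := by simp [hn]
  rw [hn'] at h1
  rw [h3]
  exact ⟨by simpa using h1.none, by simpa using h1.le, by simpa using h1.some⟩

/-- The cell of the entry in row `x` and column `y` of a matrix. -/
def cell (x y : ℕ) : HExpr := .add (.sum 12 0 (.reg x)) (.reg y)

theorem eval_cell {x y : ℕ} (hx : x ≠ 12) (s : Memory) :
    (cell x y).eval s = s.reg x * s.reg 0 + s.reg y := by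
  simp [cell, hx, mul_comm]

/-- Reverse the arc from register `x` to register `y` of the digraph in the array `a`. -/
def reverse (a x y : ℕ) : HProg :=
  seq (store a (cell x y) (.const 0)) (store a (cell y x) (.const 1))

theorem arr_reverse {a x y n i j : ℕ} (hx : x ≠ 12) (hy : y ≠ 12) {s : Memory}
    (hn : s.reg 0 = n) (hxn : s.reg x < n) (hyn : s.reg y < n) (hj : j < n) :
    ((reverse a x y).run s).arr a (i * n + j) ≠ 0 ↔
      reverseArc (s.rel a) (s.reg x) (s.reg y) i j := by
  simp only [reverse, run_seq, run_store, eval_cell hx, eval_cell hy, Memory.setArr_reg,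
    Memory.setArr_arr, HExpr.eval_const, hn, true_and, reverseArc, Memory.rel, lex_eq_iff hj hxn,
    lex_eq_iff hj hyn]
  split_ifs with h1 h2
  · simp [h1]
  · simp only [ne_eq, not_true_eq_false, false_iff]; tauto
  · tauto

/-- Walk along the next arc of the closed walk, and reverse it in the digraph in array 6. -/
def backStep : HProg :=
  when (.lt (.reg 20) (.reg 34)) <|
    seq (set 36 (.sub (.sub (.reg 34) (.reg 20)) (.const 1))) <| seq walk <|
    seq (set 35 (.find 13 0 (.and (.get₂ 3 37 13) (.and (.get₂ 4 13 29)
      (.eq (.add (.get₂ 4 13 29) (.ite (.get₂ 0 37 13) (.const 2) (.const 0))) (.reg 38)))))) <|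
    seq (set 38 (.get₂ 4 35 29)) <| seq (reverse 6 37 35) (set 37 (.reg 35))

/-- Reverse a shortest closed walk of positive gain, if there is one. -/
def flowStep : HProg :=
  seq findGain <| when (.reg 34) <| seq (fill₂ 6 (.get₂ 3 10 11)) <|
    seq (loop 20 0 backStep) (fill₂ 3 (.get₂ 6 10 11))

open Classical in
/-- The state after `i` arcs of the closed walk. -/
structure WalkState (n m u i : ℕ) (R T : ℕ → ℕ → Prop) (s : Memory) : Prop where
  n_eq : s.reg 0 = n
  m_eq : s.reg 34 = m
  target : s.reg 29 = u
  lt : s.reg 37 < n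
  value : s.reg 38 = walkValue (range n) R T (m - min i m) (s.reg 37) u
  value_ne : s.reg 38 ≠ 0
  walk : ∃ f : ℕ → ℕ, f 0 = u ∧ f (min i m) = s.reg 37 ∧
    (∀ i' < min i m, f (i' + 1) ∈ range n ∧ R (f i') (f (i' + 1)) ∧
      walkValue (range n) R T (m - i' - 1) (f (i' + 1)) u ≠ 0 ∧
      walkValue (range n) R T (m - i' - 1) (f (i' + 1)) u +
        (if T (f i') (f (i' + 1)) then 2 else 0) = walkValue (range n) R T (m - i') (f i') u) ∧
    ∀ x < n, ∀ y < n, s.rel 6 x y ↔ reversePath R f (min i m) x y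

open Classical in
theorem backStep_spec {n m u i : ℕ} {R T : ℕ → ℕ → Prop} {s : Memory}
    (h : WalkState n m u i R T s) (h20 : s.reg 20 = i) (hm : m ≤ n) (hu : u < n)
    (hR : s.rel 3 = R) (hT : s.rel 0 = T) : WalkState n m u (i + 1) R T (backStep.run s) := by
  obtain ⟨hn, h34, h29, hcur, hval, hval0, f, hf0, hfi, hf, hrel⟩ := h
  have hc : HExpr.eval (.lt (.reg 20) (.reg 34)) s ≠ 0 ↔ i < m := by
    rw [HExpr.lt_ne_zero]; simp [h20, h34]
  rw [backStep, run_when]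
  by_cases him : i < m
  · rw [if_pos (hc.2 him), run_seq, run_set, run_seq, run_seq, run_set]
    rw [Nat.min_eq_left him.le] at hval hfi hf hrel
    obtain ⟨s₁, hs₁⟩ : ∃ s₁, s₁ = s.setReg 36 (HExpr.eval (.sub (.sub (.reg 34) (.reg 20))
      (.const 1)) s) := ⟨_, rfl⟩
    rw [← hs₁]
    have h36 : s₁.reg 36 = m - i - 1 := by simp [hs₁, h20, h34]
    have hn₁ : s₁.reg 0 = n := by simp [hs₁, hn]
    have hwalk := fun {a b : ℕ} (ha : a < n) (hb : b < n) =>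
      walk_spec hn₁ (by rw [h36]; omega) ha hb
    rw [h36, hs₁, rel_setReg (by decide), rel_setReg (by decide), ← hs₁, hR, hT] at hwalk
    obtain ⟨s₂, hs₂⟩ : ∃ s₂, s₂ = walk.run s₁ := ⟨_, rfl⟩
    rw [← hs₂] at hwalk ⊢
    have hreg : ∀ x, x ≠ 39 → x ≠ 36 → s₂.reg x = s.reg x := fun x hx hx' => by
      rw [hs₂, reg_walk hx, hs₁]; simp [hx']
    have harr : ∀ a, a ≠ 4 → a ≠ 5 → s₂.arr a = s.arr a := fun a ha ha' => by
      rw [hs₂, arr_walk ha ha', hs₁]; rfl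
    have hn₂ : s₂.reg 0 = n := by rw [hreg _ (by decide) (by decide), hn]
    have h29' : s₂.reg 29 = u := by rw [hreg _ (by decide) (by decide), h29]
    obtain ⟨c, hcd⟩ : ∃ c, c = s.reg 37 := ⟨_, rfl⟩
    rw [← hcd] at hcur hval hfi
    have h37 : s₂.reg 37 = c := by rw [hreg _ (by decide) (by decide), hcd]
    have h38 : s₂.reg 38 = walkValue (range n) R T (m - i) c u := by
      rw [hreg _ (by decide) (by decide), hval]
    obtain ⟨e, he⟩ : ∃ e, e = HExpr.and (.get₂ 3 37 13) (.and (.get₂ 4 13 29)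
      (.eq (.add (.get₂ 4 13 29) (.ite (.get₂ 0 37 13) (.const 2) (.const 0))) (.reg 38))) :=
      ⟨_, rfl⟩
    have hcond : ∀ w < n, e.eval (s₂.setReg 13 w) ≠ 0 ↔ R c w ∧
        walkValue (range n) R T (m - i - 1) w u ≠ 0 ∧ walkValue (range n) R T (m - i - 1) w u +
          (if T c w then 2 else 0) = walkValue (range n) R T (m - i) c u := by
      intro w hw
      rw [he, HExpr.and_ne_zero, HExpr.and_ne_zero, HExpr.eq_ne_zero]
      simp only [HExpr.eval_get₂ _ (show 37 ≠ 12 by decide), Memory.setReg_reg, Memory.setReg_arr,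
        HExpr.eval_get₂ _ (show 13 ≠ 12 by decide), HExpr.eval_add, HExpr.eval_ite,
        HExpr.eval_const, HExpr.eval_reg, Nat.reduceEqDiff, if_true, if_false, h29', hn₂, h37,
        h38, hwalk hw hu, harr 3 (by decide) (by decide), harr 0 (by decide) (by decide)]
      simp only [← hR, ← hT, Memory.rel, hn]
    rw [← he]
    have hfind := HExpr.eval_find (show 0 ≠ 13 by decide) e s₂
    rw [hn₂] at hfind
    set v := (HExpr.find 13 0 e).eval s₂ with hv
    obtain ⟨hv1, hv2⟩ : v < n ∧ e.eval (s₂.setReg 13 v) ≠ 0 := by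
      rcases hfind with ⟨-, h1, h2, -⟩ | ⟨h1, -⟩
      · exact ⟨h1, h2⟩
      · exfalso
        rw [hval] at hval0
        rw [show m - i = m - i - 1 + 1 by omega] at hval0 hcond
        obtain ⟨w, hw, h2⟩ := exists_walkValue_succ hval0
        have hw' := mem_range.1 hw
        exact (hcond w hw').2 ⟨h2.1, h2.2.1, h2.2.2⟩ (h1 w hw')
    obtain ⟨hv3, hv4, hv5⟩ := (hcond v hv1).1 hv2
    rw [run_seq, run_set, run_seq, run_set]
    obtain ⟨s₃, hs₃⟩ : ∃ s₃, s₃ = (s₂.setReg 35 v).setReg 38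
      ((HExpr.get₂ 4 35 29).eval (s₂.setReg 35 v)) := ⟨_, rfl⟩
    rw [← hs₃]
    have g38 : s₃.reg 38 = walkValue (range n) R T (m - i - 1) v u := by
      rw [hs₃]
      simp [h29', hn₂, hwalk hv1 hu]
    have g37 : s₃.reg 37 = c := by simp [hs₃, h37]
    have g35 : s₃.reg 35 = v := by simp [hs₃]
    have g0 : s₃.reg 0 = n := by simp [hs₃, hn₂]
    have g34 : s₃.reg 34 = m := by simp [hs₃, hreg, h34]
    have g29 : s₃.reg 29 = u := by simp [hs₃, h29']
    have g6 : s₃.rel 6 = s.rel 6 := by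
      unfold Memory.rel; rw [g0, hn, hs₃]; simp [harr]
    have hrev := fun {x y : ℕ} (hy : y < n) => arr_reverse (a := 6) (x := 37) (y := 35) (i := x)
      (by decide) (by decide) g0 (by rw [g37]; exact hcur) (by rw [g35]; exact hv1) hy
    have hrr : ∀ x, ((reverse 6 37 35).run s₃).reg x = s₃.reg x := fun x => run_reg rfl s₃
    have hmin : min (i + 1) m = i + 1 := Nat.min_eq_left him
    have hupd : ∀ j ≤ i, Function.update f (i + 1) v j = f j := fun j hj =>
      Function.update_of_ne (by omega) _ _
    have hupd' : Function.update f (i + 1) v (i + 1) = v := Function.update_self ..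
    refine ⟨by simp [hrr, g0], by simp [hrr, g34], by simp [hrr, g29], by simp [hrr, g35, hv1],
      ?_, ?_, Function.update f (i + 1) v, ?_, ?_, ?_, ?_⟩
    · simp only [Memory.setReg_reg, HExpr.eval_reg, hrr, Nat.reduceEqDiff, if_true, if_false, g38,
        g35, hmin]
      rfl
    · simp only [Memory.setReg_reg, hrr, Nat.reduceEqDiff, if_false, g38]
      exact hv4
    · rw [hupd 0 (by omega), hf0]
    · rw [hmin, hupd']
      simp [hrr, g35]
    · intro j hj
      rw [hmin] at hj
      rcases Nat.lt_succ_iff_lt_or_eq.1 hj with hj | rfl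
      · rw [hupd j hj.le, hupd (j + 1) hj]
        exact hf j hj
      · rw [hupd j le_rfl, hupd', hfi]
        exact ⟨mem_range.2 hv1, hv3, hv4, hv5⟩
    · intro x hx y hy
      rw [hmin, reversePath, hupd i le_rfl, hupd', hfi, reversePath_congr hupd, rel_setReg
        (by decide)]
      have h1 : ((reverse 6 37 35).run s₃).rel 6 x y ↔
          reverseArc (s₃.rel 6) (s₃.reg 37) (s₃.reg 35) x y := by
        rw [← hrev hy, Memory.rel, hrr, g0]
      rw [h1, g37, g35, g6]
      unfold reverseArc
      rw [hrel x hx y hy]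
  · rw [if_neg (mt hc.1 him)]
    rw [Nat.min_eq_right (by omega)] at hval hfi hf hrel
    have hmin : min (i + 1) m = m := Nat.min_eq_right (by omega)
    exact ⟨hn, h34, h29, hcur, by rw [hmin, hval], hval0, f, hf0, by rw [hmin, hfi],
      by rw [hmin]; exact hf, by rw [hmin]; exact hrel⟩

open Classical in
theorem WalkState.setReg {n m u i v : ℕ} {R T : ℕ → ℕ → Prop} {s : Memory}
    (h : WalkState n m u i R T s) : WalkState n m u i R T (s.setReg 20 v) := by
  obtain ⟨h1, h2, h3, h4, h5, h6, h7⟩ := h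
  refine ⟨by simpa using h1, by simpa using h2, by simpa using h3, by simpa using h4,
    by simpa using h5, by simpa using h6, ?_⟩
  rw [rel_setReg (by decide)]
  simpa using h7

theorem arr_backStep {a : ℕ} (h4 : a ≠ 4) (h5 : a ≠ 5) (h6 : a ≠ 6) (s : Memory) :
    (backStep.run s).arr a = s.arr a :=
  run_arr (by simp [backStep, walk, stores, when, skip, fill₂, reverse, Ne.symm h4, Ne.symm h5,
    Ne.symm h6]) s

theorem flowStep_spec {n : ℕ} {L : Finset ℕ} {s : Memory} (hn : s.reg 0 = n) (hL : L ⊆ range n)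
    (hT : IsTournamentOn L (s.rel 0)) (h : IsReorientation L (s.rel 0) (s.rel 3))
    (hR : ∀ x ∈ range n, ∀ y ∈ range n, s.rel 3 x y → x ∈ L ∧ y ∈ L) :
    ((∀ l ≤ n, ∀ u < n, ¬ HasGain (range n) (s.rel 3) (s.rel 0) l u) ∧
        (flowStep.run s).arr 3 = s.arr 3) ∨
      (∃ l ≤ n, ∃ u < n, HasGain (range n) (s.rel 3) (s.rel 0) l u) ∧
        IsReorientation L (s.rel 0) ((flowStep.run s).rel 3) ∧
        numCommon L (s.rel 0) ((flowStep.run s).rel 3) < numCommon L (s.rel 0) (s.rel 3) ∧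
        ∀ x ∈ range n, ∀ y ∈ range n, (flowStep.run s).rel 3 x y → x ∈ L ∧ y ∈ L := by
  have hg := findGain_spec hn
  rw [flowStep, run_seq, run_when]
  obtain ⟨s₁, hs₁⟩ : ∃ s₁, s₁ = findGain.run s := ⟨_, rfl⟩
  rw [← hs₁] at hg ⊢
  have hn₁ : s₁.reg 0 = n := by rw [hs₁, run_reg rfl, hn]
  have ha : ∀ a, a ≠ 4 → a ≠ 5 → s₁.arr a = s.arr a := fun a h4 h5 => by
    rw [hs₁]
    exact run_arr (by simp [findGain, gainSearch, walk, stores, when, skip, fill₂, Ne.symm h4,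
      Ne.symm h5]) s
  have h3 : s₁.rel 3 = s.rel 3 := by unfold Memory.rel; rw [hn₁, hn, ha 3 (by decide) (by decide)]
  have h0 : s₁.rel 0 = s.rel 0 := by unfold Memory.rel; rw [hn₁, hn, ha 0 (by decide) (by decide)]
  rw [HExpr.eval_reg]
  by_cases hm : s₁.reg 34 = 0
  · rw [if_neg (not_not.2 hm)]
    exact .inl ⟨hg.none hm, ha 3 (by decide) (by decide)⟩
  · rw [if_pos hm, run_seq, run_seq]
    right
    obtain ⟨hu, h29, h38, hgain, hmin⟩ := hg.some hm
    have hmn := hg.le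
    obtain ⟨m, hmd⟩ : ∃ m, m = s₁.reg 34 := ⟨_, rfl⟩
    obtain ⟨u, hud⟩ : ∃ u, u = s₁.reg 37 := ⟨_, rfl⟩
    rw [← hmd] at hm hmn
    rw [← hmd, ← hud] at h38 hgain
    rw [← hmd] at hmin
    rw [← hud] at hu h29
    have e1 : HExpr.reads 6 (.get₂ 3 10 11) = false := rfl
    have e2 : HExpr.reads 3 (.get₂ 6 10 11) = false := rfl
    obtain ⟨s₂, hs₂⟩ : ∃ s₂, s₂ = (fill₂ 6 (.get₂ 3 10 11)).run s₁ := ⟨_, rfl⟩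
    rw [← hs₂]
    have hr₂ : ∀ x, s₂.reg x = s₁.reg x := fun x => by rw [hs₂, reg_fill₂ e1]
    have ha₂ : ∀ a, a ≠ 6 → s₂.arr a = s₁.arr a := fun a ha => by
      rw [hs₂, arr_fill₂_of_ne ha e1]
    have h3₂ : s₂.rel 3 = s.rel 3 := by
      rw [← h3]; unfold Memory.rel; rw [hr₂, ha₂ 3 (by decide)]
    have h0₂ : s₂.rel 0 = s.rel 0 := by
      rw [← h0]; unfold Memory.rel; rw [hr₂, ha₂ 0 (by decide)]
    have hn₂ : s₂.reg 0 = n := by rw [hr₂, hn₁]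
    obtain ⟨s₃, ⟨hW, -, -⟩, hs₃⟩ := run_loop_induction (x := 20) (b := 0) (p := backStep) (s := s₂)
      (fun i s' => WalkState n m u i (s.rel 3) (s.rel 0) s' ∧ s'.rel 3 = s.rel 3 ∧
        s'.rel 0 = s.rel 0)
      ⟨⟨hn₂, by rw [hr₂, hmd], by rw [hr₂, h29], by rw [hr₂, ← hud]; exact hu, by
        rw [hr₂, hr₂, ← hud, h38, Nat.zero_min, Nat.sub_zero], by
        rw [hr₂, h38]
        unfold HasGain at hgain
        omega, fun _ => u, rfl, by rw [hr₂, hud], fun i' hi' => by omega, fun x hx y hy => by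
        rw [Nat.zero_min, reversePath, Memory.rel, hn₂, hs₂, arr_fill₂ e1 hn₁ hx hy]
        simp [hn₁, Memory.rel, hn, ha]⟩, h3₂, h0₂⟩
      (by
        rintro i hi s' ⟨g1, g2, g3⟩
        have e3 : (s'.setReg 20 i).rel 3 = s.rel 3 := by rw [rel_setReg (by decide), g2]
        have e0 : (s'.setReg 20 i).rel 0 = s.rel 0 := by rw [rel_setReg (by decide), g3]
        have er : (backStep.run (s'.setReg 20 i)).reg 0 = (s'.setReg 20 i).reg 0 := run_reg rfl _
        refine ⟨backStep_spec g1.setReg (by simp) hmn hu e3 e0, ?_, ?_⟩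
        · rw [← e3]; unfold Memory.rel
          rw [er, arr_backStep (by decide) (by decide) (by decide)]
        · rw [← e0]; unfold Memory.rel
          rw [er, arr_backStep (by decide) (by decide) (by decide)])
    rw [hn₂] at hW
    obtain ⟨hn₃, -, -, -, -, -, f, hf0, -, hf, hrel⟩ := hW
    rw [Nat.min_eq_right hmn] at hf hrel
    rw [hs₃]
    have hfin : ∀ x ∈ range n, ∀ y ∈ range n,
        ((fill₂ 3 (.get₂ 6 10 11)).run (s₃.setReg 20 (s₂.reg 20))).rel 3 x y ↔
          reversePath (s.rel 3) f m x y := by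
      intro x hx y hy
      rw [mem_range] at hx hy
      have hn₄ : (s₃.setReg 20 (s₂.reg 20)).reg 0 = n := by simpa using hn₃
      rw [← hrel x hx y hy, Memory.rel, reg_fill₂ e2, hn₄, arr_fill₂ e2 hn₄ hx hy]
      simp [hn₃, Memory.rel]
    subst hf0
    obtain ⟨k1, k2, k3⟩ := h.reversePath_of_hasGain hT hR hf hgain (mem_range.2 hu)
      fun l hl u hu => hmin l hl u (mem_range.1 hu)
    refine ⟨⟨m, hmn, _, hu, hgain⟩, k1.congr fun x hx y hy => (hfin x (hL hx) y (hL hy)).symm, ?_,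
      fun x hx y hy hxy => k3 x hx y hy ((hfin x hx y hy).1 hxy)⟩
    rwa [numCommon_congr fun x hx y hy => hfin x (hL hx) y (hL hy)]

/-- Minimize the number of arcs that the digraphs in the arrays 3 and 0 have in common, by
reversals of closed walks in the former. Each reversal decreases this number, which is at most
`n * n`, so `n * n` rounds suffice. -/
def flow : HProg := loop 21 0 (loop 22 0 flowStep)

theorem arr_flow {a : ℕ} (h3 : a ≠ 3) (h4 : a ≠ 4) (h5 : a ≠ 5) (h6 : a ≠ 6) (s : Memory) :
    (flow.run s).arr a = s.arr a :=
  run_arr (by simp [flow, flowStep, findGain, gainSearch, backStep, walk, stores, when, skip,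
    fill₂, reverse, Ne.symm h3, Ne.symm h4, Ne.symm h5, Ne.symm h6]) s

theorem flow_spec {n : ℕ} {L : Finset ℕ} {s : Memory} (hn : s.reg 0 = n) (hL : L ⊆ range n)
    (hT : IsTournamentOn L (s.rel 0)) (h : IsReorientation L (s.rel 0) (s.rel 3))
    (hR : ∀ x ∈ range n, ∀ y ∈ range n, s.rel 3 x y → x ∈ L ∧ y ∈ L) :
    IsBalanceCost L (s.rel 0) (numCommon L (s.rel 0) ((flow.run s).rel 3)) ∧
      ∀ x ∈ range n, ∀ y ∈ range n, (flow.run s).rel 3 x y → x ∈ L ∧ y ∈ L := by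
  obtain ⟨T, hTd⟩ : ∃ T, T = s.rel 0 := ⟨_, rfl⟩
  rw [← hTd] at hT h ⊢
  -- after `i` steps either the optimum has been reached, or there were `i` improvements
  obtain ⟨I, hI⟩ : ∃ I : ℕ → Memory → Prop, ∀ i s', I i s' ↔ s'.reg 0 = n ∧ s'.rel 0 = T ∧
      IsReorientation L T (s'.rel 3) ∧
      (∀ x ∈ range n, ∀ y ∈ range n, s'.rel 3 x y → x ∈ L ∧ y ∈ L) ∧
      ((∀ l ≤ n, ∀ u < n, ¬ HasGain (range n) (s'.rel 3) T l u) ∨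
        numCommon L T (s'.rel 3) + i ≤ n * n) := ⟨_, fun _ _ => Iff.rfl⟩
  have hset : ∀ i s' x v, x ≠ 0 → I i s' → I i (s'.setReg x v) := by
    intro i s' x v hx h
    rw [hI] at h ⊢
    rw [rel_setReg hx, rel_setReg hx, Memory.setReg_reg, if_neg (Ne.symm hx)]
    exact h
  have hstep : ∀ i s', I i s' → I (i + 1) (flowStep.run s') := by
    intro i s' hs'
    rw [hI] at hs' ⊢
    obtain ⟨g1, g2, g3, g4, g5⟩ := hs'
    have g1' : (flowStep.run s').reg 0 = n := by rw [run_reg rfl, g1]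
    have g2' : (flowStep.run s').rel 0 = T := by
      unfold Memory.rel at g2 ⊢
      rw [g1', run_arr rfl, ← g1, g2]
    refine ⟨g1', g2', ?_⟩
    rcases flowStep_spec g1 hL (g2 ▸ hT) (g2 ▸ g3) g4 with ⟨h1, h2⟩ | ⟨⟨l, hl, u, hu, h0⟩, h1, h2, h3⟩
    · have h3 : (flowStep.run s').rel 3 = s'.rel 3 := by
        unfold Memory.rel; rw [g1', g1, h2]
      rw [g2] at h1
      rw [h3]
      exact ⟨g3, g4, .inl h1⟩
    · rw [g2] at h0 h1 h2
      refine ⟨h1, h3, ?_⟩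
      rcases g5 with g5 | g5
      · exact absurd h0 (g5 l hl u hu)
      · exact .inr (by omega)
  have h0 : I 0 s := by
    rw [hI]
    refine ⟨hn, hTd.symm, h, hR, .inr ?_⟩
    rw [add_zero]
    exact numCommon_le.trans (Nat.mul_le_mul (by simpa using card_le_card hL)
      (by simpa using card_le_card hL))
  have hinner : ∀ i s', I i s' → I (i + n) ((loop 22 0 flowStep).run s') := by
    intro i s' hs'
    have hn' : s'.reg 0 = n := ((hI i s').1 hs').1
    obtain ⟨s₁, h1, h2⟩ := run_loop_induction (x := 22) (b := 0) (p := flowStep) (s := s')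
      (fun j s' => I (i + j) s') hs' fun j _ s' hs' => hstep _ _ (hset _ _ _ _ (by decide) hs')
    rw [h2]
    rw [hn'] at h1
    exact hset _ _ _ _ (by decide) h1
  obtain ⟨s₁, h1, h2⟩ := run_loop_induction (x := 21) (b := 0) (p := loop 22 0 flowStep) (s := s)
    (fun j s' => I (j * n) s') (by rw [zero_mul]; exact h0) fun j _ s' hs' => by
      rw [Nat.succ_mul]
      exact hinner _ _ (hset _ _ _ _ (by decide) hs')
  rw [hn] at h1
  have h3 : I (n * n) (flow.run s) := by
    rw [flow, h2]
    exact hset _ _ _ _ (by decide) h1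
  obtain ⟨-, g2, g3, g4, g5⟩ := (hI _ _).1 h3
  refine ⟨g3.isBalanceCost_of_no_gain hT hL ?_, g4⟩
  rw [card_range]
  intro l hl u hu hg
  rcases g5 with g5 | g5
  · exact g5 l hl u (mem_range.1 hu) hg
  · obtain ⟨R', h4⟩ := g3.exists_improvement hT g4 hu hg
    omega

end HProg

/-! ### The reduction rules as programs -/

section Congruence

open Classical Finset

variable {α : Type*} {S : Finset α} {T T' : α → α → Prop}

theorem IsTournamentOn.congr (h : IsTournamentOn S T) (hT : ∀ x ∈ S, ∀ y ∈ S, T x y ↔ T' x y) :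
    IsTournamentOn S T' := by
  refine ⟨fun x hx => ?_, fun x hx y hy hxy => ?_⟩
  · rw [← hT x hx x hx]; exact h.1 x hx
  · rw [← hT x hx y hy, ← hT y hy x hx]; exact h.2 x hx y hy hxy

theorem solvable_congr {k : ℕ} (hT : ∀ x ∈ S, ∀ y ∈ S, T x y ↔ T' x y) :
    Solvable S T k ↔ Solvable S T' k := by
  have h1 : ∀ D, numDeleted S T D = numDeleted S T' D := fun D =>
    card_filter_congr fun p hp => by rw [hT p.1 (mem_product.1 hp).1 p.2 (mem_product.1 hp).2]
  constructor <;> rintro ⟨D, c, h2, h3, h4⟩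
  · exact ⟨D, c, fun x hx y hy hxy => (hT x hx y hy).1 (h2 x hx y hy hxy), h1 D ▸ h3, h4⟩
  · exact ⟨D, c, fun x hx y hy hxy => (hT x hx y hy).2 (h2 x hx y hy hxy), (h1 D).symm ▸ h3, h4⟩

theorem onTriangle_congr (hT : ∀ x ∈ S, ∀ y ∈ S, T x y ↔ T' x y) :
    onTriangle S T = onTriangle S T' := by
  refine filter_congr fun v hv => ?_
  refine exists_congr fun u => and_congr_right fun hu => exists_congr fun w =>
    and_congr_right fun hw => ?_
  rw [hT v hv u hu, hT u hu w hw, hT w hw v hv]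

theorem card_filter_degClass (d : ℕ) (p : α → Prop) :
    #{x ∈ degClass S T d | p x} = #{x ∈ S | inDeg S T x = d ∧ p x} := by
  rw [degClass, filter_filter]

theorem IsTournamentOn.inDeg_lt (hT : IsTournamentOn S T) {v : α} (hv : v ∈ S) :
    inDeg S T v < #S := by
  have := hT.outDeg_add_inDeg hv
  unfold inDeg
  omega

end Congruence

namespace HExpr

open RAM Finset

/-- The `k`-fold of an expression. -/
def times : ℕ → HExpr → HExpr
  | 0, _ => const 0
  | k + 1, e => add (times k e) e

@[simp] theorem eval_times (k : ℕ) (e : HExpr) (s : Memory) :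
    (times k e).eval s = k * e.eval s := by
  induction k with
  | zero => simp [times]
  | succ k ih => simp [times, ih, Nat.succ_mul]

open Classical in
theorem eval_sum_count {n : ℕ} {e : HExpr} {s : Memory} {P : ℕ → ℕ → Prop} (hn : s.reg 0 = n)
    (h : ∀ i < n, ∀ j < n, e.eval ((s.setReg 13 i).setReg 14 j) ≠ 0 ↔ P i j) :
    (sum 13 0 (count 14 0 e)).eval s = #{p ∈ range n ×ˢ range n | P p.1 p.2} := by
  rw [card_filter_product (range n) P, eval_sum, hn]
  refine sum_congr rfl fun i hi => ?_
  have hn' : (s.setReg 13 i).reg 0 = n := by simpa using hn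
  rw [eval_count_eq (P := P i) fun j hj => h i (mem_range.1 hi) j (hn' ▸ hj), hn']

end HExpr

namespace HProg

open Classical RAM Finset

/-- There is no large class of vertices of the same in-degree. -/
def NoLargeClass (n κ : ℕ) (T : ℕ → ℕ → Prop) : Prop :=
  ∀ d, #(degClass (range n) T d) < 4 * κ + 2

/-- No arc lies in many triangles. -/
def NoHeavyArc (n κ : ℕ) (T : ℕ → ℕ → Prop) : Prop :=
  ∀ q < n, ∀ p < n, T q p → #(triangleVertices (range n) T q p) < 6 * κ + 2

/-- The memory holds an instance that is equivalent to the proposition `P`: a tournament with `n`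
vertices in array 0, the original parameter `κ` in register 1, and the current parameter in
register 40. If register 41 is not zero, then it has been found out that `P` is false. -/
structure IsReduced (n κ : ℕ) (P : Prop) (s : Memory) : Prop where
  n_eq : s.reg 0 = n
  κ_eq : s.reg 1 = κ
  isTournamentOn : IsTournamentOn (range n) (s.rel 0)
  le : s.reg 40 ≤ κ
  iff : P ↔ s.reg 41 = 0 ∧ Solvable (range n) (s.rel 0) (s.reg 40)

/-- The vertex in register 13 has the in-degree that is in register `r`. -/
def inClass (r : ℕ) : HExpr := .eq (.get 1 (.reg 13)) (.reg r)

/-- Write all in-degrees to array 1, and the in-degree of a large class to register 30. -/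
def findClass : HProg :=
  seq (fill 1 (.count 13 0 (.get₂ 0 13 10))) <|
  set 30 (.find 14 0 (.le (.add (.times 4 (.reg 1)) (.const 2)) (.count 13 0 (inClass 14))))

theorem findClass_spec {n κ : ℕ} {s : Memory} (hn : s.reg 0 = n) (hκ : s.reg 1 = κ)
    (hT : IsTournamentOn (range n) (s.rel 0)) :
    (∀ v < n, (findClass.run s).arr 1 v = inDeg (range n) (s.rel 0) v) ∧
      ((findClass.run s).reg 30 < n ∧
          4 * κ + 2 ≤ #(degClass (range n) (s.rel 0) ((findClass.run s).reg 30)) ∨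
        (findClass.run s).reg 30 = n ∧ NoLargeClass n κ (s.rel 0)) := by
  have e : HExpr.reads 1 (.count 13 0 (.get₂ 0 13 10)) = false := rfl
  rw [findClass, run_seq, run_set]
  obtain ⟨s₁, hs₁⟩ : ∃ s₁, s₁ = (fill 1 (.count 13 0 (.get₂ 0 13 10))).run s := ⟨_, rfl⟩
  rw [← hs₁]
  have hr : ∀ x, s₁.reg x = s.reg x := fun x => by rw [hs₁, reg_fill e]
  have h1 : ∀ v < n, s₁.arr 1 v = inDeg (range n) (s.rel 0) v := by
    intro v hv
    rw [hs₁, arr_fill e (hn ▸ hv), HExpr.eval_count_eq (P := fun u => s.rel 0 u v)]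
    · rw [inDeg]; simp [hn]
    · intro u _
      simp [Memory.rel]
  refine ⟨fun v hv => h1 v hv, ?_⟩
  have hcond : ∀ d < n, (HExpr.le (.add (.times 4 (.reg 1)) (.const 2))
      (.count 13 0 (inClass 14))).eval (s₁.setReg 14 d) ≠ 0 ↔
        4 * κ + 2 ≤ #(degClass (range n) (s.rel 0) d) := by
    intro d _
    have hn' : (s₁.setReg 14 d).reg 0 = n := by simp [hr, hn]
    rw [HExpr.le_ne_zero, HExpr.eval_count_eq (P := fun v => inDeg (range n) (s.rel 0) v = d), hn']
    · simp [hr, hκ, degClass]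
    · intro v hv
      rw [hn'] at hv
      rw [inClass, HExpr.eq_ne_zero]
      simp [h1 v hv]
  have hfind := HExpr.eval_find (show 0 ≠ 14 by decide)
    (.le (.add (.times 4 (.reg 1)) (.const 2)) (.count 13 0 (inClass 14))) s₁
  rw [hr, hn] at hfind
  set v := (HExpr.find 14 0 (.le (.add (.times 4 (.reg 1)) (.const 2))
    (.count 13 0 (inClass 14)))).eval s₁ with hv
  have hv' : (s₁.setReg 30 v).reg 30 = v := by simp
  rw [hv']
  rcases hfind with ⟨-, h2, h3, -⟩ | ⟨h2, h3⟩
  · exact .inl ⟨h2, (hcond v h2).1 h3⟩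
  · refine .inr ⟨h3, fun d => ?_⟩
    by_contra hd
    rw [not_lt] at hd
    obtain ⟨x, hx⟩ : (degClass (range n) (s.rel 0) d).Nonempty := card_pos.1 (by omega)
    obtain ⟨hx1, hx2⟩ := mem_filter.1 hx
    have h4 := hT.inDeg_lt hx1
    rw [hx2, card_range] at h4
    exact (hcond d h4).2 hd (h2 d h4)

/-- Write to array 2 the positions of all vertices relative to the class whose in-degree is in
register 30. -/
def positions : HProg :=
  fill 2 (.ite (.le (.count 13 0 (.and (inClass 30) (.get₂ 0 13 10))) (.reg 1)) (.const 0)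
    (.ite (.le (.count 13 0 (.and (inClass 30) (.get₂ 0 10 13))) (.reg 1)) (.const 2) (.const 1)))

theorem positions_spec {n κ d : ℕ} {s : Memory} (hn : s.reg 0 = n) (hκ : s.reg 1 = κ)
    (hd : s.reg 30 = d) (hdeg : ∀ v < n, s.arr 1 v = inDeg (range n) (s.rel 0) v) {v : ℕ}
    (hv : v < n) : (positions.run s).arr 2 v =
      position (s.rel 0) κ (degClass (range n) (s.rel 0) d) v := by
  have h1 : (HExpr.count 13 0 (.and (inClass 30) (.get₂ 0 13 10))).eval (s.setReg 10 v) =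
      #{x ∈ degClass (range n) (s.rel 0) d | s.rel 0 x v} := by
    have hn' : (s.setReg 10 v).reg 0 = n := by simpa using hn
    rw [HExpr.eval_count_eq (P := fun x => inDeg (range n) (s.rel 0) x = d ∧ s.rel 0 x v), hn',
      card_filter_degClass]
    intro x hx
    rw [hn'] at hx
    rw [HExpr.and_ne_zero, inClass, HExpr.eq_ne_zero]
    simp [hdeg x hx, hd, Memory.rel]
  have h2 : (HExpr.count 13 0 (.and (inClass 30) (.get₂ 0 10 13))).eval (s.setReg 10 v) =
      #{x ∈ degClass (range n) (s.rel 0) d | s.rel 0 v x} := by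
    have hn' : (s.setReg 10 v).reg 0 = n := by simpa using hn
    rw [HExpr.eval_count_eq (P := fun x => inDeg (range n) (s.rel 0) x = d ∧ s.rel 0 v x), hn',
      card_filter_degClass]
    intro x hx
    rw [hn'] at hx
    rw [HExpr.and_ne_zero, inClass, HExpr.eq_ne_zero]
    simp [hdeg x hx, hd, Memory.rel]
  rw [positions, arr_fill rfl (hn ▸ hv), HExpr.eval_ite, HExpr.eval_ite, HExpr.eval_const,
    HExpr.eval_const, HExpr.eval_const, position]
  congr 1
  · rw [HExpr.le_ne_zero, h1]; simp [hκ]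
  · congr 1
    rw [HExpr.le_ne_zero, h2]; simp [hκ]

/-- The tournament that arises by splitting at the level with position 1. -/
def splitExpr : HExpr :=
  .ite (.eq (.get 2 (.reg 10)) (.get 2 (.reg 11)))
    (.ite (.eq (.get 2 (.reg 10)) (.const 1)) (.lt (.reg 10) (.reg 11)) (.get₂ 0 10 11))
    (.lt (.get 2 (.reg 10)) (.get 2 (.reg 11)))

theorem splitExpr_spec {n : ℕ} {g : ℕ → ℕ} {s : Memory} (hg : ∀ v < n, s.arr 2 v = g v) {x y : ℕ}
    (hx : x < n) (hy : y < n) : splitExpr.eval ((s.setReg 10 x).setReg 11 y) ≠ 0 ↔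
      splitAt (s.rel 0) g (fun v => v) x y := by
  rw [splitExpr, splitAt, HExpr.eval_ite, HExpr.eval_ite]
  simp only [HExpr.eq_ne_zero, HExpr.eval_get, HExpr.eval_reg, HExpr.eval_const,
    Memory.setReg_reg, Memory.setReg_arr, Nat.reduceEqDiff, if_true, if_false, hg x hx, hg y hy]
  by_cases h1 : g x = g y
  · rw [if_pos h1, if_pos h1]
    by_cases h2 : g x = 1
    · rw [if_pos h2, if_pos h2, HExpr.lt_ne_zero]; simp
    · rw [if_neg h2, if_neg h2]; simp [Memory.rel]
  · rw [if_neg h1, if_neg h1, HExpr.lt_ne_zero]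
    simp [hg x hx, hg y hy]

/-- Count in register 31 the vertices of the class that have the wrong position, and in register 32
the arcs that have to be deleted to split the tournament: the arcs that go down, and those that
have to be deleted to make the middle level balanced. -/
def splitCost : HProg :=
  seq (set 31 (.count 13 0 (.and (inClass 30) (.not (.eq (.get 2 (.reg 13)) (.const 1)))))) <|
  seq (fill₂ 3 (.and (.and (.eq (.get 2 (.reg 10)) (.const 1)) (.eq (.get 2 (.reg 11)) (.const 1)))
    (.get₂ 0 10 11))) <|
  seq flow <|
  set 32 (.add (.sum 13 0 (.count 14 0 (.and (.get₂ 3 13 14) (.get₂ 0 13 14))))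
    (.sum 13 0 (.count 14 0 (.and (.get₂ 0 13 14) (.lt (.get 2 (.reg 14)) (.get 2 (.reg 13)))))))

theorem splitCost_spec {n d : ℕ} {g : ℕ → ℕ} {s : Memory} (hn : s.reg 0 = n)
    (hT : IsTournamentOn (range n) (s.rel 0)) (hd : s.reg 30 = d)
    (hdeg : ∀ v < n, s.arr 1 v = inDeg (range n) (s.rel 0) v) (hg : ∀ v < n, s.arr 2 v = g v) :
    ((splitCost.run s).reg 31 = 0 ↔ ∀ x ∈ degClass (range n) (s.rel 0) d, g x = 1) ∧
      ∃ m, IsBalanceCost (middle (range n) g) (s.rel 0) m ∧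
        (splitCost.run s).reg 32 = m + numDown (range n) (s.rel 0) g := by
  rw [splitCost, run_seq, run_seq, run_seq, run_set, run_set]
  obtain ⟨T, hTd⟩ : ∃ T, T = s.rel 0 := ⟨_, rfl⟩
  rw [← hTd] at hT hdeg ⊢
  set e : HExpr := .and (.and (.eq (.get 2 (.reg 10)) (.const 1)) (.eq (.get 2 (.reg 11))
    (.const 1))) (.get₂ 0 10 11) with he
  have he' : HExpr.reads 3 e = false := rfl
  obtain ⟨w, hw⟩ : ∃ w, w = (HExpr.count 13 0 (.and (inClass 30)
    (.not (.eq (.get 2 (.reg 13)) (.const 1))))).eval s := ⟨_, rfl⟩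
  rw [← hw]
  obtain ⟨s₁, hs₁⟩ : ∃ s₁, s₁ = (fill₂ 3 e).run (s.setReg 31 w) := ⟨_, rfl⟩
  rw [← hs₁]
  have hr₁ : ∀ x, s₁.reg x = if x = 31 then w else s.reg x := fun x => by
    rw [hs₁, reg_fill₂ he', Memory.setReg_reg]
  have ha₁ : ∀ a, a ≠ 3 → s₁.arr a = s.arr a := fun a ha => by
    rw [hs₁, arr_fill₂_of_ne ha he', Memory.setReg_arr]
  have hn₁ : s₁.reg 0 = n := by rw [hr₁]; exact hn
  have h0₁ : s₁.rel 0 = T := by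
    rw [hTd]; unfold Memory.rel; rw [hn₁, hn, ha₁ 0 (by decide)]
  have hmem : ∀ v, v ∈ middle (range n) g ↔ v < n ∧ g v = 1 := fun v => by
    rw [middle, mem_filter, mem_range]
  have h3₁ : ∀ x < n, ∀ y < n, s₁.rel 3 x y ↔ (g x = 1 ∧ g y = 1) ∧ T x y := by
    intro x hx y hy
    rw [Memory.rel, hn₁, hs₁, arr_fill₂ he' (by simpa using hn) hx hy, he]
    rw [HExpr.and_ne_zero, HExpr.and_ne_zero, HExpr.eq_ne_zero, HExpr.eq_ne_zero]
    simp [hg x hx, hg y hy, hTd, Memory.rel, hn]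
  have hsub : middle (range n) g ⊆ range n := filter_subset _ _
  have hTm : IsTournamentOn (middle (range n) g) T :=
    ⟨fun x hx => hT.1 x (hsub hx), fun x hx y hy => hT.2 x (hsub hx) y (hsub hy)⟩
  have hR₁ : ∀ x ∈ middle (range n) g, ∀ y ∈ middle (range n) g, T x y ↔ s₁.rel 3 x y := by
    intro x hx y hy
    rw [hmem] at hx hy
    rw [h3₁ x hx.1 y hy.1]
    exact ⟨fun h => ⟨⟨hx.2, hy.2⟩, h⟩, fun h => h.2⟩
  obtain ⟨hc, hsupp⟩ := flow_spec (s := s₁) hn₁ hsub (h0₁ ▸ hTm)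
    (h0₁ ▸ (IsReorientation.congr ⟨hTm, fun _ _ => rfl⟩ hR₁)) (by
      intro x hx y hy hxy
      rw [mem_range] at hx hy
      have := (h3₁ x hx y hy).1 hxy
      exact ⟨(hmem x).2 ⟨hx, this.1.1⟩, (hmem y).2 ⟨hy, this.1.2⟩⟩)
  obtain ⟨s₂, hs₂⟩ : ∃ s₂, s₂ = flow.run s₁ := ⟨_, rfl⟩
  rw [← hs₂] at hc hsupp ⊢
  have hn₂ : s₂.reg 0 = n := by rw [hs₂, run_reg rfl, hn₁]
  have ha₂ : ∀ a, a ≠ 3 → a ≠ 4 → a ≠ 5 → a ≠ 6 → s₂.arr a = s.arr a := fun a h3 h4 h5 h6 => by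
    rw [hs₂, arr_flow h3 h4 h5 h6, ha₁ a h3]
  have h0₂ : s₂.rel 0 = T := by
    rw [hTd]; unfold Memory.rel
    rw [hn₂, hn, ha₂ 0 (by decide) (by decide) (by decide) (by decide)]
  rw [h0₁] at hc
  constructor
  · have h31 : s₂.reg 31 = w := by rw [hs₂, run_reg rfl, hr₁, if_pos rfl]
    rw [Memory.setReg_reg, if_neg (by decide), h31, hw, ← not_iff_not]
    rw [← ne_eq, HExpr.eval_count_ne_zero]
    simp only [not_forall, exists_prop, degClass, mem_filter, mem_range, hn]
    refine exists_congr fun x => ?_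
    rw [HExpr.and_ne_zero, HExpr.not_ne_zero, HExpr.eq_ne_zero, inClass, HExpr.eq_ne_zero]
    simp only [HExpr.eval_get, HExpr.eval_reg, HExpr.eval_const, Memory.setReg_reg,
      Memory.setReg_arr, if_true, Nat.reduceEqDiff, if_false]
    rw [and_assoc]
    refine and_congr_right fun hx => ?_
    rw [hdeg x hx, hg x hx, hd]
  · refine ⟨_, hc, ?_⟩
    rw [Memory.setReg_reg, if_pos rfl, HExpr.eval_add]
    congr 1
    · rw [HExpr.eval_sum_count hn₂ (P := fun x y => s₂.rel 3 x y ∧ T x y)]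
      · unfold numCommon
        congr 1
        ext p
        simp only [mem_filter, mem_product]
        exact ⟨fun h => ⟨hsupp _ h.1.1 _ h.1.2 h.2.1, h.2⟩,
          fun h => ⟨⟨hsub h.1.1, hsub h.1.2⟩, h.2⟩⟩
      · intro x _ y _
        rw [← h0₂, HExpr.and_ne_zero]
        simp [Memory.rel]
    · rw [HExpr.eval_sum_count hn₂ (P := fun x y => T x y ∧ g y < g x)]
      · unfold numDown
        congr
      · intro x hx y hy
        rw [← h0₂, HExpr.and_ne_zero, HExpr.lt_ne_zero]
        simp [Memory.rel, ha₂, hg x hx, hg y hy]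

/-- Split the tournament at the level of a large class, if there is one. The instance has no
solution if a vertex of the class has the wrong position or if the split costs more than the
parameter. -/
def splitStep : HProg :=
  seq findClass <| when (.lt (.reg 30) (.reg 0)) <| seq positions <| seq splitCost <|
  ite (.or (.reg 31) (.lt (.reg 40) (.reg 32))) (set 41 (.const 1)) <|
  seq (set 40 (.sub (.reg 40) (.reg 32))) <| seq (fill₂ 7 splitExpr) (fill₂ 0 (.get₂ 7 10 11))

set_option maxHeartbeats 400000 in
theorem splitStep_spec {n κ : ℕ} {P : Prop} {s : Memory} (h : IsReduced n κ P s) :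
    IsReduced n κ P (splitStep.run s) ∧ (splitStep.run s).reg 40 ≤ s.reg 40 ∧
      (NoLargeClass n κ (s.rel 0) ∧ (splitStep.run s).arr 0 = s.arr 0 ∨
        (splitStep.run s).reg 41 ≠ 0 ∨
        ¬ NoLargeClass n κ (s.rel 0) ∧
          #(onTriangle (range n) ((splitStep.run s).rel 0)) <
            #(onTriangle (range n) (s.rel 0))) := by
  obtain ⟨hn, hκ, hT, hle, hP⟩ := h
  obtain ⟨hdeg, hd⟩ := findClass_spec hn hκ hT
  rw [splitStep, run_seq, run_when]
  obtain ⟨T, hTd⟩ : ∃ T, T = s.rel 0 := ⟨_, rfl⟩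
  obtain ⟨k, hkd⟩ : ∃ k, k = s.reg 40 := ⟨_, rfl⟩
  obtain ⟨b, hbd⟩ : ∃ b, b = s.reg 41 := ⟨_, rfl⟩
  obtain ⟨A, hA⟩ : ∃ A, A = s.arr 0 := ⟨_, rfl⟩
  rw [← hTd] at hT hP hdeg hd ⊢
  rw [← hkd] at hle hP ⊢
  rw [← hbd] at hP
  rw [← hA]
  obtain ⟨s₁, hs₁⟩ : ∃ s₁, s₁ = findClass.run s := ⟨_, rfl⟩
  rw [← hs₁] at hdeg hd ⊢
  have n₁ : s₁.reg 0 = n := by rw [hs₁, run_reg rfl, hn]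
  have κ₁ : s₁.reg 1 = κ := by rw [hs₁, run_reg rfl, hκ]
  have k₁ : s₁.reg 40 = k := by rw [hs₁, run_reg rfl, hkd]
  have b₁ : s₁.reg 41 = b := by rw [hs₁, run_reg rfl, hbd]
  have A₁ : s₁.arr 0 = A := by rw [hs₁, run_arr rfl, hA]
  have T₁ : s₁.rel 0 = T := by
    rw [hTd]; unfold Memory.rel; rw [n₁, A₁, hA, hn]
  obtain ⟨d, hdd⟩ : ∃ d, d = s₁.reg 30 := ⟨_, rfl⟩
  rw [← hdd] at hd
  have hc : HExpr.eval (.lt (.reg 30) (.reg 0)) s₁ ≠ 0 ↔ d < n := by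
    rw [HExpr.lt_ne_zero]; simp [← hdd, n₁]
  rcases hd with ⟨hdn, hd⟩ | ⟨hdn, hd⟩
  · rw [if_pos (hc.2 hdn), run_seq, run_seq, run_ite]
    have hpos := fun {v : ℕ} (hv : v < n) => positions_spec n₁ κ₁ hdd.symm
      (fun v hv => by rw [hdeg v hv, T₁]) hv
    rw [T₁] at hpos
    obtain ⟨g, hgd⟩ : ∃ g, g = position T κ (degClass (range n) T d) := ⟨_, rfl⟩
    rw [← hgd] at hpos
    obtain ⟨s₂, hs₂⟩ : ∃ s₂, s₂ = positions.run s₁ := ⟨_, rfl⟩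
    rw [← hs₂] at hpos ⊢
    have n₂ : s₂.reg 0 = n := by rw [hs₂, run_reg rfl, n₁]
    have κ₂ : s₂.reg 1 = κ := by rw [hs₂, run_reg rfl, κ₁]
    have k₂ : s₂.reg 40 = k := by rw [hs₂, run_reg rfl, k₁]
    have b₂ : s₂.reg 41 = b := by rw [hs₂, run_reg rfl, b₁]
    have d₂ : s₂.reg 30 = d := by rw [hs₂, run_reg rfl, hdd]
    have A₂ : s₂.arr 0 = A := by rw [hs₂, run_arr rfl, A₁]
    have T₂ : s₂.rel 0 = T := by
      rw [hTd]; unfold Memory.rel; rw [n₂, A₂, hA, hn]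
    have deg₂ : ∀ v < n, s₂.arr 1 v = inDeg (range n) T v := fun v hv => by
      rw [hs₂, run_arr rfl, hdeg v hv]
    obtain ⟨hviol, m, hm, h32⟩ := splitCost_spec n₂ (T₂.symm ▸ hT) d₂
      (fun v hv => by rw [T₂]; exact deg₂ v hv) (fun v hv => hpos hv)
    rw [T₂] at hviol hm h32
    obtain ⟨s₃, hs₃⟩ : ∃ s₃, s₃ = splitCost.run s₂ := ⟨_, rfl⟩
    rw [← hs₃] at hviol h32 ⊢
    have n₃ : s₃.reg 0 = n := by rw [hs₃, run_reg rfl, n₂]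
    have κ₃ : s₃.reg 1 = κ := by rw [hs₃, run_reg rfl, κ₂]
    have k₃ : s₃.reg 40 = k := by rw [hs₃, run_reg rfl, k₂]
    have b₃ : s₃.reg 41 = b := by rw [hs₃, run_reg rfl, b₂]
    have A₃ : s₃.arr 0 = A := by rw [hs₃, run_arr rfl, A₂]
    have T₃ : s₃.rel 0 = T := by
      rw [hTd]; unfold Memory.rel; rw [n₃, A₃, hA, hn]
    have pos₃ : ∀ v < n, s₃.arr 2 v = g v := fun v hv => by
      rw [hs₃, run_arr rfl, hpos hv]
    have hsplit := solvable_iff_split (r := fun v => v) hT hle hd (hgd ▸ hm)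
    rw [← hgd] at hsplit
    have hnl : ¬ NoLargeClass n κ T := fun h => by have := h d; omega
    have hc' : HExpr.eval (.or (.reg 31) (.lt (.reg 40) (.reg 32))) s₃ ≠ 0 ↔
        ¬ ((∀ x ∈ degClass (range n) T d, g x = 1) ∧ m + numDown (range n) T g ≤ k) := by
      rw [HExpr.or_ne_zero, HExpr.lt_ne_zero, ← hviol]
      simp only [HExpr.eval_reg, k₃, h32]
      omega
    by_cases hfail : (∀ x ∈ degClass (range n) T d, g x = 1) ∧ m + numDown (range n) T g ≤ k
    · rw [if_neg (by rw [hc']; exact not_not.2 hfail), run_seq, run_set, run_seq]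
      have hv : HExpr.eval (.sub (.reg 40) (.reg 32)) s₃ = k - (m + numDown (range n) T g) := by
        simp [k₃, h32]
      rw [hv]
      obtain ⟨s₄, hs₄⟩ : ∃ s₄, s₄ = s₃.setReg 40 (k - (m + numDown (range n) T g)) := ⟨_, rfl⟩
      rw [← hs₄]
      have n₄ : s₄.reg 0 = n := by simp [hs₄, n₃]
      have pos₄ : ∀ v < n, s₄.arr 2 v = g v := fun v hv => by
        rw [hs₄, Memory.setReg_arr, pos₃ v hv]
      have T₄ : s₄.rel 0 = T := by rw [hs₄, rel_setReg (by decide), T₃]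
      have e7 : HExpr.reads 7 splitExpr = false := rfl
      have e0 : HExpr.reads 0 (.get₂ 7 10 11) = false := rfl
      have hrel : ∀ x ∈ range n, ∀ y ∈ range n,
          splitAt T g (fun v => v) x y ↔
            ((fill₂ 0 (.get₂ 7 10 11)).run ((fill₂ 7 splitExpr).run s₄)).rel 0 x y := by
        intro x hx y hy
        rw [mem_range] at hx hy
        have n₅ : ((fill₂ 7 splitExpr).run s₄).reg 0 = n := by rw [reg_fill₂ e7, n₄]
        rw [Memory.rel, reg_fill₂ e0, n₅, arr_fill₂ e0 n₅ hx hy]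
        simp only [HExpr.eval_get₂ _ (show 10 ≠ 12 by decide), Memory.setReg_reg,
          Memory.setReg_arr, Nat.reduceEqDiff, if_true, if_false, n₅]
        rw [arr_fill₂ e7 n₄ hx hy, ← T₄]
        exact (splitExpr_spec pos₄ hx hy).symm
      refine ⟨⟨?_, ?_, ?_, ?_, ?_⟩, ?_, .inr (.inr ⟨hnl, ?_⟩)⟩
      · rw [reg_fill₂ e0, reg_fill₂ e7, n₄]
      · rw [reg_fill₂ e0, reg_fill₂ e7, hs₄]; simpa using κ₃
      · exact (isTournamentOn_splitAt hT (fun x _ y _ h => h)).congr hrel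
      · rw [reg_fill₂ e0, reg_fill₂ e7, hs₄]
        simp only [Memory.setReg_reg, if_true]
        omega
      · rw [hP, hsplit]
        rw [reg_fill₂ e0, reg_fill₂ e7, reg_fill₂ e0, reg_fill₂ e7, ← solvable_congr hrel, hs₄]
        simp only [Memory.setReg_reg, if_true, Nat.reduceEqDiff, if_false, b₃]
        tauto
      · rw [reg_fill₂ e0, reg_fill₂ e7, hs₄]
        simp only [Memory.setReg_reg, if_true]
        omega
      · rw [← onTriangle_congr hrel]
        exact card_onTriangle_splitAt_lt hT (by omega) hfail.1
    · rw [if_pos (hc'.2 hfail), run_set]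
      refine ⟨⟨by simpa using n₃, by simpa using κ₃, ?_, by simpa [k₃] using hle, ?_⟩,
        by simp [k₃], .inr (.inl (by simp))⟩
      · rw [rel_setReg (by decide), T₃]; exact hT
      · rw [hP, hsplit]
        simp only [Memory.setReg_reg, if_true, HExpr.eval_const]
        tauto
  · rw [if_neg (by rw [hc]; omega)]
    refine ⟨⟨n₁, κ₁, T₁.symm ▸ hT, k₁.symm ▸ hle, ?_⟩, k₁.le, .inl ⟨hd, A₁⟩⟩
    rw [hP, T₁, k₁, b₁]

end HProg

/-! ### The exhaustive application of the reduction rules -/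

namespace HProg

open Classical RAM Finset

theorem IsReduced.setReg {n κ : ℕ} {P : Prop} {s : Memory} (h : IsReduced n κ P s) {x : ℕ} (v : ℕ)
    (h0 : x ≠ 0) (h1 : x ≠ 1) (h40 : x ≠ 40) (h41 : x ≠ 41) : IsReduced n κ P (s.setReg x v) := by
  refine ⟨?_, ?_, ?_, ?_, ?_⟩ <;> simp only [rel_setReg h0, Memory.setReg_reg, h0.symm, h1.symm,
    h40.symm, h41.symm, if_false]
  exacts [h.n_eq, h.κ_eq, h.isTournamentOn, h.le, h.iff]

theorem run_when_not (e : HExpr) (p : HProg) (s : Memory) :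
    (when (.not e) p).run s = if e.eval s = 0 then p.run s else s := by
  rw [run_when]
  exact if_congr (by rw [HExpr.not_ne_zero, not_not]) rfl rfl

/-- There are many vertices `u` such that the arc from the vertex in register 14 to the vertex in
register 15 is in a triangle with `u`. -/
def manyTriangles : HExpr :=
  .le (.add (.times 6 (.reg 1)) (.const 2)) (.count 13 0 (.and (.get₂ 0 15 13) (.get₂ 0 13 14)))

/-- The arc from the vertex in register 14 to the vertex in register 15 exists and lies in many
triangles. -/
def heavyArc : HExpr := .and (.get₂ 0 14 15) manyTriangles

theorem heavyArc_spec {n κ : ℕ} {s : Memory} (hn : s.reg 0 = n) (hκ : s.reg 1 = κ) (q p : ℕ) :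
    heavyArc.eval ((s.setReg 14 q).setReg 15 p) ≠ 0 ↔
      s.rel 0 q p ∧ 6 * κ + 2 ≤ #(triangleVertices (range n) (s.rel 0) q p) := by
  rw [heavyArc, HExpr.and_ne_zero, manyTriangles, HExpr.le_ne_zero,
    HExpr.eval_count_eq (P := fun u => s.rel 0 p u ∧ s.rel 0 u q)]
  · simp only [HExpr.eval_add, HExpr.eval_times, HExpr.eval_reg, HExpr.eval_const,
      Memory.setReg_reg, Nat.reduceEqDiff, if_false, hn, hκ, triangleVertices]
    simp [Memory.rel]
  · intro u _
    rw [HExpr.and_ne_zero]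
    simp [Memory.rel]

/-- Reverse an arc that lies in many triangles, if there is one. -/
def arcStep : HProg :=
  seq (set 30 (.find 14 0 (.count 15 0 heavyArc))) <| when (.lt (.reg 30) (.reg 0)) <|
  seq (set 14 (.reg 30)) <| seq (set 31 (.find 15 0 heavyArc)) <|
  ite (.reg 40) (seq (set 40 (.sub (.reg 40) (.const 1))) (reverse 0 30 31)) (set 41 (.const 1))

theorem arcStep_spec {n κ : ℕ} {P : Prop} {s : Memory} (h : IsReduced n κ P s) :
    (NoHeavyArc n κ (s.rel 0) ∧ IsReduced n κ P (arcStep.run s) ∧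
        (arcStep.run s).arr 0 = s.arr 0) ∨
      ¬ NoHeavyArc n κ (s.rel 0) ∧ (NoLargeClass n κ (s.rel 0) → IsReduced n κ P (arcStep.run s) ∧
        ((arcStep.run s).reg 41 ≠ 0 ∨ (arcStep.run s).reg 40 < s.reg 40)) := by
  have hP := h.iff
  have hn := h.n_eq
  have hκ := h.κ_eq
  have hq := HExpr.eval_find (show 0 ≠ 14 by decide) (.count 15 0 heavyArc) s
  rw [arcStep, run_seq, run_set, run_when]
  obtain ⟨q, hqd⟩ : ∃ q, q = (HExpr.find 14 0 (.count 15 0 heavyArc)).eval s := ⟨_, rfl⟩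
  rw [← hqd, hn] at hq
  rw [← hqd]
  have hcount : ∀ q, (HExpr.count 15 0 heavyArc).eval (s.setReg 14 q) ≠ 0 ↔
      ∃ p < n, s.rel 0 q p ∧ 6 * κ + 2 ≤ #(triangleVertices (range n) (s.rel 0) q p) := by
    intro q
    rw [HExpr.eval_count_ne_zero, Memory.setReg_reg, if_neg (by decide), hn]
    simp_rw [heavyArc_spec hn hκ]
  have hc : HExpr.eval (.lt (.reg 30) (.reg 0)) (s.setReg 30 q) ≠ 0 ↔ q < n := by
    rw [HExpr.lt_ne_zero]; simp [hn]
  rcases hq with ⟨-, hqn, hq, -⟩ | ⟨hq, hqn⟩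
  · right
    refine ⟨fun hh => ?_, fun hsmall => ?_⟩
    · obtain ⟨p, hpn, hqp, hp⟩ := (hcount q).1 hq
      exact absurd (hh q hqn p hpn hqp) (not_lt.2 hp)
    rw [if_pos (hc.2 hqn), run_seq, run_set, run_seq, run_set]
    obtain ⟨s₁, hs₁⟩ : ∃ s₁, s₁ = (s.setReg 30 q).setReg 14
      ((HExpr.reg 30).eval (s.setReg 30 q)) := ⟨_, rfl⟩
    rw [← hs₁]
    have hr₁ : ∀ x, s₁.reg x = if x = 14 ∨ x = 30 then q else s.reg x := by
      intro x
      simp only [hs₁, Memory.setReg_reg, HExpr.eval_reg, if_true]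
      split_ifs <;> tauto
    have rel₁ : s₁.rel 0 = s.rel 0 := by
      rw [hs₁, rel_setReg (by decide), rel_setReg (by decide)]
    have n₁ : s₁.reg 0 = n := by simp [hr₁, hn]
    have κ₁ : s₁.reg 1 = κ := by simp [hr₁, hκ]
    have hs14 : s₁.setReg 14 q = s₁ := by
      have h14 : s₁.reg 14 = q := by simp [hr₁]
      refine Memory.ext' (fun x => ?_) fun _ _ => rfl
      rw [Memory.setReg_reg]
      split_ifs with hx
      · rw [hx, h14]
      · rfl
    have hp := HExpr.eval_find (show 0 ≠ 15 by decide) heavyArc s₁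
    rw [n₁] at hp
    have hpe : ∀ p, heavyArc.eval (s₁.setReg 15 p) ≠ 0 ↔
        s.rel 0 q p ∧ 6 * κ + 2 ≤ #(triangleVertices (range n) (s.rel 0) q p) := by
      intro p
      have := heavyArc_spec n₁ κ₁ q p
      rw [rel₁] at this
      rwa [hs14] at this
    obtain ⟨p, hpd⟩ : ∃ p, p = (HExpr.find 15 0 heavyArc).eval s₁ := ⟨_, rfl⟩
    rw [← hpd] at hp ⊢
    rcases hp with ⟨-, hpn, hp, -⟩ | ⟨hp, -⟩
    swap
    · obtain ⟨p', hp', hh⟩ := (hcount q).1 hq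
      exact absurd (hp p' hp') ((hpe p').2 hh)
    obtain ⟨hqp, htri⟩ := (hpe p).1 hp
    have hsolv := solvable_iff_reverseArc h.isTournamentOn h.le (mem_range.2 hpn)
      (mem_range.2 hqn) hqp htri hsmall
    rw [run_ite]
    have hcond : HExpr.eval (.reg 40) (s₁.setReg 31 p) = s.reg 40 := by simp [hr₁]
    rw [hcond]
    by_cases h40 : s.reg 40 = 0
    · have hnP : ¬ P := by
        rw [hP, hsolv]; tauto
      rw [if_neg (by tauto), run_set]
      refine ⟨⟨?_, ?_, ?_, ?_, ?_⟩, .inl (by simp)⟩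
      · simp [n₁]
      · simp [κ₁]
      · rw [rel_setReg (by decide), rel_setReg (by decide), rel₁]; exact h.isTournamentOn
      · simpa [hr₁] using h.le
      · simp [hnP]
    · rw [if_pos h40, run_seq, run_set]
      obtain ⟨s₂, hs₂⟩ : ∃ s₂, s₂ = (s₁.setReg 31 p).setReg 40
        (HExpr.eval (.sub (.reg 40) (.const 1)) (s₁.setReg 31 p)) := ⟨_, rfl⟩
      rw [← hs₂]
      have hr₂ : ∀ x, s₂.reg x = if x = 40 then s.reg 40 - 1 else if x = 31 then p else
          s₁.reg x := by
        intro x; simp [hs₂, hr₁]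
      have rel₂ : s₂.rel 0 = s.rel 0 := by
        rw [hs₂, rel_setReg (by decide), rel_setReg (by decide), rel₁]
      have hrev : ∀ x, ((reverse 0 30 31).run s₂).reg x = s₂.reg x := fun x => rfl
      have n₂ : s₂.reg 0 = n := by simp [hr₂, n₁]
      have q₂ : s₂.reg 30 = q := by simp [hr₂, hr₁]
      have p₂ : s₂.reg 31 = p := by simp [hr₂]
      have hrel : ∀ x ∈ range n, ∀ y ∈ range n, reverseArc (s.rel 0) q p x y ↔
          ((reverse 0 30 31).run s₂).rel 0 x y := by
        intro x _ y hy
        rw [mem_range] at hy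
        unfold Memory.rel
        rw [hrev, n₂, arr_reverse (by decide) (by decide) n₂ (q₂ ▸ hqn) (p₂ ▸ hpn) hy, q₂, p₂,
          rel₂]
        rfl
      refine ⟨⟨?_, ?_, ?_, ?_, ?_⟩, .inr ?_⟩
      · rw [hrev, n₂]
      · rw [hrev, hr₂]; simp [κ₁]
      · exact (isTournamentOn_reverseArc h.isTournamentOn (mem_range.2 hpn)
          (mem_range.2 hqn) hqp).congr hrel
      · have := h.le
        rw [hrev, hr₂, if_pos rfl]; omega
      · rw [hP, hsolv, hrev, hrev, ← solvable_congr hrel]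
        simp [hr₂, hr₁, h40]
      · rw [hrev, hr₂, if_pos rfl]; omega
  · left
    rw [if_neg (by rw [hc]; omega)]
    refine ⟨fun q hqn p hpn hqp => ?_, h.setReg _ (by decide) (by decide) (by decide)
      (by decide), rfl⟩
    by_contra hcon
    exact (hcount q).2 ⟨p, hpn, hqp, not_lt.1 hcon⟩ (hq q hqn)

/-- Split the tournament as long as there are large classes. Every split decreases the number of
vertices on triangles, so `n` rounds suffice. -/
def splits : HProg := loop 24 0 (when (.not (.reg 41)) splitStep)

theorem splits_spec {n κ : ℕ} {P : Prop} {s : Memory} (h : IsReduced n κ P s) :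
    IsReduced n κ P (splits.run s) ∧ (splits.run s).reg 40 ≤ s.reg 40 ∧
      ((splits.run s).reg 41 ≠ 0 ∨ NoLargeClass n κ ((splits.run s).rel 0)) ∧
      (NoLargeClass n κ (s.rel 0) → (splits.run s).reg 41 ≠ 0 ∨
        (splits.run s).rel 0 = s.rel 0) ∧
      (s.reg 41 ≠ 0 → (splits.run s).reg 41 ≠ 0) := by
  have hcard : ∀ s : Memory, #(onTriangle (range n) (s.rel 0)) ≤ n := fun s =>
    (card_filter_le _ _).trans (card_range n).le
  obtain ⟨s', ⟨h1, h2, h3, h4, h5⟩, hs'⟩ := run_loop_induction (x := 24) (b := 0)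
    (p := when (.not (.reg 41)) splitStep)
    (s := s) (fun i s' => IsReduced n κ P s' ∧ s'.reg 40 ≤ s.reg 40 ∧
      (s'.reg 41 ≠ 0 ∨ NoLargeClass n κ (s'.rel 0) ∨ #(onTriangle (range n) (s'.rel 0)) + i ≤ n) ∧
      (NoLargeClass n κ (s.rel 0) → s'.reg 41 ≠ 0 ∨ s'.rel 0 = s.rel 0) ∧
      (s.reg 41 ≠ 0 → s'.reg 41 ≠ 0))
    ⟨h, le_rfl, .inr (.inr (hcard s)), fun _ => .inr rfl, id⟩ (by
      rintro i - s' ⟨h1, h2, h3, h4, h0⟩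
      have h1' := h1.setReg (x := 24) i (by decide) (by decide) (by decide) (by decide)
      obtain ⟨s₁, hs₁⟩ : ∃ s₁, s₁ = s'.setReg 24 i := ⟨_, rfl⟩
      have hr : s'.rel 0 = s₁.rel 0 := by rw [hs₁, rel_setReg (by decide)]
      have h40 : s'.reg 40 = s₁.reg 40 := by simp [hs₁]
      have h41 : s'.reg 41 = s₁.reg 41 := by simp [hs₁]
      rw [hr, h41] at h3 h4
      rw [h41] at h0
      rw [h40] at h2
      rw [← hs₁] at h1' ⊢
      rw [run_when_not, HExpr.eval_reg]
      by_cases hf : s₁.reg 41 = 0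
      swap
      · rw [if_neg hf]
        exact ⟨h1', h2, .inl hf, h4, h0⟩
      rw [if_pos hf]
      obtain ⟨h5, h6, h7⟩ := splitStep_spec h1'
      have hrel : (splitStep.run s₁).arr 0 = s₁.arr 0 →
          (splitStep.run s₁).rel 0 = s₁.rel 0 := by
        intro hh
        unfold Memory.rel
        rw [h5.n_eq, h1'.n_eq, hh]
      refine ⟨h5, h6.trans h2, ?_, fun hl => ?_, fun hh => absurd hf (h0 hh)⟩
      · rcases h7 with ⟨h7, h8⟩ | h7 | ⟨h7, h8⟩
        · rw [hrel h8]; exact .inr (.inl h7)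
        · exact .inl h7
        · rcases h3 with h3 | h3 | h3
          · exact absurd hf h3
          · exact absurd h3 h7
          · exact .inr (.inr (by omega))
      · have h9 := (h4 hl).resolve_left (not_not.2 hf)
        rcases h7 with ⟨h7, h8⟩ | h7 | ⟨h7, h8⟩
        · rw [hrel h8, h9]; exact .inr rfl
        · exact .inl h7
        · exact absurd (h9 ▸ hl) h7)
  have hrel : (splits.run s).rel 0 = s'.rel 0 := by rw [splits, hs', rel_setReg (by decide)]
  have h41 : (splits.run s).reg 41 = s'.reg 41 := by rw [splits, hs']; rfl
  rw [hrel, h41]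
  refine ⟨?_, ?_, ?_, h4, h5⟩
  · rw [splits, hs']; exact h1.setReg _ (by decide) (by decide) (by decide) (by decide)
  · rw [splits, hs']; simpa using h2
  · rcases h3 with h3 | h3 | h3
    · exact .inl h3
    · exact .inr h3
    · right
      rw [h.n_eq] at h3
      have h0 : #(onTriangle (range n) (s'.rel 0)) = 0 := by omega
      intro d
      by_contra hd
      obtain ⟨x, hx, y, hy, hxy⟩ :=
        one_lt_card.1 (show 1 < #(degClass (range n) (s'.rel 0) d) by omega)
      obtain ⟨hx, hx'⟩ := mem_filter.1 hx
      obtain ⟨hy, hy'⟩ := mem_filter.1 hy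
      have := mem_onTriangle_of_inDeg_eq h1.isTournamentOn hx hy hxy (hx'.trans hy'.symm)
      rw [card_eq_zero.1 h0] at this
      simp at this

/-- Reduce the tournament until there are neither large classes nor arcs in many triangles. Every
arc that is reversed decreases the parameter, so after `n` rounds either no such arc is left or
`n ≤ κ`, and then no arc can lie in that many triangles. -/
def reduce : HProg :=
  seq (set 40 (.reg 1)) <| seq (set 41 (.const 0)) <| seq splits <|
    loop 25 0 (when (.not (.reg 41)) (seq arcStep splits))

theorem reduce_spec {n κ : ℕ} {s : Memory} (hn : s.reg 0 = n) (hκ : s.reg 1 = κ)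
    (hT : IsTournamentOn (range n) (s.rel 0)) {P : Prop} (hP : P ↔ Solvable (range n) (s.rel 0) κ) :
    IsReduced n κ P (reduce.run s) ∧ ((reduce.run s).reg 41 ≠ 0 ∨
      NoLargeClass n κ ((reduce.run s).rel 0) ∧ NoHeavyArc n κ ((reduce.run s).rel 0)) := by
  rw [reduce, run_seq, run_seq, run_seq, run_set, run_set]
  obtain ⟨s₁, hs₁⟩ : ∃ s₁, s₁ = (s.setReg 40 ((HExpr.reg 1).eval s)).setReg 41
    ((HExpr.const 0).eval (s.setReg 40 ((HExpr.reg 1).eval s))) := ⟨_, rfl⟩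
  rw [← hs₁]
  have h₁ : IsReduced n κ P s₁ := by
    have hrel : s₁.rel 0 = s.rel 0 := by
      rw [hs₁, rel_setReg (by decide), rel_setReg (by decide)]
    refine ⟨by simpa [hs₁] using hn, by simpa [hs₁] using hκ, hrel ▸ hT, by simp [hs₁, hκ], ?_⟩
    rw [hP, hrel]
    simp [hs₁, hκ]
  obtain ⟨h₂, -, hl₂, -, -⟩ := splits_spec h₁
  obtain ⟨s₂, hs₂⟩ : ∃ s₂, s₂ = splits.run s₁ := ⟨_, rfl⟩
  rw [← hs₂] at h₂ hl₂ ⊢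
  obtain ⟨s', ⟨h3, h4⟩, hs'⟩ := run_loop_induction (x := 25) (b := 0)
    (p := when (.not (.reg 41)) (seq arcStep splits))
    (s := s₂) (fun i s' => IsReduced n κ P s' ∧ (s'.reg 41 ≠ 0 ∨ NoLargeClass n κ (s'.rel 0) ∧
      (NoHeavyArc n κ (s'.rel 0) ∨ s'.reg 40 + i ≤ κ)))
    ⟨h₂, hl₂.imp_right fun h => ⟨h, .inr h₂.le⟩⟩ (by
      rintro i - s' ⟨h1, h2⟩
      have h1' := h1.setReg (x := 25) i (by decide) (by decide) (by decide) (by decide)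
      obtain ⟨s₃, hs₃⟩ : ∃ s₃, s₃ = s'.setReg 25 i := ⟨_, rfl⟩
      have hr : s₃.rel 0 = s'.rel 0 := by rw [hs₃, rel_setReg (by decide)]
      have h40 : s₃.reg 40 = s'.reg 40 := by simp [hs₃]
      have h41 : s₃.reg 41 = s'.reg 41 := by simp [hs₃]
      rw [← hs₃] at h1' ⊢
      rw [← hr, ← h40, ← h41] at h2
      rw [run_when_not, HExpr.eval_reg]
      by_cases hf : s₃.reg 41 = 0
      swap
      · rw [if_neg hf]
        exact ⟨h1', .inl hf⟩
      rw [if_pos hf, run_seq]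
      obtain ⟨hl, h2⟩ := h2.resolve_left (not_not.2 hf)
      rcases arcStep_spec h1' with ⟨h5, h6, h7⟩ | ⟨h7, h5⟩
      · have hrel : (arcStep.run s₃).rel 0 = s₃.rel 0 := by
          unfold Memory.rel
          rw [h6.n_eq, h1'.n_eq, h7]
        obtain ⟨h8, -, -, h9, -⟩ := splits_spec h6
        rw [hrel] at h9
        refine ⟨h8, (h9 hl).imp_right fun h9 => ?_⟩
        rw [h9]
        exact ⟨hl, .inl h5⟩
      · obtain ⟨h5, h6⟩ := h5 hl
        obtain ⟨h8, h9, h10, -, h11⟩ := splits_spec h5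
        refine ⟨h8, h6.elim (fun h6 => .inl (h11 h6)) fun h6 => h10.imp_right fun h10 =>
          ⟨h10, h2.elim (fun h2 => absurd h2 h7) fun h2 => .inr (by omega)⟩⟩)
  have hrel : ((loop 25 0 (when (.not (.reg 41)) (seq arcStep splits))).run s₂).rel 0 =
      s'.rel 0 := by rw [hs', rel_setReg (by decide)]
  have h41 : ((loop 25 0 (when (.not (.reg 41)) (seq arcStep splits))).run s₂).reg 41 =
      s'.reg 41 := by rw [hs']; rfl
  rw [hrel, h41]
  refine ⟨?_, h4.imp_right fun h4 => ⟨h4.1, h4.2.elim id fun h5 q hq p hp hqp => ?_⟩⟩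
  · rw [hs']; exact h3.setReg _ (by decide) (by decide) (by decide) (by decide)
  · rw [h₂.n_eq] at h5
    have : #(triangleVertices (range n) (s'.rel 0) q p) ≤ n :=
      (card_filter_le _ _).trans (card_range n).le
    omega

end HProg

/-! ### Instances as relations on an initial segment of the natural numbers -/

section Instances

open Classical RAM Finset

namespace TournamentInstance

/-- The instance given by a relation on the numbers below `n` that is a tournament. -/
def ofRel (n k : ℕ) (R : ℕ → ℕ → Prop) (h : IsTournamentOn (range n) R) : TournamentInstance where
  n := n
  k := k
  T := ⟨fun i j => R i j⟩
  isTournament := by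
    refine ⟨fun x => h.1 x (mem_range.2 x.2), fun x y hxy => ?_⟩
    have := h.2 x (mem_range.2 x.2) y (mem_range.2 y.2) (fun h => hxy (Fin.ext h))
    change Xor (R x y) (R y x)
    unfold Xor
    tauto

theorem solvable_range_iff {n k : ℕ} {R : ℕ → ℕ → Prop} :
    Solvable (range n) R k ↔ Solvable (univ : Finset (Fin n)) (fun i j => R i j) k := by
  refine Iff.trans ?_ (solvable_map Fin.valEmbedding univ R k)
  refine iff_of_eq (congrArg (fun S => Solvable S R k) ?_)
  ext x
  simp only [mem_range, mem_map, mem_univ, true_and, Fin.valEmbedding_apply]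
  exact ⟨fun h => ⟨⟨x, h⟩, rfl⟩, by rintro ⟨y, rfl⟩; exact y.2⟩

theorem ofRel_mem {n k : ℕ} {R : ℕ → ℕ → Prop} (h : IsTournamentOn (range n) R) :
    ofRel n k R h ∈ EulerianStrongComponentArcDeletion ↔ Solvable (range n) R k := by
  rw [solvable_range_iff]
  exact Digraph.exists_isDESCSet_iff

theorem matrix_apply (I : TournamentInstance) (i j : Fin I.n) :
    I.matrix (i * I.n + j) = if I.T.Adj i j then 1 else 0 := by
  unfold matrix
  refine if_congr ⟨?_, fun h => ⟨i, j, rfl, h⟩⟩ rfl rfl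
  rintro ⟨i', j', h, h'⟩
  obtain ⟨h1, h2⟩ := (lex_eq_iff j.2 j'.2).1 h
  rw [Fin.ext h1, Fin.ext h2]
  exact h'

theorem isOutput_ofRel {n k : ℕ} {R : ℕ → ℕ → Prop} (h : IsTournamentOn (range n) R) {s : Memory}
    (h0 : s.reg 0 = n) (h1 : s.reg 1 = k)
    (hR : ∀ x < n, ∀ y < n, s.arr 0 (x * n + y) = if R x y then 1 else 0) :
    (ofRel n k R h).IsOutput s := by
  refine ⟨h0, h1, fun p hp => ?_⟩
  have hp : p < n * n := hp
  have hn : 0 < n := Nat.pos_of_ne_zero (by rintro rfl; simp at hp)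
  have hq := Nat.div_lt_of_lt_mul hp
  have hr := Nat.mod_lt p hn
  have h2 := matrix_apply (ofRel n k R h) ⟨p / n, hq⟩ ⟨p % n, hr⟩
  have h3 : p / n * n + p % n = p := by rw [mul_comm]; exact Nat.div_add_mod p n
  have h4 := hR (p / n) hq (p % n) hr
  rw [h3] at h4
  change (ofRel n k R h).matrix (p / n * n + p % n) = if R (p / n) (p % n) then 1 else 0 at h2
  rw [h3] at h2
  rw [h4, h2]

theorem input_rel (I : TournamentInstance) (i j : Fin I.n) : I.input.rel 0 i j ↔ I.T.Adj i j := by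
  have h : I.input.rel 0 i j ↔ I.matrix (i * I.n + j) ≠ 0 := Iff.rfl
  rw [h, matrix_apply]
  simp

theorem isTournamentOn_input (I : TournamentInstance) :
    IsTournamentOn (range I.n) (I.input.rel 0) := by
  refine ⟨fun x hx => ?_, fun x hx y hy hxy => ?_⟩
  · have := input_rel I ⟨x, mem_range.1 hx⟩ ⟨x, mem_range.1 hx⟩
    rw [this]; exact I.isTournament.1 _
  · have h1 := input_rel I ⟨x, mem_range.1 hx⟩ ⟨y, mem_range.1 hy⟩
    have h2 := input_rel I ⟨y, mem_range.1 hy⟩ ⟨x, mem_range.1 hx⟩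
    rw [h1, h2]
    have := I.isTournament.2 ⟨x, mem_range.1 hx⟩ ⟨y, mem_range.1 hy⟩ (by simpa using hxy)
    unfold Xor at this
    tauto

theorem mem_iff_solvable {I : TournamentInstance} {R : ℕ → ℕ → Prop}
    (hR : ∀ i j : Fin I.n, R i j ↔ I.T.Adj i j) :
    I ∈ EulerianStrongComponentArcDeletion ↔ Solvable (range I.n) R I.k := by
  rw [solvable_range_iff]
  refine Digraph.exists_isDESCSet_iff.trans ?_
  exact solvable_congr fun x _ y _ => (hR x y).symm

end TournamentInstance

/-- The arcs of a strong tournament on four vertices that is not Eulerian. -/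
def strongFour (x y : ℕ) : Prop := (x < y ∧ y < x + 3) ∨ (x = 3 ∧ y = 0)

theorem isTournamentOn_strongFour : IsTournamentOn (range 4) strongFour := by
  unfold strongFour
  refine ⟨fun x _ => by omega, fun x hx y hy hxy => ?_⟩
  rw [mem_range] at hx hy
  omega

theorem not_solvable_strongFour : ¬ Solvable (range 4) strongFour 0 := by
  rintro ⟨D, c, h1, h2, h3⟩
  have hD : ∀ x < 4, ∀ y < 4, strongFour x y → D x y := by
    intro x hx y hy hxy
    by_contra hcon
    have := card_eq_zero.1 (Nat.le_zero.1 h2)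
    exact notMem_empty (x, y) (this ▸ mem_filter.2 ⟨mk_mem_product (mem_range.2 hx)
      (mem_range.2 hy), hxy, hcon⟩)
  have hc : ∀ x < 4, ∀ y < 4, strongFour x y → c x ≤ c y := fun x hx y hy hxy =>
    h3.1 x (mem_range.2 hx) y (mem_range.2 hy) (hD x hx y hy hxy)
  have h01 := hc 0 (by omega) 1 (by omega) (by unfold strongFour; omega)
  have h12 := hc 1 (by omega) 2 (by omega) (by unfold strongFour; omega)
  have h23 := hc 2 (by omega) 3 (by omega) (by unfold strongFour; omega)
  have h30 := hc 3 (by omega) 0 (by omega) (by unfold strongFour; omega)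
  have hbal := h3.2 0 (by simp)
  have hle : #{w ∈ range 4 | c w = c 0 ∧ D w 0} ≤ #({3} : Finset ℕ) := card_le_card fun w hw => by
    obtain ⟨hw1, -, hw2⟩ := mem_filter.1 hw
    have := h1 w hw1 0 (by simp) hw2
    unfold strongFour at this
    simp; omega
  have hge : #({1, 2} : Finset ℕ) ≤ #{w ∈ range 4 | c w = c 0 ∧ D 0 w} := card_le_card fun w hw => by
    rw [mem_insert, mem_singleton] at hw
    refine mem_filter.2 ⟨by simp; omega, ?_, hD 0 (by omega) w (by omega) ?_⟩
    · rcases hw with rfl | rfl <;> omega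
    · unfold strongFour; omega
  rw [hbal] at hge
  simp at hge hle
  omega

end Instances

/-! ### The kernelization as a program -/

section Renumbering

open Classical Finset

variable {W : Finset ℕ} {V : ℕ → ℕ} {T : ℕ → ℕ → Prop}

theorem solvable_renumber {k : ℕ} (hV : ∀ r < #W, V r ∈ W ∧ #{u ∈ W | u < V r} = r) :
    Solvable (range #W) (fun x y => T (V x) (V y)) k ↔ Solvable W T k := by
  have hinj : Function.Injective fun i : Fin #W => V i := fun i j h => by
    have hi := (hV i i.2).2
    have hj := (hV j j.2).2
    change V i = V j at h
    rw [h] at hi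
    exact Fin.ext (hi.symm.trans hj)
  have himage : univ.map ⟨fun i : Fin #W => V i, hinj⟩ = W := by
    refine eq_of_subset_of_card_le (fun x hx => ?_) (by simp)
    obtain ⟨i, -, rfl⟩ := mem_map.1 hx
    exact (hV i i.2).1
  have h := solvable_map ⟨fun i : Fin #W => V i, hinj⟩ univ T k
  rw [himage] at h
  rw [h, TournamentInstance.solvable_range_iff]
  rfl

theorem isTournamentOn_renumber (hV : ∀ r < #W, V r ∈ W ∧ #{u ∈ W | u < V r} = r)
    (hT : IsTournamentOn W T) : IsTournamentOn (range #W) fun x y => T (V x) (V y) := by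
  refine ⟨fun x hx => hT.1 _ (hV x (mem_range.1 hx)).1, fun x hx y hy hxy =>
    hT.2 _ (hV x (mem_range.1 hx)).1 _ (hV y (mem_range.1 hy)).1 fun h => hxy ?_⟩
  have hx' := (hV x (mem_range.1 hx)).2
  rw [h, (hV y (mem_range.1 hy)).2] at hx'
  exact hx'.symm

theorem exists_card_filter_lt {r : ℕ} (hr : r < #W) : ∃ v ∈ W, #{u ∈ W | u < v} = r := by
  have hf : (Set.ofPred (· ∈ W)).Finite := W.finite_toSet
  have hr' : r < #hf.toFinset := by
    convert hr
    ext x; rw [Set.Finite.mem_toFinset]; rfl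
  refine ⟨Nat.nth (· ∈ W) r, Nat.nth_mem_of_lt_card hf hr', ?_⟩
  have h := Nat.count_nth (p := (· ∈ W)) (n := r) fun hf => by
    convert hr
    ext x; rw [Set.Finite.mem_toFinset]; rfl
  rw [Nat.count_eq_card_filter_range] at h
  refine Eq.trans (congrArg card ?_) h
  ext u
  simp [and_comm]

end Renumbering

namespace HProg

open Classical RAM Finset

/-- The arcs of array `a` that lie on cycles are not balanced at the vertex in register 13. -/
def unbalancedAt (a : ℕ) : HExpr :=
  .not (.eq (.count 14 0 (.and (.get₂ a 13 14) (.get₂ 8 14 13)))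
    (.count 14 0 (.and (.get₂ a 14 13) (.get₂ 8 13 14))))

theorem unbalancedAt_spec {a n : ℕ} {s : Memory} (hn : s.reg 0 = n)
    (hreach : ∀ x < n, ∀ y < n, s.rel 8 x y ↔ Reach (range n) (s.rel a) x y) {u : ℕ} (hu : u < n) :
    (unbalancedAt a).eval (s.setReg 13 u) ≠ 0 ↔
      ¬ IsCyclicallyBalancedAt (range n) (s.rel a) u := by
  have hn' : (s.setReg 13 u).reg 0 = n := by simpa using hn
  rw [unbalancedAt, HExpr.not_ne_zero, HExpr.eq_ne_zero, IsCyclicallyBalancedAt,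
    HExpr.eval_count_eq (P := fun w => s.rel a u w ∧ Reach (range n) (s.rel a) w u),
    HExpr.eval_count_eq (P := fun w => s.rel a w u ∧ Reach (range n) (s.rel a) u w), hn']
  · intro w hw
    rw [hn'] at hw
    rw [HExpr.and_ne_zero, ← hreach u hu w hw]
    simp [Memory.rel]
  · intro w hw
    rw [hn'] at hw
    rw [HExpr.and_ne_zero, ← hreach w hw u hu]
    simp [Memory.rel]

/-- The vertex in register 10 is in a strong component that is not balanced. -/
def inUnbalancedPart : HExpr :=
  .count 13 0 (.and (.and (.get₂ 8 10 13) (.get₂ 8 13 10)) (unbalancedAt 0))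

theorem inUnbalancedPart_spec {n : ℕ} {s : Memory} (hn : s.reg 0 = n)
    (hreach : ∀ x < n, ∀ y < n, s.rel 8 x y ↔ Reach (range n) (s.rel 0) x y) {v : ℕ} (hv : v < n) :
    inUnbalancedPart.eval (s.setReg 10 v) ≠ 0 ↔ v ∈ unbalancedPart (range n) (s.rel 0) := by
  rw [inUnbalancedPart, HExpr.eval_count_ne_zero, unbalancedPart, mem_filter, mem_range,
    Memory.setReg_reg, if_neg (by decide), hn]
  simp only [mem_range, hv, true_and]
  refine exists_congr fun u => and_congr_right fun hu => ?_
  have h1 : HExpr.eval (.get₂ 8 10 13) ((s.setReg 10 v).setReg 13 u) ≠ 0 ↔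
      Reach (range n) (s.rel 0) v u := by
    rw [← hreach v hv u hu]; simp [Memory.rel]
  have h2 : HExpr.eval (.get₂ 8 13 10) ((s.setReg 10 v).setReg 13 u) ≠ 0 ↔
      Reach (range n) (s.rel 0) u v := by
    rw [← hreach u hu v hv]; simp [Memory.rel]
  rw [HExpr.and_ne_zero, HExpr.and_ne_zero, h1, h2, and_assoc]
  refine and_congr_right fun _ => and_congr_right fun _ => ?_
  have h0 : (s.setReg 10 v).rel 0 = s.rel 0 := rel_setReg (by decide) _ _ _
  have h8 : (s.setReg 10 v).rel 8 = s.rel 8 := rel_setReg (by decide) _ _ _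
  have := unbalancedAt_spec (a := 0) (s := s.setReg 10 v) (n := n) (by simpa using hn)
    (by rw [h0, h8]; exact hreach) hu
  rwa [h0] at this

/-- The greatest possible size of the kernel: the product of `16κ + 8` and the minimum of `n`
and `κ`. -/
def maxSize : HExpr :=
  .sum 13 0 (.ite (.lt (.reg 13) (.reg 1)) (.add (.times 16 (.reg 1)) (.const 8)) (.const 0))

theorem eval_maxSize {n κ : ℕ} {s : Memory} (hn : s.reg 0 = n) (hκ : s.reg 1 = κ) :
    maxSize.eval s = min n κ * (16 * κ + 8) := by
  rw [maxSize, HExpr.eval_sum, hn]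
  have : ∀ i ∈ range n, (HExpr.ite (.lt (.reg 13) (.reg 1)) (.add (.times 16 (.reg 1)) (.const 8))
      (.const 0)).eval (s.setReg 13 i) = if i < κ then 16 * κ + 8 else 0 := by
    intro i _
    rw [HExpr.eval_ite]
    refine if_congr ?_ ?_ rfl
    · rw [HExpr.lt_ne_zero]; simp [hκ]
    · simp [hκ]
  rw [sum_congr rfl this, ← sum_filter, sum_const, smul_eq_mul]
  congr 1
  have : {i ∈ range n | i < κ} = range (min n κ) := by ext; simp
  rw [this, card_range]

/-- The vertex marked in array 9 that has as many marked vertices before it as register 10 says. -/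
def nthMarked : HExpr :=
  .find 14 0 (.and (.get 9 (.reg 14))
    (.eq (.count 13 0 (.and (.get 9 (.reg 13)) (.lt (.reg 13) (.reg 14)))) (.reg 10)))

theorem nthMarked_spec {n r : ℕ} {W : Finset ℕ} {s : Memory} (hn : s.reg 0 = n)
    (hW : W ⊆ range n) (h9 : ∀ v < n, s.arr 9 v ≠ 0 ↔ v ∈ W) (hr : r < #W) :
    nthMarked.eval (s.setReg 10 r) ∈ W ∧ #{u ∈ W | u < nthMarked.eval (s.setReg 10 r)} = r := by
  have hfind := HExpr.eval_find (show 0 ≠ 14 by decide) (.and (.get 9 (.reg 14))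
    (.eq (.count 13 0 (.and (.get 9 (.reg 13)) (.lt (.reg 13) (.reg 14)))) (.reg 10)))
    (s.setReg 10 r)
  have hn' : (s.setReg 10 r).reg 0 = n := by simpa using hn
  rw [hn', ← nthMarked] at hfind
  have hc : ∀ v < n, HExpr.eval (.and (.get 9 (.reg 14))
      (.eq (.count 13 0 (.and (.get 9 (.reg 13)) (.lt (.reg 13) (.reg 14)))) (.reg 10)))
      ((s.setReg 10 r).setReg 14 v) ≠ 0 ↔ v ∈ W ∧ #{u ∈ W | u < v} = r := by
    intro v hv
    have hn'' : ((s.setReg 10 r).setReg 14 v).reg 0 = n := by simpa using hn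
    rw [HExpr.and_ne_zero, HExpr.eq_ne_zero,
      HExpr.eval_count_eq (P := fun u => u ∈ W ∧ u < v), hn'']
    · simp only [HExpr.eval_get, HExpr.eval_reg, Memory.setReg_reg, Memory.setReg_arr, if_true,
        Nat.reduceEqDiff, if_false, h9 v hv]
      refine and_congr_right fun _ => ?_
      have : {u ∈ range n | u ∈ W ∧ u < v} = {u ∈ W | u < v} := by
        ext u
        simp only [mem_filter]
        exact ⟨fun h => h.2, fun h => ⟨hW h.1, h⟩⟩
      rw [this]
    · intro u hu
      rw [hn''] at hu
      rw [HExpr.and_ne_zero, HExpr.lt_ne_zero]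
      simp [h9 u hu]
  rcases hfind with ⟨-, h1, h2, -⟩ | ⟨h1, -⟩
  · exact (hc _ h1).1 h2
  · obtain ⟨v, hv, hvr⟩ := exists_card_filter_lt hr
    have hvn := mem_range.1 (hW hv)
    exact absurd (h1 v hvn) ((hc v hvn).2 ⟨hv, hvr⟩)

/-- Find the vertices of the kernel and write them to array 2, and their multiples by `n` to
array 1. The order of the kernel is written to register 30 and its parameter to register 40.
If register 41 is not zero, the kernel is a fixed instance without solution. -/
def prepare : HProg :=
  seq reduce <| seq (closure 0) <| seq (fill 9 inUnbalancedPart) <|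
  seq (set 30 (.count 13 0 (.get 9 (.reg 13)))) <|
  seq (set 41 (.or (.reg 41) (.lt maxSize (.reg 30)))) <| seq (fill 2 nthMarked) <|
  seq (fill 1 (.sum 12 0 (.get 2 (.reg 10)))) <|
  when (.reg 41) (seq (set 30 (.const 4)) (set 40 (.const 0)))

theorem prepare_spec {n κ : ℕ} {s : Memory} (hn : s.reg 0 = n) (hκ : s.reg 1 = κ)
    (hT : IsTournamentOn (range n) (s.rel 0)) {P : Prop} (hP : P ↔ Solvable (range n) (s.rel 0) κ) :
    (prepare.run s).reg 41 ≠ 0 ∧ ¬ P ∧ (prepare.run s).reg 30 = 4 ∧ (prepare.run s).reg 40 = 0 ∨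
      (prepare.run s).reg 41 = 0 ∧ ∃ m k R, (prepare.run s).reg 30 = m ∧
        (prepare.run s).reg 40 = k ∧ m ≤ n ∧ m ≤ κ * (16 * κ + 8) ∧ k ≤ κ ∧
        IsTournamentOn (range m) R ∧ (P ↔ Solvable (range m) R k) ∧
        ∀ x < m, ∀ y < m,
          (prepare.run s).arr 0 ((prepare.run s).arr 1 x + (prepare.run s).arr 2 y) ≠ 0 ↔
            R x y := by
  obtain ⟨h₁, hsmall⟩ := reduce_spec hn hκ hT hP
  rw [prepare, run_seq, run_seq, run_seq, run_seq, run_seq, run_seq, run_seq, run_when]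
  obtain ⟨s₁, hs₁⟩ : ∃ s₁, s₁ = reduce.run s := ⟨_, rfl⟩
  rw [← hs₁] at h₁ hsmall ⊢
  have hcl := fun {x y : ℕ} (hx : x < n) (hy : y < n) =>
    closure_spec (a := 0) (by decide) h₁.n_eq hx hy
  obtain ⟨s₂, hs₂⟩ : ∃ s₂, s₂ = (closure 0).run s₁ := ⟨_, rfl⟩
  rw [← hs₂] at hcl ⊢
  have hr₂ : ∀ x, s₂.reg x = s₁.reg x := fun x => by
    rw [hs₂, run_reg rfl]
  have a₂ : s₂.arr 0 = s₁.arr 0 := by rw [hs₂, run_arr rfl]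
  obtain ⟨T, hTd⟩ : ∃ T, T = s₁.rel 0 := ⟨_, rfl⟩
  have T₂ : s₂.rel 0 = T := by
    rw [hTd]; unfold Memory.rel; rw [hr₂, a₂]
  have n₂ : s₂.reg 0 = n := (hr₂ 0).trans h₁.n_eq
  have e₃ : HExpr.reads 9 inUnbalancedPart = false := rfl
  have h9 : ∀ v < n, ((fill 9 inUnbalancedPart).run s₂).arr 9 v ≠ 0 ↔
      v ∈ unbalancedPart (range n) T := by
    intro v hv
    rw [arr_fill e₃ (n₂ ▸ hv), inUnbalancedPart_spec n₂ _ hv, T₂]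
    intro x hx y hy
    rw [T₂, hTd, Memory.rel, n₂]
    exact hcl hx hy
  obtain ⟨s₃, hs₃⟩ : ∃ s₃, s₃ = (fill 9 inUnbalancedPart).run s₂ := ⟨_, rfl⟩
  rw [← hs₃] at h9 ⊢
  have hr₃ : ∀ x, s₃.reg x = s₁.reg x := fun x => by rw [hs₃, reg_fill e₃, hr₂]
  have a₃ : s₃.arr 0 = s₁.arr 0 := by rw [hs₃, run_arr rfl, a₂]
  obtain ⟨W, hW⟩ : ∃ W, W = unbalancedPart (range n) T := ⟨_, rfl⟩
  rw [← hW] at h9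
  have hWn : W ⊆ range n := hW ▸ filter_subset _ _
  rw [run_set, run_set]
  have hcount : (HExpr.count 13 0 (.get 9 (.reg 13))).eval s₃ = #W := by
    rw [HExpr.eval_count_eq (P := fun v => v ∈ W), hr₃, h₁.n_eq, filter_mem_eq_inter,
      inter_eq_right.2 hWn]
    intro v hv
    rw [hr₃, h₁.n_eq] at hv
    rw [← h9 v hv]; simp
  rw [hcount]
  obtain ⟨b, hb⟩ : ∃ b, b = (HExpr.or (.reg 41) (.lt maxSize (.reg 30))).eval (s₃.setReg 30 #W) :=
    ⟨_, rfl⟩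
  have hb' : b ≠ 0 ↔ s₁.reg 41 ≠ 0 ∨ min n κ * (16 * κ + 8) < #W := by
    rw [hb, HExpr.or_ne_zero, HExpr.lt_ne_zero, eval_maxSize (n := n) (κ := κ)]
    · simp [hr₃]
    · simp [hr₃, h₁.n_eq]
    · simp [hr₃, h₁.κ_eq]
  rw [← hb]
  obtain ⟨s₄, hs₄⟩ : ∃ s₄, s₄ = (s₃.setReg 30 #W).setReg 41 b := ⟨_, rfl⟩
  rw [← hs₄]
  have n₄ : s₄.reg 0 = n := by simp [hs₄, hr₃, h₁.n_eq]
  have e₅ : HExpr.reads 2 nthMarked = false := rfl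
  have e₆ : HExpr.reads 1 (.sum 12 0 (.get 2 (.reg 10))) = false := rfl
  have a₄ : s₄.arr = s₃.arr := by simp [hs₄]
  obtain ⟨V, hVd⟩ : ∃ V : ℕ → ℕ, V = fun r => nthMarked.eval (s₄.setReg 10 r) := ⟨_, rfl⟩
  have hV : ∀ r < #W, V r ∈ W ∧ #{u ∈ W | u < V r} = r := by
    intro r hr
    rw [hVd]
    exact nthMarked_spec n₄ hWn (fun v hv => by rw [a₄]; exact h9 v hv) hr
  have h2₅ : ∀ r < n, ((fill 2 nthMarked).run s₄).arr 2 r = V r := fun r hr => by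
    rw [arr_fill e₅ (n₄ ▸ hr), hVd]
  obtain ⟨s₅, hs₅⟩ : ∃ s₅, s₅ = (fill 2 nthMarked).run s₄ := ⟨_, rfl⟩
  rw [← hs₅] at h2₅ ⊢
  have hr₅ : ∀ x, s₅.reg x = s₄.reg x := fun x => by rw [hs₅, reg_fill e₅]
  have n₅ : s₅.reg 0 = n := by rw [hr₅, n₄]
  have a₅ : s₅.arr 0 = s₁.arr 0 := by rw [hs₅, run_arr rfl, a₄, a₃]
  have h1₆ : ∀ r < n, ((fill 1 (.sum 12 0 (.get 2 (.reg 10)))).run s₅).arr 1 r = V r * n := by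
    intro r hr
    rw [arr_fill e₆ (n₅ ▸ hr)]
    simp [h2₅ r hr, n₅, mul_comm]
  obtain ⟨s₆, hs₆⟩ : ∃ s₆, s₆ = (fill 1 (.sum 12 0 (.get 2 (.reg 10)))).run s₅ := ⟨_, rfl⟩
  rw [← hs₆] at h1₆ ⊢
  have h2₆ : ∀ r < n, s₆.arr 2 r = V r := fun r hr => by rw [hs₆, run_arr rfl, h2₅ r hr]
  have hr₆ : ∀ x, s₆.reg x = s₄.reg x := fun x => by rw [hs₆, reg_fill e₆, hr₅]
  have a₆ : s₆.arr 0 = s₁.arr 0 := by rw [hs₆, run_arr rfl, a₅]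
  have hb₆ : HExpr.eval (.reg 41) s₆ = b := by rw [HExpr.eval_reg, hr₆, hs₄]; simp
  rw [hb₆]
  by_cases hbz : b = 0
  · rw [if_neg (not_not.2 hbz)]
    have hbz' : ¬ (s₁.reg 41 ≠ 0 ∨ min n κ * (16 * κ + 8) < #W) := by
      rw [← hb']; exact not_not.2 hbz
    push Not at hbz'
    have hTW : IsTournamentOn W T := by
      have := hTd ▸ h₁.isTournamentOn
      exact ⟨fun x hx => this.1 x (hWn hx), fun x hx y hy => this.2 x (hWn hx) y (hWn hy)⟩
    refine .inr ⟨by rw [hr₆, hs₄]; simpa using hbz, #W, s₁.reg 40, fun x y => T (V x) (V y), ?_, ?_,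
      ?_, ?_, h₁.le, isTournamentOn_renumber hV hTW, ?_, ?_⟩
    · rw [hr₆, hs₄]; simp
    · rw [hr₆, hs₄]; simp [hr₃]
    · exact (card_le_card hWn).trans (card_range n).le
    · exact hbz'.2.trans (Nat.mul_le_mul_right _ (min_le_right _ _))
    · rw [h₁.iff, solvable_renumber hV, hW, solvable_unbalancedPart_iff, hTd]
      tauto
    · intro x hx y hy
      have hcW : #W ≤ n := (card_le_card hWn).trans (card_range n).le
      rw [h1₆ x (by omega), h2₆ y (by omega), a₆, hTd, ← h₁.n_eq]
      rfl
  · rw [if_pos hbz, run_seq, run_set, run_set]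
    left
    refine ⟨?_, fun hPP => ?_, by simp, by simp⟩
    · simp [hr₆, hs₄, hbz]
    · obtain ⟨h41, hsol⟩ := h₁.iff.1 hPP
      have hlt := (hb'.1 hbz).resolve_left (not_not.2 h41)
      obtain ⟨hl, hh⟩ := hsmall.resolve_left (not_not.2 h41)
      have hle := card_unbalancedPart_le h₁.isTournamentOn (κ := κ) (by
          obtain ⟨D, c, h1, h2, h3⟩ := hsol
          exact ⟨D, c, h1, h2.trans h₁.le, h3⟩) hl (fun q hq p hp hqp =>
            hh q (mem_range.1 hq) p (mem_range.1 hp) hqp)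
      rw [← hTd, ← hW] at hle
      have hcW : #W ≤ n := (card_le_card hWn).trans (card_range n).le
      rcases le_total n κ with hnk | hnk
      · rw [min_eq_left hnk] at hlt
        nlinarith
      · rw [min_eq_right hnk] at hlt
        omega

end HProg

/-! ### The machine program for the kernel -/

namespace HProg

open Classical RAM Finset

/-- Write the adjacency matrix of the kernel to array 0, after `prepare`. -/
def output : HProg :=
  ite (.reg 41)
    (fill₂ 0 (.ite (.or (.and (.lt (.reg 10) (.reg 11)) (.lt (.reg 11) (.add (.reg 10) (.const 3))))
      (.and (.eq (.reg 10) (.const 3)) (.eq (.reg 11) (.const 0)))) (.const 1) (.const 0)))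
    (seq (fill₂ 7 (.get 0 (.add (.get 1 (.reg 10)) (.get 2 (.reg 11)))))
      (fill₂ 0 (.ite (.get₂ 7 10 11) (.const 1) (.const 0))))

theorem reg_output (s : Memory) (x : ℕ) : (output.run s).reg x = s.reg x := run_reg rfl s

theorem output_of_ne_zero {s : Memory} (h : s.reg 41 ≠ 0) (hn : s.reg 0 = 4) {x y : ℕ} (hx : x < 4)
    (hy : y < 4) : (output.run s).arr 0 (x * 4 + y) = if strongFour x y then 1 else 0 := by
  rw [output, run_ite, HExpr.eval_reg, if_pos h, arr_fill₂ rfl hn hx hy, HExpr.eval_ite]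
  refine if_congr ?_ rfl rfl
  rw [HExpr.or_ne_zero, HExpr.and_ne_zero, HExpr.and_ne_zero, HExpr.lt_ne_zero, HExpr.lt_ne_zero,
    HExpr.eq_ne_zero, HExpr.eq_ne_zero]
  simp [strongFour]

theorem output_of_eq_zero {m : ℕ} {R : ℕ → ℕ → Prop} {s : Memory} (h : s.reg 41 = 0)
    (hn : s.reg 0 = m) (hR : ∀ x < m, ∀ y < m, s.arr 0 (s.arr 1 x + s.arr 2 y) ≠ 0 ↔ R x y)
    {x y : ℕ} (hx : x < m) (hy : y < m) :
    (output.run s).arr 0 (x * m + y) = if R x y then 1 else 0 := by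
  have e7 : HExpr.reads 7 (.get 0 (.add (.get 1 (.reg 10)) (.get 2 (.reg 11)))) = false := rfl
  rw [output, run_ite, HExpr.eval_reg, if_neg (not_not.2 h), run_seq,
    arr_fill₂ rfl ((reg_fill₂ e7 s 0).trans hn) hx hy, HExpr.eval_ite]
  refine if_congr ?_ rfl rfl
  rw [HExpr.eval_get₂ _ (show 10 ≠ 12 by decide), ← hR x hx y hy]
  simp only [Memory.setReg_reg, Memory.setReg_arr, Nat.reduceEqDiff, if_true, if_false,
    reg_fill₂ e7, hn]
  rw [arr_fill₂ e7 hn hx hy]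
  simp

end HProg

namespace TournamentInstance

open Classical RAM Finset HProg

/-- The machine program that computes the kernel. The order of the instance is changed between two
compiled programs, because the ranges of bounded loops are not changed inside of them. -/
def kernelProgram : Program :=
  .seq (prepare.toProg 50) <| .seq (.setReg 0 (.reg 30)) <| .seq (.setReg 1 (.reg 40)) <|
    output.toProg 50

theorem kernelProgram_spec (I : TournamentInstance) :
    ∃ τ s J, Exec kernelProgram I.input τ s ∧
      τ ≤ prepare.time (I.n + 4) + output.time (I.n + 4) + 4 ∧ IsOutput J s ∧
      (I ∈ EulerianStrongComponentArcDeletion ↔ J ∈ EulerianStrongComponentArcDeletion) ∧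
      J.k ≤ I.k ∧ (J.n ≤ I.k * (16 * I.k + 8) ∨
        I ∉ EulerianStrongComponentArcDeletion ∧ J.n = 4) := by
  have hok : prepare.ok [0] 50 = true := by decide
  have hok' : output.ok [0] 50 = true := by decide
  have hspec := prepare_spec (s := I.input) (n := I.n) (κ := I.k) rfl rfl I.isTournamentOn_input
    (mem_iff_solvable (I := I) I.input_rel)
  obtain ⟨τ₁, s₁, h1, h2, h3⟩ := exec_toProg (B := I.n + 4) hok le_rfl (by decide) (s := I.input)
    (by
      intro b hb
      rw [List.mem_singleton] at hb
      subst hb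
      exact Nat.le_add_right I.n 4)
  have hr : ∀ x < 50, s₁.reg x = (prepare.run I.input).reg x := h3.2
  rw [← h3.1, ← hr 41 (by decide), ← hr 40 (by decide), ← hr 30 (by decide)] at hspec
  obtain ⟨s₂, hs₂⟩ : ∃ s₂, s₂ = (s₁.setReg 0 (s₁.reg 30)).setReg 1 (s₁.reg 40) := ⟨_, rfl⟩
  have r0 : s₂.reg 0 = s₁.reg 30 := by simp [hs₂]
  have r1 : s₂.reg 1 = s₁.reg 40 := by simp [hs₂]
  have r41 : s₂.reg 41 = s₁.reg 41 := by simp [hs₂]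
  have arr₂ : s₂.arr = s₁.arr := by simp [hs₂]
  rw [← r0, ← r1, ← r41, ← arr₂] at hspec
  have hle : s₂.reg 0 ≤ I.n + 4 := by
    rcases hspec with h | ⟨-, m, k, R, h, -, h', -⟩ <;> omega
  obtain ⟨τ₂, s₃, h4, h5, h6⟩ := exec_toProg (B := I.n + 4) hok' le_rfl (by decide) (s := s₂)
    (by
      intro b hb
      rw [List.mem_singleton] at hb
      subst hb
      exact hle)
  have hexec : Exec kernelProgram I.input (τ₁ + (2 + (2 + τ₂))) s₃ := by
    refine .seq h1 (.seq (Exec.setReg s₁ 0 (.reg 30)) (.seq (Exec.setReg _ 1 (.reg 40)) ?_))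
    convert h4 using 1
    rw [hs₂]
    simp [Expr.eval]
  have r0' : s₃.reg 0 = s₂.reg 0 := by rw [h6.2 0 (by decide), reg_output]
  have r1' : s₃.reg 1 = s₂.reg 1 := by rw [h6.2 1 (by decide), reg_output]
  have hτ : τ₁ + (2 + (2 + τ₂)) ≤ prepare.time (I.n + 4) + output.time (I.n + 4) + 4 := by omega
  rcases hspec with ⟨h41, hP, hn, hk⟩ | ⟨h41, m, k, R, hn, hk, -, hm, hkI, hT, hP, hR⟩
  · refine ⟨_, s₃, ofRel 4 0 strongFour isTournamentOn_strongFour, hexec, hτ,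
      isOutput_ofRel _ (r0'.trans hn) (r1'.trans hk) fun x hx y hy => ?_, ?_, Nat.zero_le _,
      .inr ⟨hP, rfl⟩⟩
    · rw [h6.1]; exact output_of_ne_zero h41 hn hx hy
    · rw [ofRel_mem]
      exact iff_of_false hP not_solvable_strongFour
  · refine ⟨_, s₃, ofRel m k R hT, hexec, hτ,
      isOutput_ofRel _ (r0'.trans hn) (r1'.trans hk) fun x hx y hy => ?_, ?_, hkI, .inl hm⟩
    · rw [h6.1]; exact output_of_eq_zero h41 hn hR hx hy
    · rw [ofRel_mem]; exact hP

end TournamentInstance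

/-! ### Exhaustive search -/

theorem Nat.exists_testBit (N : ℕ) (P : ℕ → Prop) :
    ∃ x < 2 ^ N, ∀ p < N, x.testBit p = true ↔ P p := by
  classical
  refine ⟨Nat.ofBits fun i : Fin N => decide (P i), Nat.ofBits_lt_two_pow _, fun p hp => ?_⟩
  rw [Nat.testBit_ofBits_lt _ _ hp]
  simp

section Subsets

open Classical Finset

/-- The subrelation of `T` on the numbers below `n` from which those arcs are deleted that
correspond to the binary digits 1 of `x`. -/
def deleteBits (T : ℕ → ℕ → Prop) (n x p q : ℕ) : Prop := T p q ∧ ¬ x.testBit (p * n + q)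

/-- Deleting the arcs encoded in `x` is a solution. -/
def IsSolutionCode (T : ℕ → ℕ → Prop) (n k x : ℕ) : Prop :=
  numDeleted (range n) T (deleteBits T n x) ≤ k ∧
    IsCyclicallyBalanced (range n) (deleteBits T n x)

theorem IsLeveled.congr {α : Type*} {S : Finset α} {D D' : α → α → Prop} {c : α → ℕ}
    (h : IsLeveled S D c) (hD : ∀ x ∈ S, ∀ y ∈ S, D x y ↔ D' x y) : IsLeveled S D' c := by
  refine ⟨fun x hx y hy hxy => h.1 x hx y hy ((hD x hx y hy).2 hxy), fun v hv => ?_⟩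
  rw [filter_congr (q := fun w => c w = c v ∧ D v w) fun w hw => by rw [hD v hv w hw], h.2 v hv]
  exact congrArg card (filter_congr fun w hw => by rw [hD w hw v hv])

theorem exists_isSolutionCode_iff {T : ℕ → ℕ → Prop} {n k : ℕ} :
    (∃ x < 2 ^ (n * n), IsSolutionCode T n k x) ↔ Solvable (range n) T k := by
  constructor
  · rintro ⟨x, -, h1, h2⟩
    obtain ⟨c, hc⟩ := isCyclicallyBalanced_iff.1 h2
    exact ⟨_, c, fun p _ q _ h => h.1, h1, hc⟩
  · rintro ⟨D, c, h1, h2, h3⟩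
    obtain ⟨x, hx, hbits⟩ := Nat.exists_testBit (n * n) fun p => ¬ D (p / n) (p % n)
    have hD : ∀ p ∈ range n, ∀ q ∈ range n, D p q ↔ deleteBits T n x p q := by
      intro p hp q hq
      rw [mem_range] at hp hq
      have hlt : p * n + q < n * n := by nlinarith
      have hdiv : (p * n + q) / n = p := by
        rw [mul_comm, Nat.mul_add_div (by omega), Nat.div_eq_of_lt hq, add_zero]
      have hmod : (p * n + q) % n = q := by
        rw [mul_comm, Nat.mul_add_mod, Nat.mod_eq_of_lt hq]
      rw [deleteBits, hbits _ hlt, hdiv, hmod, not_not]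
      exact ⟨fun h => ⟨h1 p (mem_range.2 hp) q (mem_range.2 hq) h, h⟩, fun h => h.2⟩
    refine ⟨x, hx, le_of_eq_of_le (congrArg card (filter_congr fun p hp => ?_)) h2,
      isCyclicallyBalanced_iff.2 ⟨c, h3.congr hD⟩⟩
    rw [hD p.1 (mem_product.1 hp).1 p.2 (mem_product.1 hp).2]

end Subsets

namespace HProg

open Classical RAM Finset

/-- Write `2 ^ (n * n)` to register 42. -/
def powerOfTwo : HProg :=
  seq (set 42 (.const 1)) (loop 20 0 (loop 21 0 (set 42 (.add (.reg 42) (.reg 42)))))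

/-- Two nested loops over the numbers below `n` run through the numbers below `n * n`. -/
theorem run_loop_loop_induction {n : ℕ} {p : HProg} {s : Memory} (hn : s.reg 0 = n)
    (hp : p.writes 0 = false) (I : ℕ → Memory → Prop) (h0 : I 0 s)
    (hset : ∀ i s' x v, (x = 20 ∨ x = 21) → I i s' → I i (s'.setReg x v))
    (hstep : ∀ i < n, ∀ j < n, ∀ s', s'.reg 0 = n → s'.reg 20 = i → s'.reg 21 = j →
      I (i * n + j) s' → I (i * n + j + 1) (p.run s')) (hp' : p.writes 20 = false) :
    I (n * n) ((loop 20 0 (loop 21 0 p)).run s) := by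
  obtain ⟨s', ⟨h1, h2⟩, hs'⟩ := run_loop_induction (x := 20) (b := 0) (p := loop 21 0 p) (s := s)
    (fun i s' => I (i * n) s' ∧ s'.reg 0 = n) ⟨by simpa using h0, hn⟩ (by
      rintro i hi s' ⟨h1, h2⟩
      obtain ⟨s'', ⟨h3, h4, h5⟩, hs''⟩ := run_loop_induction (x := 21) (b := 0) (p := p)
        (s := s'.setReg 20 i) (fun j s' => I (i * n + j) s' ∧ s'.reg 0 = n ∧ s'.reg 20 = i)
        ⟨hset _ _ _ _ (.inl rfl) h1, by simpa using h2, by simp⟩ (by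
          rintro j hj s'' ⟨h3, h4, h5⟩
          have hj' : j < n := by simpa [h2] using hj
          refine ⟨hstep i (hn ▸ hi) j hj' _ (by simpa using h4) (by simpa using h5) (by simp)
            (hset _ _ _ _ (.inr rfl) h3), ?_, ?_⟩
          · rw [run_reg hp]; simpa using h4
          · rw [run_reg hp']; simpa using h5)
      rw [hs'']
      refine ⟨hset _ _ _ _ (.inr rfl) ?_, by simpa using h4⟩
      have : (i + 1) * n = i * n + n := by ring
      rw [this]
      simpa [h2] using h3)
  rw [hs']
  exact hset _ _ _ _ (.inl rfl) (hn ▸ h1)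

theorem powerOfTwo_spec {n : ℕ} {s : Memory} (hn : s.reg 0 = n) :
    (powerOfTwo.run s).reg 42 = 2 ^ (n * n) := by
  rw [powerOfTwo, run_seq, run_set]
  refine run_loop_loop_induction (by simpa using hn) rfl (fun i s' => s'.reg 42 = 2 ^ i) (by simp)
    ?_ ?_ rfl
  · rintro i s' x v (rfl | rfl) h <;> simpa using h
  · intro i _ j _ s' _ _ _ h
    rw [run_set]
    simp [h, pow_succ]
    omega

/-- Half the content of register 43, rounded down, if this is not above the content of register 2.
-/
def half : HExpr :=
  .sum 13 2 (.le (.add (.times 2 (.reg 13)) (.const 2)) (.reg 43))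

theorem eval_half {s : Memory} (h : s.reg 43 / 2 ≤ s.reg 2) : half.eval s = s.reg 43 / 2 := by
  have h1 : ∀ i ∈ range (s.reg 2), (HExpr.le (.add (.times 2 (.reg 13)) (.const 2)) (.reg 43)).eval
      (s.setReg 13 i) = if i ∈ range (s.reg 43 / 2) then 1 else 0 := by
    intro i _
    rw [HExpr.eval_le]
    refine if_congr ?_ rfl rfl
    simp
    omega
  rw [half, HExpr.eval_sum, sum_congr rfl h1, sum_boole, filter_mem_eq_inter,
    inter_eq_right.2 (range_subset_range.2 h), card_range, Nat.cast_id]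

/-- Write the `n * n` binary digits of the number in register 43 to array 3. -/
def bits : HProg :=
  loop 20 0 (loop 21 0 (seq (store 3 (cell 20 21) (.sub (.reg 43) (.add half half)))
    (set 43 half)))

theorem bits_spec {n x : ℕ} {s : Memory} (hn : s.reg 0 = n) (hx : s.reg 43 = x)
    (h2 : x ≤ s.reg 2) {p : ℕ} (hp : p < n * n) :
    (bits.run s).arr 3 p ≠ 0 ↔ x.testBit p = true := by
  have := run_loop_loop_induction (p := seq (store 3 (cell 20 21) (.sub (.reg 43) (.add half half)))
    (set 43 half)) hn rfl (fun i s' => s'.reg 43 = x / 2 ^ i ∧ x ≤ s'.reg 2 ∧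
      ∀ p < i, s'.arr 3 p ≠ 0 ↔ x.testBit p = true) ⟨by simpa using hx, h2, by simp⟩ (by
        rintro i s' x v (rfl | rfl) h <;> simpa using h) (by
        rintro i hi j hj s' h0 h20 h21 ⟨h43, h2, hb⟩
        have hle : s'.reg 43 / 2 ≤ s'.reg 2 := by
          rw [h43]
          exact (Nat.div_le_self _ _).trans ((Nat.div_le_self _ _).trans h2)
        rw [run_seq, run_store, run_set, eval_cell (by decide), h20, h21, h0, HExpr.eval_sub,
          HExpr.eval_add, eval_half hle, eval_half (by simpa using hle)]
        refine ⟨?_, by simpa using h2, fun p hp => ?_⟩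
        · simp [h43, pow_succ, Nat.div_div_eq_div_mul]
        · simp only [Memory.setReg_arr, Memory.setArr_arr, true_and]
          split_ifs with hpp
          · rw [hpp, Nat.testBit_eq_decide_div_mod_eq, HExpr.eval_reg, h43, decide_eq_true_iff]
            omega
          · exact hb p (by omega)) rfl
  exact this.2.2 p hp

/-- The arcs of array 6 form a solution. -/
def isSolution : HExpr :=
  .and (.le (.sum 13 0 (.count 14 0 (.and (.get₂ 0 13 14) (.not (.get₂ 6 13 14))))) (.reg 1))
    (.not (.count 13 0 (unbalancedAt 6)))

/-- Write 1 to register 45 if the arcs given by the binary digits of register 22 are a solution. -/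
def tryCode : HProg :=
  seq (set 43 (.reg 22)) <| seq bits <|
  seq (fill₂ 6 (.and (.get₂ 0 10 11) (.not (.get₂ 3 10 11)))) <| seq (closure 6) <|
  when isSolution (set 45 (.const 1))

theorem tryCode_spec {n k x : ℕ} {s : Memory} (hn : s.reg 0 = n) (hk : s.reg 1 = k)
    (hx : s.reg 22 = x) (h2 : x ≤ s.reg 2) :
    (tryCode.run s).reg 45 = if IsSolutionCode (s.rel 0) n k x then 1 else s.reg 45 := by
  rw [tryCode, run_seq, run_seq, run_seq, run_seq, run_set, run_when, run_set]
  have hb := fun {p : ℕ} (hp : p < n * n) => bits_spec (s := s.setReg 43 x) (x := x)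
    (by simpa using hn) (by simp) (by simpa using h2) hp
  rw [HExpr.eval_reg, hx]
  obtain ⟨s₁, hs₁⟩ : ∃ s₁, s₁ = bits.run (s.setReg 43 x) := ⟨_, rfl⟩
  rw [← hs₁] at hb ⊢
  have hr₁ : ∀ y, y ≠ 43 → s₁.reg y = s.reg y := fun y hy => by
    rw [hs₁, run_reg (by simpa [bits, writes] using hy.symm)]; simp [hy]
  have a₁ : s₁.arr 0 = s.arr 0 := by rw [hs₁, run_arr rfl]; rfl
  have n₁ : s₁.reg 0 = n := by rw [hr₁ 0 (by decide), hn]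
  have e₆ : HExpr.reads 6 (.and (.get₂ 0 10 11) (.not (.get₂ 3 10 11))) = false := rfl
  have h6 : ∀ p < n, ∀ q < n, ((fill₂ 6 (.and (.get₂ 0 10 11) (.not (.get₂ 3 10 11)))).run s₁).rel
      6 p q ↔ deleteBits (s.rel 0) n x p q := by
    intro p hp q hq
    have hlt : p * n + q < n * n := by nlinarith
    rw [Memory.rel, reg_fill₂ e₆, n₁, arr_fill₂ e₆ n₁ hp hq, HExpr.and_ne_zero, HExpr.not_ne_zero,
      deleteBits, ← hb hlt]
    simp [Memory.rel, n₁, hn, a₁]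
  obtain ⟨s₂, hs₂⟩ : ∃ s₂, s₂ = (fill₂ 6 (.and (.get₂ 0 10 11) (.not (.get₂ 3 10 11)))).run s₁ :=
    ⟨_, rfl⟩
  rw [← hs₂] at h6 ⊢
  have hr₂ : ∀ y, s₂.reg y = s₁.reg y := fun y => by rw [hs₂, reg_fill₂ e₆]
  have n₂ : s₂.reg 0 = n := by rw [hr₂, n₁]
  have hcl := fun {p q : ℕ} (hp : p < n) (hq : q < n) =>
    closure_spec (a := 6) (by decide) n₂ hp hq
  obtain ⟨s₃, hs₃⟩ : ∃ s₃, s₃ = (closure 6).run s₂ := ⟨_, rfl⟩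
  rw [← hs₃] at hcl ⊢
  have hr₃ : ∀ y, s₃.reg y = s₁.reg y := fun y => by rw [hs₃, run_reg rfl, hr₂]
  have n₃ : s₃.reg 0 = n := by rw [hr₃, n₁]
  have T₃ : s₃.rel 0 = s.rel 0 := by
    unfold Memory.rel
    rw [n₃, hn, hs₃, run_arr rfl, hs₂, run_arr rfl, a₁]
  have D₃ : s₃.rel 6 = s₂.rel 6 := by
    unfold Memory.rel
    rw [n₃, n₂, hs₃, run_arr rfl]
  rw [← D₃] at h6 hcl
  obtain ⟨T, hT⟩ : ∃ T, T = s.rel 0 := ⟨_, rfl⟩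
  obtain ⟨D, hD⟩ : ∃ D, D = s₃.rel 6 := ⟨_, rfl⟩
  rw [← hD] at h6 hcl
  have hcond : isSolution.eval s₃ ≠ 0 ↔ IsSolutionCode (s.rel 0) n k x := by
    rw [isSolution, HExpr.and_ne_zero, HExpr.le_ne_zero, HExpr.not_ne_zero,
      HExpr.eval_sum_count n₃ (P := fun p q => T p q ∧ ¬ D p q), HExpr.eval_count_ne_zero, n₃,
      IsSolutionCode]
    · refine and_congr ?_ ?_
      · have hdel : #{p ∈ range n ×ˢ range n | T p.1 p.2 ∧ ¬ D p.1 p.2} =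
            numDeleted (range n) (s.rel 0) (deleteBits (s.rel 0) n x) := by
          unfold numDeleted
          refine congrArg card (filter_congr fun p hp => ?_)
          rw [hT, h6 p.1 (mem_range.1 (mem_product.1 hp).1) p.2 (mem_range.1 (mem_product.1 hp).2)]
        rw [HExpr.eval_reg, hr₃, hr₁ 1 (by decide), hk]
        refine iff_of_eq (congrArg (· ≤ k) ?_)
        convert hdel
      · have hbal : IsCyclicallyBalanced (range n) D ↔
            IsCyclicallyBalanced (range n) (deleteBits (s.rel 0) n x) := by
          rw [isCyclicallyBalanced_iff, isCyclicallyBalanced_iff]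
          have h6' : ∀ p ∈ range n, ∀ q ∈ range n, D p q ↔ deleteBits (s.rel 0) n x p q :=
            fun p hp q hq => h6 p (mem_range.1 hp) q (mem_range.1 hq)
          exact ⟨fun ⟨c, hc⟩ => ⟨c, hc.congr h6'⟩,
            fun ⟨c, hc⟩ => ⟨c, hc.congr fun p hp q hq => (h6' p hp q hq).symm⟩⟩
        rw [← hbal]
        push Not
        refine forall_congr' fun u => ?_
        rw [mem_range]
        refine forall_congr' fun hu => ?_
        have := unbalancedAt_spec (a := 6) n₃ (by
          intro p hp q hq
          rw [Memory.rel, n₃, ← hD]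
          exact hcl hp hq) hu
        rw [← hD] at this
        rw [← not_iff_not, ← ne_eq, this, IsCyclicallyBalancedAt]
    · intro p _ q _
      rw [HExpr.and_ne_zero, HExpr.not_ne_zero, hT, ← T₃, hD]
      simp [Memory.rel]
  by_cases hcon : IsSolutionCode (s.rel 0) n k x
  · rw [if_pos hcon, if_pos (hcond.2 hcon)]; simp
  · rw [if_neg hcon, if_neg (fun h => hcon (hcond.1 h)), hr₃, hr₁ 45 (by decide)]

/-- Try all codes below the content of register 2. -/
def search : HProg := seq (set 45 (.const 0)) (loop 22 2 tryCode)

theorem search_spec {n k : ℕ} {s : Memory} (hn : s.reg 0 = n) (hk : s.reg 1 = k)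
    (h2 : s.reg 2 = 2 ^ (n * n)) :
    (search.run s).reg 45 = if Solvable (range n) (s.rel 0) k then 1 else 0 := by
  rw [search, run_seq, run_set]
  obtain ⟨s', ⟨-, -, -, -, h⟩, hs'⟩ := run_loop_induction (x := 22) (b := 2) (p := tryCode)
    (s := s.setReg 45 ((HExpr.const 0).eval s)) (fun i s' => s'.reg 0 = n ∧ s'.reg 1 = k ∧
      s'.reg 2 = 2 ^ (n * n) ∧ s'.rel 0 = s.rel 0 ∧
      s'.reg 45 = if ∃ x < i, IsSolutionCode (s.rel 0) n k x then 1 else 0)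
    ⟨by simpa using hn, by simpa using hk, by simpa using h2, by rw [rel_setReg (by decide)],
      by simp⟩ (by
      rintro i hi s' ⟨h3, h4, h5, h6, h7⟩
      have hi' : i < 2 ^ (n * n) := by simpa [h2] using hi
      have r0 : (tryCode.run (s'.setReg 22 i)).reg 0 = n := by
        rw [run_reg rfl]; simpa using h3
      refine ⟨r0, ?_, ?_, ?_, ?_⟩
      · rw [run_reg rfl]; simpa using h4
      · rw [run_reg rfl]; simpa using h5
      · rw [← h6]; unfold Memory.rel
        rw [r0, h3, run_arr rfl]; rfl
      · rw [tryCode_spec (n := n) (k := k) (x := i) (by simpa using h3) (by simpa using h4)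
          (by simp) (by simp [h5]; omega), rel_setReg (by decide), h6]
        have : (∃ x < i + 1, IsSolutionCode (s.rel 0) n k x) ↔
            IsSolutionCode (s.rel 0) n k i ∨ ∃ x < i, IsSolutionCode (s.rel 0) n k x := by
          constructor
          · rintro ⟨x, hx, hh⟩
            rcases Nat.lt_succ_iff_lt_or_eq.1 hx with hx | rfl
            · exact .inr ⟨x, hx, hh⟩
            · exact .inl hh
          · rintro (hh | ⟨x, hx, hh⟩)
            · exact ⟨i, by omega, hh⟩
            · exact ⟨x, by omega, hh⟩
        rw [if_congr this rfl rfl]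
        by_cases hi : IsSolutionCode (s.rel 0) n k i
        · rw [if_pos hi, if_pos (.inl hi)]
        · rw [if_neg hi, Memory.setReg_reg, if_neg (by decide), h7]
          exact if_congr ⟨.inr, fun h => h.resolve_left hi⟩ rfl rfl)
  rw [hs', Memory.setReg_reg, if_neg (by decide), h]
  refine if_congr ?_ rfl rfl
  simp only [Memory.setReg_reg, Nat.reduceEqDiff, if_false, h2]
  exact exists_isSolutionCode_iff

end HProg

/-! ### The running times -/

namespace TournamentInstance

open Classical RAM Finset HProg

/-- The machine program that tries all sets of arcs. -/
def searchProgram : Program :=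
  .seq (powerOfTwo.toProg 50) <| .seq (.setReg 2 (.reg 42)) <| .seq (search.toProg 50) <|
    .setReg 0 (.reg 45)

theorem searchProgram_spec {I : TournamentInstance} {s : Memory} (h : I.IsOutput s) :
    ∃ τ s', Exec searchProgram s τ s' ∧
      τ ≤ powerOfTwo.time I.n + search.time (I.n + 2 ^ (I.n * I.n)) + 4 ∧
      s'.reg 0 = if I ∈ EulerianStrongComponentArcDeletion then 1 else 0 := by
  obtain ⟨hn, hk, hm⟩ := h
  have hok : powerOfTwo.ok [0] 50 = true := by decide
  have hok' : search.ok [0, 2] 50 = true := by decide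
  have hrel : ∀ i j : Fin I.n, s.rel 0 i j ↔ I.T.Adj i j := by
    intro i j
    have hlt : i * I.n + j < I.n * I.n := by nlinarith [i.2, j.2]
    rw [Memory.rel, hn, hm _ hlt, matrix_apply]
    simp
  obtain ⟨τ₁, s₁, h1, h2, h3⟩ := exec_toProg (B := I.n) hok le_rfl (by decide) (s := s) (by
    intro b hb
    rw [List.mem_singleton] at hb
    subst hb
    exact hn.le)
  have n₁ : s₁.reg 0 = I.n := by rw [h3.2 0 (by decide), run_reg rfl, hn]
  have k₁ : s₁.reg 1 = I.k := by rw [h3.2 1 (by decide), run_reg rfl, hk]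
  have p₁ : s₁.reg 42 = 2 ^ (I.n * I.n) := by rw [h3.2 42 (by decide), powerOfTwo_spec hn]
  have T₁ : s₁.rel 0 = s.rel 0 := by
    unfold Memory.rel; rw [n₁, hn, h3.1, run_arr rfl]
  obtain ⟨s₂, hs₂⟩ : ∃ s₂, s₂ = s₁.setReg 2 (s₁.reg 42) := ⟨_, rfl⟩
  have n₂ : s₂.reg 0 = I.n := by simp [hs₂, n₁]
  have p₂ : s₂.reg 2 = 2 ^ (I.n * I.n) := by simp [hs₂, p₁]
  obtain ⟨τ₂, s₃, h4, h5, h6⟩ := exec_toProg (B := I.n + 2 ^ (I.n * I.n)) hok' le_rfl (by decide)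
    (s := s₂) (by
      intro b hb
      simp only [List.mem_cons, List.not_mem_nil, or_false] at hb
      rcases hb with rfl | rfl <;> omega)
  refine ⟨τ₁ + (2 + (τ₂ + 2)), s₃.setReg 0 (s₃.reg 45), .seq h1 (.seq (Exec.setReg s₁ 2 (.reg 42))
    (.seq ?_ (Exec.setReg s₃ 0 (.reg 45)))), by omega, ?_⟩
  · rw [hs₂] at h4; exact h4
  · rw [Memory.setReg_reg, if_pos rfl, h6.2 45 (by decide),
      search_spec n₂ (show s₂.reg 1 = I.k by simp [hs₂, k₁]) p₂]
    refine if_congr ?_ rfl rfl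
    rw [hs₂, rel_setReg (by decide), T₁, mem_iff_solvable hrel]

/-- A polynomial bound in the order of the tournament, for the time of a program on a slightly
larger range, is a polynomial bound in the size of the instance. -/
theorem exists_le_size_pow {f : ℕ → ℕ} (hf : PolyBounded f) :
    ∃ C c, ∀ I : TournamentInstance, f (I.n + 4) ≤ C * I.size ^ c := by
  obtain ⟨C, c, h⟩ := hf
  refine ⟨C * 6 ^ c, c, fun I => (h _).trans ?_⟩
  rw [mul_assoc, ← mul_pow]
  refine Nat.mul_le_mul_left _ (Nat.pow_le_pow_left ?_ _)
  unfold size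
  nlinarith [Nat.le_mul_self I.n]

theorem exists_kernelProgram_bound : ∃ C c, ∀ I : TournamentInstance,
    prepare.time (I.n + 4) + output.time (I.n + 4) + 4 ≤ C * I.size ^ c :=
  exists_le_size_pow (f := fun B => prepare.time B + output.time B + 4)
    ((prepare.polyBounded_time.add output.polyBounded_time).add (.const 4))

/-- Compute the kernel, and solve it by exhaustive search, in a time that depends on `k` only. -/
theorem fixedParameterTractable : FixedParameterTractable EulerianStrongComponentArcDeletion := by
  obtain ⟨C, c, hC⟩ := exists_kernelProgram_bound
  obtain ⟨F, hF⟩ : ∃ F : ℕ → ℕ, ∀ n, F n = powerOfTwo.time n + search.time (n + 2 ^ (n * n)) + 4 :=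
    ⟨_, fun _ => rfl⟩
  refine ⟨.seq kernelProgram searchProgram,
    fun k => C + ∑ n ∈ range (k * (16 * k + 8) + 5), F n, c, fun I => ?_⟩
  obtain ⟨τ₁, s₁, J, h1, h2, h3, h4, -, h6⟩ := kernelProgram_spec I
  obtain ⟨τ₂, s₂, h7, h8, h9⟩ := searchProgram_spec h3
  refine ⟨τ₁ + τ₂, s₂, h1.seq h7, ?_, fun h => ?_, fun h => ?_⟩
  · rw [← hF] at h8
    have hn : J.n ∈ range (I.k * (16 * I.k + 8) + 5) := mem_range.2 (by omega)
    have hle := single_le_sum (f := F) (fun _ _ => Nat.zero_le _) hn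
    have hpos : 1 ≤ I.size ^ c := Nat.one_le_pow _ _ (Nat.succ_pos _)
    have := h2.trans (hC I)
    rw [add_mul]
    exact Nat.add_le_add this (h8.trans (hle.trans (Nat.le_mul_of_pos_right _ hpos)))
  · rw [h9, if_pos (h4.1 h)]
  · rw [h9, if_neg fun hJ => h (h4.2 hJ)]

end TournamentInstance

open TournamentInstance in
theorem theorem1 :
    FixedParameterTractable EulerianStrongComponentArcDeletion ∧
      ∃ K : TournamentInstance → TournamentInstance,
        IsKernelization EulerianStrongComponentArcDeletion K ∧
          ∀ I : TournamentInstance,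
            (K I).n ≤ 4 * I.k * (4 * I.k + 2) ∨
              (I.k = 0 ∧ I ∉ EulerianStrongComponentArcDeletion ∧ (K I).n ≤ 4) := by
  refine ⟨fixedParameterTractable, ?_⟩
  choose τ s K h1 h2 h3 h4 h5 h6 using kernelProgram_spec
  obtain ⟨C, c, hC⟩ := exists_kernelProgram_bound
  refine ⟨K, ⟨⟨kernelProgram, C, c, fun I => ⟨τ I, s I, h1 I, ?_, h3 I⟩⟩, h4, ⟨id, h5⟩,
    fun k => (k * (16 * k + 8) + 4) * (k * (16 * k + 8) + 4) + 1, fun I => ?_⟩, fun I => ?_⟩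
  · exact ((h2 I).trans (hC I)).trans
      (Nat.mul_le_mul_left _ (Nat.pow_le_pow_left (Nat.le_add_right _ _) _))
  · have hn : (K I).n ≤ I.k * (16 * I.k + 8) + 4 := by
      have := h6 I
      omega
    exact Nat.succ_le_succ (Nat.mul_le_mul hn hn)
  · have heq : 4 * I.k * (4 * I.k + 2) = I.k * (16 * I.k + 8) := by ring
    rw [heq]
    rcases h6 I with h | ⟨h, h'⟩
    · exact .inl h
    · rcases Nat.eq_zero_or_pos I.k with hk | hk
      · exact .inr ⟨hk, h, h'.le⟩
      -- the fixed no-instance with four vertices is small enough if `k` is positive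
      · exact .inl (by nlinarith)
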